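/- **Setting.** A battery has interval length $T>0$, energy capacity $E>0$, power rating $P>0$, cell replacement price $R>0$, charge and discharge efficiencies $\eta_c,\eta_d>0$, and energy limits $\underline e\le\overline e$ with $\overline e-\underline e\le E$. Penalty prices are $\theta,\pi\ge 0$. The cycle stress function $\Phi:[0,1]\to[0,\infty)$ is strictly convex with $\Phi(0)=0$. Controls $(c_n,d_n)_{n<N}$ move the stored energy by $e_{n+1}=e_n+T\eta_c c_n-(T/\eta_d)d_n$. They are *feasible* from $e_0$ if $\underline e\le e_n\le\overline e$ for all $n\le N$ and, for all $n<N$, $0\le c_n\le P$, $0\le d_n\le P$, and $c_n=0$ or $d_n=0$. Given instructions $r_n\in[-P,P]$ (positive means charge), they *respond within the instruction* if moreover $c_n\le[r_n]^+$ and $d_n\le[-r_n]^+$. The cost is $J(c,d,r)=ER\,\Delta L+T\theta\sum_n[r_n-c_n+d_n]^+ +T\pi\sum_n[c_n-d_n-r_n]^+$. Here $\Delta L=\sum_i\Phi(u_i)+\tfrac12\sum_i\Phi(v_i)+\tfrac12\sum_i\Phi(w_i)$, where $u_i,v_i,w_i$ are the depths of the full cycles, charge half cycles and discharge half cycles that rainflow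 counting finds in the profile $(e_n-e_0)/E$. Rainflow counting works on the list of local extrema (end points included): for consecutive points $s_1,s_2,s_3,s_4$ with $|s_2-s_3|\le|s_1-s_2|$ and $|s_2-s_3|\le|s_3-s_4|$ it records a full cycle of depth $|s_2-s_3|$ and deletes $s_2,s_3$; otherwise it moves forward one point; this is repeated until no such four points remain. Each step between adjacent points of what remains is a half cycle, charge if increasing and discharge if decreasing. Put $$J_u(x)=ER\,\Phi(x)-E(\theta/\eta_c+\pi\eta_d)x,\quad J_v(x)=\tfrac12ER\,\Phi(x)-\tfrac{E}{\eta_c}\theta x,\quad J_w(x)=\tfrac12ER\,\Phi(x)-E\eta_d\pi x,$$ and let $\hat u,\hat v,\hat w$ be their minimizers on the domain $[0,1]$ of $\Phi$. The threshold policy $g$, started at $e_0$, keeps the running maximum $e^{\max}_n$ and minimum $e^{\min}_n$ of $e_0,\dots,e_n$. If $r_n\ge0$ it sets $d_n=0$ and $c_n=\min\{\frac1{T\eta_c}(\min\{\overline e,e^{\min}_n+\hat uE\}-e_n),\,r_n\}$. If $r_n<0$ it sets $c_n=0$ and $d_n=\min\{\frac{\eta_d}{T}(e_n-\max\{\underline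 e,e^{\max}_n-\hat uE\}),\,-r_n\}$. **Theorem 2.** Let $$\varepsilon=\begin{cases}J_w(\hat u)+2J_v(\hat u)-J_w(\hat w)-2J_v(\hat v)&\text{if }\pi\eta_d>\theta/\eta_c,\\ 0&\text{if }\pi\eta_d=\theta/\eta_c,\\ 2J_w(\hat u)+J_v(\hat u)-2J_w(\hat w)-J_v(\hat v)&\text{if }\pi\eta_d<\theta/\eta_c.\end{cases}$$ 1. For every $N\in\mathbb N$, every $e_0\in[\underline e,\overline e]$, every $r\in[-P,P]^N$ and every feasible $(c,d)$ that responds within the instruction, $J(g(e_0,r),r)-J(c,d,r)\le\varepsilon$. 2. Suppose $\pi\eta_d=\theta/\eta_c$, or the energy range is wide enough that $(\hat u+|\hat w-\hat v|)E\le\overline e-\underline e$. Then $\varepsilon$ is exactly the worst-case optimality gap: it is the maximum of $J(g(e_0,r),r)-J(c^*,d^*,r)$ over all $N$, all $e_0\in[\underline e,\overline e]$, all $r\in[-P,P]^N$, and all offline minimizers $(c^*,d^*)$ of $J(\cdot,\cdot,r)$ among the feasible controls that respond within the instruction. 3. If $\eta_c\eta_d=1$ (no losses), then 1 and 2 also hold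 with all feasible controls in place of those that respond within the instruction. -/

import Mathlib

noncomputable section

namespace BatteryRegulation

/-! ### Rainflow cycle counting -/

/-- The successive local extrema of a profile (its first and last points included). A point lying
between its two neighbours is not an extremum, and repeated values are merged. -/
def localExtrema : List ℝ → List ℝ
  | [] => []
  | [a] => [a]
  | [a, b] => if a = b then [a] else [a, b]
  | a :: b :: c :: l =>
      if (a ≤ b ∧ b ≤ c) ∨ (c ≤ b ∧ b ≤ a) then localExtrema (a :: c :: l)
      else a :: localExtrema (b :: c :: l)
termination_by l => l.length

/-- One forward sweep of the rainflow procedure over a list of extrema. Looking at four consecutive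
points `s₁ s₂ s₃ s₄`, if `|s₂ - s₃|` is at most `|s₁ - s₂|` and at most `|s₃ - s₄|`, a full cycle of
depth `|s₂ - s₃|` is recorded and `s₂, s₃` are removed; otherwise the window moves forward by one
point. Returns the depths recorded and the remaining profile. -/
def rainflowSweep : List ℝ → List ℝ × List ℝ
  | s₁ :: s₂ :: s₃ :: s₄ :: l =>
      if |s₂ - s₃| ≤ |s₁ - s₂| ∧ |s₂ - s₃| ≤ |s₃ - s₄| then
        let q := rainflowSweep (s₁ :: s₄ :: l)
        (|s₂ - s₃| :: q.1, q.2)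
      else
        let q := rainflowSweep (s₂ :: s₃ :: s₄ :: l)
        (q.1, s₁ :: q.2)
  | l => ([], l)
termination_by l => l.length

/-- `k` successive sweeps: all full-cycle depths recorded, and the profile that remains. -/
def rainflowSweeps : ℕ → List ℝ → List ℝ × List ℝ
  | 0, l => ([], l)
  | k + 1, l =>
      let q := rainflowSweep l
      let q' := rainflowSweeps k q.2
      (q.1 ++ q'.1, q'.2)

/-- Depths of the charge (increasing) half cycles between adjacent points of a residue. -/
def chargeHalfCycles : List ℝ → List ℝ
  | a :: b :: l => if a < b then (b - a) :: chargeHalfCycles (b :: l) else chargeHalfCycles (b :: l)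
  | _ => []

/-- Depths of the discharge (decreasing) half cycles between adjacent points of a residue. -/
def dischargeHalfCycles : List ℝ → List ℝ
  | a :: b :: l =>
      if b < a then (a - b) :: dischargeHalfCycles (b :: l) else dischargeHalfCycles (b :: l)
  | _ => []

/-- The result of cycle counting: depths of full cycles, charge half cycles, discharge half cycles. -/
structure Cycles where
  full : List ℝ
  charge : List ℝ
  discharge : List ℝ

/-- Rainflow counting of a profile, with the residue decomposed into half cycles. A sweep that
records a cycle shortens the profile, and a sweep that records none leaves it unchanged, so as many
sweeps as there are points exhaust all full cycles. -/
def rainflow (profile : List ℝ) : Cycles :=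
  let s := localExtrema profile
  let q := rainflowSweeps s.length s
  { full := q.1
    charge := chargeHalfCycles q.2
    discharge := dischargeHalfCycles q.2 }

/-- Total life loss: `Φ` of each full cycle plus half of `Φ` of each half cycle. -/
def lifeLoss (Φ : ℝ → ℝ) (y : Cycles) : ℝ :=
  (y.full.map Φ).sum + (y.charge.map fun v => Φ v / 2).sum + (y.discharge.map fun w => Φ w / 2).sum

/-! ### Battery, market and objective -/

/-- The data of the problem: interval length `T`, energy capacity `E`, replacement price `R`,
power rating `P`, charge and discharge efficiencies `ηc`, `ηd`, minimum and maximum energy levels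
`eLo`, `eHi`, penalty prices `θ` (surplus injection or deficient demand) and `π` (deficient
injection or surplus demand), and the cycle depth stress function `Φ` (used on `[0, 1]` only). -/
structure Model where
  T : ℝ
  E : ℝ
  R : ℝ
  P : ℝ
  ηc : ℝ
  ηd : ℝ
  eLo : ℝ
  eHi : ℝ
  θ : ℝ
  π : ℝ
  Φ : ℝ → ℝ

namespace Model

variable (M : Model)

/-- The stored energy after `n` intervals, starting from `e₀`, under charge controls `c` and
discharge controls `d`. -/
def soc (e₀ : ℝ) (c d : ℕ → ℝ) : ℕ → ℝ
  | 0 => e₀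
  | n + 1 => soc e₀ c d n + (M.T * M.ηc * c n - M.T / M.ηd * d n)

/-- The normalized profile over `N` intervals, as a list of `N + 1` points starting at `0`. -/
def profile (N : ℕ) (c d : ℕ → ℝ) : List ℝ :=
  (List.range (N + 1)).map fun n => M.soc 0 c d n / M.E

/-- Cycle aging cost. -/
def agingCost (N : ℕ) (c d : ℕ → ℝ) : ℝ :=
  lifeLoss M.Φ (rainflow (M.profile N c d)) * (M.E * M.R)

/-- Performance penalty; `r n > 0` is a charge instruction. -/
def penalty (N : ℕ) (c d r : ℕ → ℝ) : ℝ :=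
  M.T * M.θ * ∑ n ∈ Finset.range N, max (r n - c n + d n) 0 +
    M.T * M.π * ∑ n ∈ Finset.range N, max (c n - d n - r n) 0

/-- The total operating cost of a pair of control sequences `x = (c, d)`. -/
def cost (N : ℕ) (r : ℕ → ℝ) (x : (ℕ → ℝ) × (ℕ → ℝ)) : ℝ :=
  M.agingCost N x.1 x.2 + M.penalty N x.1 x.2 r

/-- Controls `(c, d)` satisfying the battery's operation constraints over `N` intervals. -/
def feasible (N : ℕ) (e₀ : ℝ) : Set ((ℕ → ℝ) × (ℕ → ℝ)) :=
  {x | (∀ n ≤ N, M.soc e₀ x.1 x.2 n ∈ Set.Icc M.eLo M.eHi) ∧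
    ∀ n < N, x.1 n ∈ Set.Icc 0 M.P ∧ x.2 n ∈ Set.Icc 0 M.P ∧ (x.1 n = 0 ∨ x.2 n = 0)}

/-- Feasible controls whose response never exceeds the regulation instruction:
`c n ≤ [r n]⁺` and `d n ≤ [-r n]⁺`. -/
def responsive (N : ℕ) (e₀ : ℝ) (r : ℕ → ℝ) : Set ((ℕ → ℝ) × (ℕ → ℝ)) :=
  {x | x ∈ M.feasible N e₀ ∧ ∀ n < N, x.1 n ≤ max (r n) 0 ∧ x.2 n ≤ max (-r n) 0}

/-! ### The threshold policy -/

/-- What the controller knows at an interval: the current energy level and its running maximum and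
minimum since the beginning of the operation. -/
structure PolicyState where
  e : ℝ
  eMax : ℝ
  eMin : ℝ

/-- The action `(c, d)` of the policy with depth threshold `u` in state `s` on instruction `ρ`. -/
def policyAction (u : ℝ) (s : PolicyState) (ρ : ℝ) : ℝ × ℝ :=
  if 0 ≤ ρ then
    (min (1 / (M.T * M.ηc) * (min M.eHi (s.eMin + u * M.E) - s.e)) ρ, 0)
  else
    (0, min (M.ηd / M.T * (s.e - max M.eLo (s.eMax - u * M.E))) (-ρ))

/-- The state of the controller at interval `n`. -/
def policyState (u e₀ : ℝ) (r : ℕ → ℝ) : ℕ → PolicyState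
  | 0 => ⟨e₀, e₀, e₀⟩
  | n + 1 =>
      let s := policyState u e₀ r n
      let a := M.policyAction u s (r n)
      let e' := s.e + (M.T * M.ηc * a.1 - M.T / M.ηd * a.2)
      ⟨e', max s.eMax e', min s.eMin e'⟩

/-- The controls `g(e₀, r)` produced by the threshold policy. -/
def policy (u e₀ : ℝ) (r : ℕ → ℝ) : (ℕ → ℝ) × (ℕ → ℝ) :=
  (fun n => (M.policyAction u (M.policyState u e₀ r n) (r n)).1,
    fun n => (M.policyAction u (M.policyState u e₀ r n) (r n)).2)

/-! ### Optimality gap -/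

/-- `ε` bounds the excess cost of the policy over every control in the class `A` (which depends on
horizon, initial level and instructions), for all horizons, initial levels and instructions. -/
def BoundsGap (u : ℝ) (A : ℕ → ℝ → (ℕ → ℝ) → Set ((ℕ → ℝ) × (ℕ → ℝ))) (ε : ℝ) : Prop :=
  ∀ (N : ℕ) (e₀ : ℝ) (r : ℕ → ℝ), e₀ ∈ Set.Icc M.eLo M.eHi →
    (∀ n < N, r n ∈ Set.Icc (-M.P) M.P) →
    ∀ x ∈ A N e₀ r, M.cost N r (M.policy u e₀ r) - M.cost N r x ≤ ε

/-- All optimality gaps `J(g(e₀, r), r) - J(c*, d*, r)`, where `(c*, d*)` is an offline minimizer of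
the cost over the class `A`. -/
def gaps (u : ℝ) (A : ℕ → ℝ → (ℕ → ℝ) → Set ((ℕ → ℝ) × (ℕ → ℝ))) : Set ℝ :=
  {δ | ∃ (N : ℕ) (e₀ : ℝ) (r : ℕ → ℝ) (x : (ℕ → ℝ) × (ℕ → ℝ)),
    e₀ ∈ Set.Icc M.eLo M.eHi ∧ (∀ n < N, r n ∈ Set.Icc (-M.P) M.P) ∧
    x ∈ A N e₀ r ∧ IsMinOn (M.cost N r) (A N e₀ r) x ∧
    δ = M.cost N r (M.policy u e₀ r) - M.cost N r x}

/-- Cost of a full cycle of depth `x`, up to a constant that does not depend on the controls. -/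
def Ju (x : ℝ) : ℝ := M.E * M.R * M.Φ x - M.E * (M.θ / M.ηc + M.π * M.ηd) * x

/-- Cost of a charge half cycle of depth `x`. -/
def Jv (x : ℝ) : ℝ := 1 / 2 * (M.E * M.R * M.Φ x) - M.E / M.ηc * M.θ * x

/-- Cost of a discharge half cycle of depth `x`. -/
def Jw (x : ℝ) : ℝ := 1 / 2 * (M.E * M.R * M.Φ x) - M.E * M.ηd * M.π * x

/-- The claimed worst-case optimality gap. -/
def worstGap (u v w : ℝ) : ℝ :=
  if M.θ / M.ηc < M.π * M.ηd then M.Jw u + 2 * M.Jv u - M.Jw w - 2 * M.Jv v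
  else if M.π * M.ηd < M.θ / M.ηc then 2 * M.Jw u + M.Jv u - 2 * M.Jw w - M.Jv v
  else 0

end Model

end BatteryRegulation

end

noncomputable section

namespace BatteryRegulation

/-! ### The stop operator -/

/-- The projection of `x` onto `[0, t]`. -/
def clampTo (t x : ℝ) : ℝ := max 0 (min x t)

/-- The downward variation of the stop operator of width `t` along a profile: the room `B` left
below the current point inside a window of width `t` follows the profile and is kept in `[0, t]`. -/
def stopDown (t : ℝ) : ℝ → List ℝ → ℝ
  | B, a :: b :: l =>
      max (B - clampTo t (B + (b - a))) 0 + stopDown t (clampTo t (B + (b - a))) (b :: l)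
  | _, _ => 0

theorem clampTo_mem {t x : ℝ} (ht : 0 ≤ t) : clampTo t x ∈ Set.Icc 0 t := by
  simp only [clampTo, Set.mem_Icc]
  exact ⟨le_max_left _ _, max_le ht (min_le_right _ _)⟩

theorem clampTo_of_mem {t x : ℝ} (h0 : 0 ≤ x) (h1 : x ≤ t) : clampTo t x = x := by
  simp [clampTo, h0, h1]

theorem clampTo_of_le {t x : ℝ} (ht : 0 ≤ t) (h1 : t ≤ x) : clampTo t x = t := by
  simp [clampTo, h1, ht]

theorem clampTo_of_nonpos {t x : ℝ} (h1 : x ≤ 0) : clampTo t x = 0 := by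
  rw [clampTo, max_eq_left]
  exact (min_le_left _ _).trans h1

theorem clampTo_cases {t : ℝ} (ht : 0 ≤ t) (x : ℝ) :
    (0 ≤ x ∧ x ≤ t ∧ clampTo t x = x) ∨ (t ≤ x ∧ clampTo t x = t) ∨
      (x ≤ 0 ∧ clampTo t x = 0) := by
  rcases le_total x 0 with h | h
  · exact Or.inr (Or.inr ⟨h, clampTo_of_nonpos h⟩)
  · rcases le_total x t with h' | h'
    · exact Or.inl ⟨h, h', clampTo_of_mem h h'⟩
    · exact Or.inr (Or.inl ⟨h', clampTo_of_le ht h'⟩)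

theorem stopDown_between {t B a b c : ℝ} (hB : B ∈ Set.Icc 0 t)
    (h : (a ≤ b ∧ b ≤ c) ∨ (c ≤ b ∧ b ≤ a)) (l : List ℝ) :
    stopDown t B (a :: b :: c :: l) = stopDown t B (a :: c :: l) := by
  obtain ⟨h0, h1⟩ := hB
  have ht : 0 ≤ t := h0.trans h1
  have key : clampTo t (clampTo t (B + (b - a)) + (c - b)) = clampTo t (B + (c - a)) ∧
      max (B - clampTo t (B + (b - a))) 0 +
        max (clampTo t (B + (b - a)) - clampTo t (B + (c - a))) 0 =
        max (B - clampTo t (B + (c - a))) 0 := by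
    have e : clampTo t (clampTo t (B + (b - a)) + (c - b)) = clampTo t (B + (c - a)) := by
      rcases clampTo_cases ht (B + (b - a)) with ⟨p, q, e1⟩ | ⟨p, e1⟩ | ⟨p, e1⟩ <;>
      rw [e1]
      · congr 1; ring
      · rcases h with h | h
        · rw [clampTo_of_le ht (by linarith), clampTo_of_le ht (by linarith)]
        · have : a = b := by linarith
          congr 1; linarith
      · rcases h with h | h
        · have : a = b := by linarith
          congr 1; linarith
        · rw [clampTo_of_nonpos (by linarith), clampTo_of_nonpos (by linarith)]
    refine ⟨e, ?_⟩
    rcases h with h | h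
    · have e1 : B ≤ clampTo t (B + (b - a)) := by
        rcases clampTo_cases ht (B + (b - a)) with ⟨p, q, e1⟩ | ⟨p, e1⟩ | ⟨p, e1⟩ <;> linarith
      have e2 : clampTo t (B + (b - a)) ≤ clampTo t (B + (c - a)) := by
        unfold clampTo; gcongr; linarith
      rw [max_eq_right (by linarith), max_eq_right (by linarith), max_eq_right (by linarith)]
      ring
    · have e1 : clampTo t (B + (b - a)) ≤ B := by
        rcases clampTo_cases ht (B + (b - a)) with ⟨p, q, e1⟩ | ⟨p, e1⟩ | ⟨p, e1⟩ <;> linarith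
      have e2 : clampTo t (B + (c - a)) ≤ clampTo t (B + (b - a)) := by
        unfold clampTo; gcongr; linarith
      rw [max_eq_left (by linarith), max_eq_left (by linarith), max_eq_left (by linarith)]
      ring
  obtain ⟨k1, k2⟩ := key
  simp only [stopDown]
  rw [k1, ← add_assoc, k2]

/-! ### Local extrema -/

theorem localExtrema_head (a : ℝ) (l : List ℝ) : ∃ l', localExtrema (a :: l) = a :: l' := by
  induction hn : l.length generalizing a l with
  | zero =>
    rw [List.length_eq_zero_iff] at hn
    subst hn
    exact ⟨[], by simp [localExtrema]⟩
  | succ n ih =>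
    match l, hn with
    | [b], _ =>
      by_cases h : a = b
      · exact ⟨[], by simp [localExtrema, h]⟩
      · exact ⟨[b], by simp [localExtrema, h]⟩
    | b :: c :: l, hn =>
      rw [localExtrema]
      split_ifs
      · exact ih a (c :: l) (by simpa using hn)
      · exact ⟨_, rfl⟩

theorem localExtrema_subset (l : List ℝ) : ∀ x ∈ localExtrema l, x ∈ l := by
  induction l using localExtrema.induct with
  | case1 => simp [localExtrema]
  | case2 a => simp [localExtrema]
  | case3 b => simp [localExtrema]
  | case4 a b h => simp [localExtrema, h]
  | case5 a b c l h ih =>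
    rw [localExtrema, if_pos h]
    intro x hx
    have := ih x hx
    simp only [List.mem_cons] at this ⊢
    tauto
  | case6 a b c l h ih =>
    rw [localExtrema, if_neg h]
    intro x hx
    rcases List.mem_cons.1 hx with rfl | hx
    · simp
    · exact List.mem_cons_of_mem _ (ih x hx)

theorem stopDown_localExtrema {t : ℝ} (l : List ℝ) :
    ∀ B ∈ Set.Icc 0 t, stopDown t B (localExtrema l) = stopDown t B l := by
  induction l using localExtrema.induct with
  | case1 => simp [localExtrema]
  | case2 a => simp [localExtrema]
  | case3 b =>
    intro B hB
    have : clampTo t B = B := clampTo_of_mem hB.1 hB.2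
    simp [localExtrema, stopDown, this]
  | case4 a b h => simp [localExtrema, h]
  | case5 a b c l h ih =>
    intro B hB
    rw [localExtrema, if_pos h, ih B hB, stopDown_between hB h]
  | case6 a b c l h ih =>
    intro B hB
    rw [localExtrema, if_neg h]
    obtain ⟨l', hl'⟩ := localExtrema_head b (c :: l)
    have := ih (clampTo t (B + (b - a))) (clampTo_mem (hB.1.trans hB.2))
    rw [hl'] at this ⊢
    rw [stopDown, this, ← stopDown]

/-- A strictly alternating profile; the flag tells whether the first step is upward. -/
def Zigzag : Bool → List ℝ → Prop
  | true, a :: b :: l => a < b ∧ Zigzag false (b :: l)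
  | false, a :: b :: l => b < a ∧ Zigzag true (b :: l)
  | _, _ => True

theorem zigzag_localExtrema_of_ne (l : List ℝ) :
    ∀ a b l', l = a :: b :: l' → (a < b → Zigzag true (localExtrema l)) ∧
      (b < a → Zigzag false (localExtrema l)) := by
  induction l using localExtrema.induct with
  | case1 => simp
  | case2 a => simp
  | case3 b =>
    rintro a c l' h
    simp only [List.cons.injEq] at h
    obtain ⟨rfl, rfl, -⟩ := h
    simp
  | case4 a b h =>
    rintro a' b' l' h'
    simp only [List.cons.injEq] at h'
    obtain ⟨rfl, rfl, -⟩ := h'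
    simp only [localExtrema, if_neg h, Zigzag]
    tauto
  | case5 a b c l h ih =>
    rintro a' b' l' h'
    simp only [List.cons.injEq] at h'
    obtain ⟨rfl, rfl, -⟩ := h'
    rw [localExtrema, if_pos h]
    obtain ⟨h1, h2⟩ := ih a c l rfl
    constructor <;> intro hab
    · exact h1 (by rcases h with h | h <;> linarith)
    · exact h2 (by rcases h with h | h <;> linarith)
  | case6 a b c l h ih =>
    rintro a' b' l' h'
    simp only [List.cons.injEq] at h'
    obtain ⟨rfl, rfl, -⟩ := h'
    rw [localExtrema, if_neg h]
    obtain ⟨h1, h2⟩ := ih b c l rfl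
    obtain ⟨m, hm⟩ := localExtrema_head b (c :: l)
    push Not at h
    rw [hm] at h1 h2 ⊢
    constructor <;> intro hab
    · exact ⟨hab, h2 (h.1 hab.le)⟩
    · refine ⟨hab, h1 ?_⟩
      by_contra hc
      linarith [h.2 (not_lt.1 hc)]

theorem zigzag_localExtrema (l : List ℝ) : ∃ σ, Zigzag σ (localExtrema l) := by
  induction l using localExtrema.induct with
  | case1 => exact ⟨true, by simp [localExtrema, Zigzag]⟩
  | case2 a => exact ⟨true, by simp [localExtrema, Zigzag]⟩
  | case3 b => exact ⟨true, by simp [localExtrema, Zigzag]⟩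
  | case4 a b h =>
    rcases lt_or_gt_of_ne h with h' | h'
    · exact ⟨true, (zigzag_localExtrema_of_ne _ a b [] rfl).1 h'⟩
    · exact ⟨false, (zigzag_localExtrema_of_ne _ a b [] rfl).2 h'⟩
  | case5 a b c l h ih => rw [localExtrema, if_pos h]; exact ih
  | case6 a b c l h ih =>
    rcases lt_trichotomy a b with hab | hab | hab
    · exact ⟨true, (zigzag_localExtrema_of_ne _ a b _ rfl).1 hab⟩
    · subst hab
      exact absurd (by rcases le_total a c with h | h <;> simp [h]) h
    · exact ⟨false, (zigzag_localExtrema_of_ne _ a b _ rfl).2 hab⟩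

/-! ### Rainflow sweeps -/

theorem Zigzag.delete {σ : Bool} {s₁ s₂ s₃ s₄ : ℝ} {l : List ℝ}
    (hz : Zigzag σ (s₁ :: s₂ :: s₃ :: s₄ :: l))
    (h : |s₂ - s₃| ≤ |s₁ - s₂| ∧ |s₂ - s₃| ≤ |s₃ - s₄|) : Zigzag σ (s₁ :: s₄ :: l) := by
  obtain ⟨h1, h2⟩ := h
  cases σ
  · obtain ⟨a1, a2, a3, a4⟩ := hz
    rw [abs_of_neg (by linarith), abs_of_pos (by linarith)] at h1
    exact ⟨by linarith, a4⟩
  · obtain ⟨a1, a2, a3, a4⟩ := hz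
    rw [abs_of_pos (by linarith), abs_of_neg (by linarith)] at h1
    exact ⟨by linarith, a4⟩

theorem stopDown_delete {t B : ℝ} (hB : B ∈ Set.Icc 0 t) {σ : Bool} {s₁ s₂ s₃ s₄ : ℝ} {l : List ℝ}
    (hz : Zigzag σ (s₁ :: s₂ :: s₃ :: s₄ :: l))
    (h : |s₂ - s₃| ≤ |s₁ - s₂| ∧ |s₂ - s₃| ≤ |s₃ - s₄|) :
    stopDown t B (s₁ :: s₂ :: s₃ :: s₄ :: l) =
      min |s₂ - s₃| t + stopDown t B (s₁ :: s₄ :: l) := by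
  obtain ⟨b0, b1⟩ := hB
  have ht : 0 ≤ t := b0.trans b1
  obtain ⟨h1, h2⟩ := h
  simp only [stopDown]
  cases σ
  · obtain ⟨a1, a2, a3, a4⟩ := hz
    rw [abs_of_neg (by linarith), abs_of_pos (by linarith)] at h1 h2
    rw [abs_of_neg (by linarith)]
    rcases le_total (s₁ - s₂) B with c1 | c1
    · rw [clampTo_of_mem (x := B + (s₂ - s₁)) (by linarith) (by linarith),
        clampTo_of_mem (x := B + (s₂ - s₁) + (s₃ - s₂)) (by linarith) (by linarith),
        show B + (s₂ - s₁) + (s₃ - s₂) + (s₄ - s₃) = B + (s₄ - s₁) by ring,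
        max_eq_left (a := B - (B + (s₂ - s₁))) (by linarith), max_eq_right (b := 0) (by linarith),
        min_eq_left (by linarith)]
      rcases clampTo_cases ht (B + (s₄ - s₁)) with ⟨p, q, e1⟩ | ⟨p, e1⟩ | ⟨p, e1⟩ <;> rw [e1]
      · rw [max_eq_left (by linarith), max_eq_left (by linarith)]; ring
      · linarith
      · rw [max_eq_left (by linarith), max_eq_left (by linarith)]; ring
    · rw [clampTo_of_nonpos (x := B + (s₂ - s₁)) (by linarith),
        clampTo_of_nonpos (x := B + (s₄ - s₁)) (by linarith)]
      have e : clampTo t (0 + (s₃ - s₂)) = min (-(s₂ - s₃)) t := by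
        rw [clampTo, max_eq_right (le_min (by linarith) ht)]
        congr 1; ring
      have e0 : 0 ≤ min (-(s₂ - s₃)) t := le_min (by linarith) ht
      have e1 : min (-(s₂ - s₃)) t ≤ -(s₂ - s₃) := min_le_left _ _
      rw [e, clampTo_of_nonpos (by linarith), max_eq_right (a := 0 - _) (by linarith),
        max_eq_left (by linarith), max_eq_left (by linarith)]
      ring
  · obtain ⟨a1, a2, a3, a4⟩ := hz
    rw [abs_of_pos (by linarith), abs_of_neg (by linarith)] at h1 h2
    rw [abs_of_pos (by linarith)]
    rcases le_total (B + (s₂ - s₁)) t with c1 | c1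
    · rw [clampTo_of_mem (x := B + (s₂ - s₁)) (by linarith) c1,
        clampTo_of_mem (x := B + (s₂ - s₁) + (s₃ - s₂)) (by linarith) (by linarith),
        show B + (s₂ - s₁) + (s₃ - s₂) + (s₄ - s₃) = B + (s₄ - s₁) by ring,
        max_eq_right (a := B - (B + (s₂ - s₁))) (by linarith),
        max_eq_left (a := (B + (s₂ - s₁)) - _) (by linarith),
        min_eq_left (by linarith)]
      rcases clampTo_cases ht (B + (s₄ - s₁)) with ⟨p, q, e1⟩ | ⟨p, e1⟩ | ⟨p, e1⟩ <;> rw [e1]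
      · rw [max_eq_right (by linarith), max_eq_right (by linarith)]; ring
      · rw [max_eq_right (by linarith), max_eq_right (by linarith)]; ring
      · linarith
    · rw [clampTo_of_le ht (x := B + (s₂ - s₁)) (by linarith),
        clampTo_of_le ht (x := B + (s₄ - s₁)) (by linarith)]
      rcases le_total (s₂ - s₃) t with c2 | c2
      · rw [clampTo_of_mem (x := t + (s₃ - s₂)) (by linarith) (by linarith),
          clampTo_of_le ht (by linarith), min_eq_left c2, max_eq_right (by linarith),
          max_eq_left (by linarith), max_eq_right (by linarith)]
        ring
      · rw [clampTo_of_nonpos (x := t + (s₃ - s₂)) (by linarith),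
          clampTo_of_le ht (by linarith), min_eq_right c2, max_eq_right (by linarith),
          max_eq_left (by linarith), max_eq_right (by linarith)]
        ring

theorem rainflowSweep_head (a : ℝ) (l : List ℝ) :
    ∃ l', (rainflowSweep (a :: l)).2 = a :: l' := by
  induction hn : l.length using Nat.strong_induction_on generalizing l with
  | _ n ih =>
    match l, hn with
    | [], _ => exact ⟨[], by simp [rainflowSweep]⟩
    | [b], _ => exact ⟨[b], by simp [rainflowSweep]⟩
    | [b, c], _ => exact ⟨[b, c], by simp [rainflowSweep]⟩
    | b :: c :: d :: l, hn =>
      rw [rainflowSweep]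
      split_ifs
      · exact ih _ (by simp at hn ⊢; omega) (d :: l) rfl
      · exact ⟨_, rfl⟩

/-- No four consecutive points of the profile enclose a full cycle. -/
def NoCycle : List ℝ → Prop
  | s₁ :: s₂ :: s₃ :: s₄ :: l =>
      ¬ (|s₂ - s₃| ≤ |s₁ - s₂| ∧ |s₂ - s₃| ≤ |s₃ - s₄|) ∧ NoCycle (s₂ :: s₃ :: s₄ :: l)
  | _ => True

theorem rainflowSweep_spec (l : List ℝ) :
    (∀ σ, Zigzag σ l → Zigzag σ (rainflowSweep l).2 ∧ ∀ t, ∀ B ∈ Set.Icc 0 t,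
      stopDown t B l = ((rainflowSweep l).1.map (min · t)).sum +
        stopDown t B (rainflowSweep l).2) ∧
    ((rainflowSweep l).2.length < l.length ∨ (rainflowSweep l = ([], l) ∧ NoCycle l)) ∧
    (∀ x ∈ (rainflowSweep l).2, x ∈ l) ∧
    (∀ x ∈ (rainflowSweep l).1, ∃ p ∈ l, ∃ q ∈ l, x = |p - q|) := by
  induction l using rainflowSweep.induct with
  | case1 s₁ s₂ s₃ s₄ l h ih =>
    obtain ⟨i1, i2, i3, i4⟩ := ih
    rw [rainflowSweep, if_pos h]
    dsimp only
    refine ⟨fun σ hz => ⟨(i1 σ (hz.delete h)).1, fun t B hB => ?_⟩, ?_, ?_, ?_⟩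
    · rw [stopDown_delete hB hz h, (i1 σ (hz.delete h)).2 t B hB, List.map_cons, List.sum_cons,
        add_assoc]
    · left
      rcases i2 with i2 | ⟨i2, -⟩
      · simp at i2 ⊢; omega
      · rw [i2]; simp
    · intro x hx
      have := i3 x hx
      simp only [List.mem_cons] at this ⊢
      tauto
    · intro x hx
      rcases List.mem_cons.1 hx with rfl | hx
      · exact ⟨s₂, by simp, s₃, by simp, rfl⟩
      · obtain ⟨p, hp, q, hq, e⟩ := i4 x hx
        simp only [List.mem_cons] at hp hq
        refine ⟨p, ?_, q, ?_, e⟩ <;> simp only [List.mem_cons] <;> tauto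
  | case2 s₁ s₂ s₃ s₄ l h ih =>
    obtain ⟨i1, i2, i3, i4⟩ := ih
    rw [rainflowSweep, if_neg h]
    dsimp only
    obtain ⟨l', hl'⟩ := rainflowSweep_head s₂ (s₃ :: s₄ :: l)
    refine ⟨fun σ hz => ?_, ?_, ?_, ?_⟩
    · cases σ
      · obtain ⟨j1, j2⟩ := i1 true hz.2
        rw [hl'] at j1 j2 ⊢
        refine ⟨⟨hz.1, j1⟩, fun t B hB => ?_⟩
        rw [stopDown, j2 t _ (clampTo_mem (hB.1.trans hB.2)), stopDown]
        ring
      · obtain ⟨j1, j2⟩ := i1 false hz.2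
        rw [hl'] at j1 j2 ⊢
        refine ⟨⟨hz.1, j1⟩, fun t B hB => ?_⟩
        rw [stopDown, j2 t _ (clampTo_mem (hB.1.trans hB.2)), stopDown]
        ring
    · rcases i2 with i2 | ⟨i2, i5⟩
      · left
        simp at i2 ⊢; omega
      · right
        rw [i2]
        exact ⟨rfl, h, i5⟩
    · intro x hx
      rcases List.mem_cons.1 hx with rfl | hx
      · simp
      · exact List.mem_cons_of_mem _ (i3 x hx)
    · intro x hx
      obtain ⟨p, hp, q, hq, e⟩ := i4 x hx
      exact ⟨p, List.mem_cons_of_mem _ hp, q, List.mem_cons_of_mem _ hq, e⟩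
  | case3 l h =>
    have e : rainflowSweep l = ([], l) := by
      rw [rainflowSweep]
      exact h
    have n : NoCycle l := by
      match l, h with
      | [], _ => trivial
      | [_], _ => trivial
      | [_, _], _ => trivial
      | [_, _, _], _ => trivial
      | a :: b :: c :: d :: l, h => exact absurd rfl (h a b c d l)
    rw [e]
    simp [n]

theorem rainflowSweeps_spec (k : ℕ) (l : List ℝ) :
    (∀ σ, Zigzag σ l → Zigzag σ (rainflowSweeps k l).2 ∧ ∀ t, ∀ B ∈ Set.Icc 0 t,
      stopDown t B l = ((rainflowSweeps k l).1.map (min · t)).sum +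
        stopDown t B (rainflowSweeps k l).2) ∧
    (l.length ≤ k → NoCycle (rainflowSweeps k l).2) ∧
    (∀ x ∈ (rainflowSweeps k l).2, x ∈ l) ∧
    (∀ x ∈ (rainflowSweeps k l).1, ∃ p ∈ l, ∃ q ∈ l, x = |p - q|) := by
  induction k generalizing l with
  | zero =>
    simp only [rainflowSweeps]
    refine ⟨by simp, fun h => ?_, by simp, by simp⟩
    rw [List.length_eq_zero_iff.1 (Nat.le_zero.1 h)]
    trivial
  | succ k ih =>
    obtain ⟨a1, a2, a3, a4⟩ := rainflowSweep_spec l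
    obtain ⟨i1, i2, i3, i4⟩ := ih (rainflowSweep l).2
    simp only [rainflowSweeps]
    refine ⟨fun σ hz => ?_, fun h => ?_, fun x hx => a3 x (i3 x hx), fun x hx => ?_⟩
    · obtain ⟨b1, b2⟩ := a1 σ hz
      obtain ⟨c1, c2⟩ := i1 σ b1
      refine ⟨c1, fun t B hB => ?_⟩
      rw [b2 t B hB, c2 t B hB, List.map_append, List.sum_append]
      ring
    · rcases a2 with a2 | ⟨a2, a5⟩
      · exact i2 (by omega)
      · have : ∀ j, rainflowSweeps j l = ([], l) := by
          intro j
          induction j with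
          | zero => rfl
          | succ j ihj => simp [rainflowSweeps, a2, ihj]
        rw [a2, this]
        exact a5
    · rcases List.mem_append.1 hx with hx | hx
      · exact a4 x hx
      · obtain ⟨p, hp, q, hq, e⟩ := i4 x hx
        exact ⟨p, a3 p hp, q, a3 q hq, e⟩

/-! ### The residue -/

/-- The steps of the profile strictly decrease in size. -/
def StepsDecrease : List ℝ → Prop
  | a :: b :: c :: l => |b - c| < |a - b| ∧ StepsDecrease (b :: c :: l)
  | _ => True

theorem NoCycle.stepsDecrease {a b c : ℝ} {l : List ℝ} (h : NoCycle (a :: b :: c :: l))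
    (hab : |b - c| ≤ |a - b|) : StepsDecrease (b :: c :: l) := by
  induction l generalizing a b c with
  | nil => trivial
  | cons d l ih =>
    have h1 : |c - d| < |b - c| := by
      by_contra h'
      exact h.1 ⟨hab, not_lt.1 h'⟩
    exact ⟨h1, ih h.2 h1.le⟩

theorem NoCycle.tail {a : ℝ} {l : List ℝ} (h : NoCycle (a :: l)) : NoCycle l := by
  match l, h with
  | [], _ => trivial
  | [_], _ => trivial
  | [_, _], _ => trivial
  | _ :: _ :: _ :: _, h => exact h.2

theorem stopDown_le_discharge {t : ℝ} (l : List ℝ) :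
    ∀ B ∈ Set.Icc 0 t, stopDown t B l ≤ ((dischargeHalfCycles l).map (min · t)).sum := by
  induction l with
  | nil => intro B _; simp [stopDown, dischargeHalfCycles]
  | cons a l ih =>
    cases l with
    | nil => intro B _; simp [stopDown, dischargeHalfCycles]
    | cons b l =>
      rintro B ⟨h0, h1⟩
      have ht := h0.trans h1
      have := ih (clampTo t (B + (b - a))) (clampTo_mem ht)
      rw [stopDown, dischargeHalfCycles]
      split_ifs with hab
      · rw [List.map_cons, List.sum_cons]
        refine add_le_add ?_ this
        refine max_le (le_min ?_ ?_) (le_min (by linarith) ht)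
        · rcases clampTo_cases ht (B + (b - a)) with ⟨p, q, e1⟩ | ⟨p, e1⟩ | ⟨p, e1⟩ <;> linarith
        · have := (clampTo_mem (x := B + (b - a)) ht).1; linarith
      · rw [max_eq_right, zero_add]
        · exact this
        · rcases clampTo_cases ht (B + (b - a)) with ⟨p, q, e1⟩ | ⟨p, e1⟩ | ⟨p, e1⟩ <;> linarith

theorem discharge_le_stopDown_of_stepsDecrease {t : ℝ} (l : List ℝ) :
    ∀ σ B, B ∈ Set.Icc 0 t → Zigzag σ l → StepsDecrease l →
      (∀ a b l', σ = false → l = a :: b :: l' → min |a - b| t ≤ B) →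
      ((dischargeHalfCycles l).map (min · t)).sum ≤ stopDown t B l := by
  induction l with
  | nil => intros; simp [stopDown, dischargeHalfCycles]
  | cons a l ih =>
    cases l with
    | nil => intros; simp [stopDown, dischargeHalfCycles]
    | cons b l =>
      rintro σ B ⟨h0, h1⟩ hz hd hB
      have ht := h0.trans h1
      have hd' : StepsDecrease (b :: l) := by
        cases l with
        | nil => trivial
        | cons c l => exact hd.2
      rw [stopDown, dischargeHalfCycles]
      cases σ
      · obtain ⟨hz1, hz2⟩ := hz
        have := ih true _ (clampTo_mem (x := B + (b - a)) ht) hz2 hd' (by simp)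
        rw [if_pos hz1, List.map_cons, List.sum_cons]
        refine add_le_add (le_max_of_le_left ?_) this
        have hm := hB a b l rfl rfl
        rw [abs_of_pos (by linarith)] at hm
        have h2 : min (a - b) t ≤ a - b := min_le_left _ _
        rcases clampTo_cases ht (B + (b - a)) with ⟨p, q, e1⟩ | ⟨p, e1⟩ | ⟨p, e1⟩ <;> linarith
      · obtain ⟨hz1, hz2⟩ := hz
        rw [if_neg (by linarith)]
        refine (ih false _ (clampTo_mem (x := B + (b - a)) ht) hz2 hd' ?_).trans
          (le_add_of_nonneg_left (le_max_right _ _))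
        rintro a' c l' - hl
        simp only [List.cons.injEq] at hl
        obtain ⟨rfl, rfl⟩ := hl
        have h3 := hd.1
        rw [abs_of_neg (a := a - b) (by linarith)] at h3
        rcases clampTo_cases ht (B + (b - a)) with ⟨p, q, e1⟩ | ⟨p, e1⟩ | ⟨p, e1⟩ <;> rw [e1]
        · exact (min_le_left _ _).trans (by linarith)
        · exact min_le_right _ _
        · linarith

theorem discharge_le_stopDown {t : ℝ} (l : List ℝ) :
    ∀ σ B, B ∈ Set.Icc 0 t → Zigzag σ l → NoCycle l →
      (∀ a b l', l = a :: b :: l' → t ≤ if σ then B + (b - a) else B) →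
      ((dischargeHalfCycles l).map (min · t)).sum ≤ stopDown t B l := by
  induction l with
  | nil => intros; simp [stopDown, dischargeHalfCycles]
  | cons a l ih =>
    cases l with
    | nil => intros; simp [stopDown, dischargeHalfCycles]
    | cons b l =>
      rintro σ B ⟨h0, h1⟩ hz hd hB
      have ht := h0.trans h1
      have hBt := hB a b l rfl
      rw [stopDown, dischargeHalfCycles]
      cases σ
      · obtain ⟨hz1, hz2⟩ := hz
        have : B = t := le_antisymm h1 (by simpa using hBt)
        subst this
        rw [if_pos hz1, List.map_cons, List.sum_cons]
        refine add_le_add (le_max_of_le_left ?_) ?_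
        · rcases clampTo_cases ht (B + (b - a)) with ⟨p, q, e1⟩ | ⟨p, e1⟩ | ⟨p, e1⟩ <;> rw [e1]
          · exact (min_le_left _ _).trans (by linarith)
          · linarith
          · exact (min_le_right _ _).trans (by linarith)
        · rcases l with - | ⟨c, l⟩
          · simp [stopDown, dischargeHalfCycles]
          rcases le_or_gt |b - c| |a - b| with hc | hc
          · exact discharge_le_stopDown_of_stepsDecrease _ true _ (clampTo_mem ht) hz2
              (hd.stepsDecrease hc) (by simp)
          · refine ih true _ (clampTo_mem ht) hz2 hd.tail ?_
            rintro a' b' l' hl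
            simp only [List.cons.injEq] at hl
            obtain ⟨rfl, rfl, rfl⟩ := hl
            have := hz2.1
            rw [abs_of_pos (by linarith), abs_of_neg (by linarith)] at hc
            simp only [if_true]
            rcases clampTo_cases ht (B + (b - a)) with ⟨p, q, e1⟩ | ⟨p, e1⟩ | ⟨p, e1⟩ <;>
              linarith
      · obtain ⟨hz1, hz2⟩ := hz
        simp only [if_true] at hBt
        rw [if_neg (by linarith), clampTo_of_le ht hBt]
        refine (ih false t ⟨ht, le_rfl⟩ hz2 hd.tail ?_).trans
          (le_add_of_nonneg_left (le_max_right _ _))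
        simp

/-! ### Sums over the cycles found by rainflow counting -/

/-- Depths of all upward strokes: every full cycle and every charge half cycle. -/
def Cycles.ups (y : Cycles) : List ℝ := y.full ++ y.charge

/-- Depths of all downward strokes: every full cycle and every discharge half cycle. -/
def Cycles.downs (y : Cycles) : List ℝ := y.full ++ y.discharge

theorem residue_spec (l : List ℝ) :
    ∃ m : List ℝ, (rainflow l).charge = chargeHalfCycles m ∧
      (rainflow l).discharge = dischargeHalfCycles m ∧ NoCycle m ∧ (∃ σ, Zigzag σ m) ∧
      (∀ x ∈ m, x ∈ l) ∧ (∀ x ∈ (rainflow l).full, ∃ p ∈ l, ∃ q ∈ l, x = |p - q|) ∧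
      ∀ t, 0 ≤ t → stopDown t t l = ((rainflow l).full.map (min · t)).sum + stopDown t t m := by
  obtain ⟨a1, a2, a3, a4⟩ := rainflowSweeps_spec (localExtrema l).length (localExtrema l)
  obtain ⟨σ, hσ⟩ := zigzag_localExtrema l
  refine ⟨_, rfl, rfl, a2 le_rfl, ⟨σ, (a1 σ hσ).1⟩,
    fun x hx => localExtrema_subset l x (a3 x hx), fun x hx => ?_, fun t ht => ?_⟩
  · obtain ⟨p, hp, q, hq, e⟩ := a4 x hx
    exact ⟨p, localExtrema_subset l p hp, q, localExtrema_subset l q hq, e⟩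
  · rw [← stopDown_localExtrema l t ⟨ht, le_rfl⟩]
    exact (a1 σ hσ).2 t t ⟨ht, le_rfl⟩

theorem sum_min_downs {t : ℝ} (ht : 0 ≤ t) (l : List ℝ) :
    ((rainflow l).downs.map (min · t)).sum = stopDown t t l := by
  obtain ⟨m, -, h2, h3, ⟨σ, h4⟩, -, -, h6⟩ := residue_spec l
  rw [Cycles.downs, List.map_append, List.sum_append, h6 t ht, h2]
  congr 1
  refine le_antisymm (discharge_le_stopDown m σ t ⟨ht, le_rfl⟩ h4 h3 ?_)
    (stopDown_le_discharge m t ⟨ht, le_rfl⟩)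
  rintro a b l' rfl
  cases σ
  · simp
  · have := h4.1
    simp only [if_true]
    linarith

theorem charge_mem_Icc {w : ℝ} (m : List ℝ) (hw : ∀ p ∈ m, ∀ q ∈ m, |p - q| ≤ w) :
    ∀ x ∈ chargeHalfCycles m, x ∈ Set.Icc 0 w := by
  induction m with
  | nil => simp [chargeHalfCycles]
  | cons a m ih =>
    cases m with
    | nil => simp [chargeHalfCycles]
    | cons b m =>
      have ih' := ih fun p hp q hq => hw p (List.mem_cons_of_mem _ hp) q (List.mem_cons_of_mem _ hq)
      rw [chargeHalfCycles]
      split_ifs with h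
      · intro x hx
        rcases List.mem_cons.1 hx with rfl | hx
        · exact ⟨by linarith, (le_abs_self _).trans (hw b (by simp) a (by simp))⟩
        · exact ih' x hx
      · exact ih'

theorem discharge_mem_Icc {w : ℝ} (m : List ℝ) (hw : ∀ p ∈ m, ∀ q ∈ m, |p - q| ≤ w) :
    ∀ x ∈ dischargeHalfCycles m, x ∈ Set.Icc 0 w := by
  induction m with
  | nil => simp [dischargeHalfCycles]
  | cons a m ih =>
    cases m with
    | nil => simp [dischargeHalfCycles]
    | cons b m =>
      have ih' := ih fun p hp q hq => hw p (List.mem_cons_of_mem _ hp) q (List.mem_cons_of_mem _ hq)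
      rw [dischargeHalfCycles]
      split_ifs with h
      · intro x hx
        rcases List.mem_cons.1 hx with rfl | hx
        · exact ⟨by linarith, (le_abs_self _).trans (hw a (by simp) b (by simp))⟩
        · exact ih' x hx
      · exact ih'

theorem ups_mem_Icc {w : ℝ} {l : List ℝ} (hw : ∀ p ∈ l, ∀ q ∈ l, |p - q| ≤ w) :
    ∀ x ∈ (rainflow l).ups, x ∈ Set.Icc 0 w := by
  obtain ⟨m, h1, -, -, -, h5, h6, -⟩ := residue_spec l
  intro x hx
  rcases List.mem_append.1 hx with hx | hx
  · obtain ⟨p, hp, q, hq, rfl⟩ := h6 x hx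
    exact ⟨abs_nonneg _, hw p hp q hq⟩
  · rw [h1] at hx
    exact charge_mem_Icc m (fun p hp q hq => hw p (h5 p hp) q (h5 q hq)) x hx

theorem downs_mem_Icc {w : ℝ} {l : List ℝ} (hw : ∀ p ∈ l, ∀ q ∈ l, |p - q| ≤ w) :
    ∀ x ∈ (rainflow l).downs, x ∈ Set.Icc 0 w := by
  obtain ⟨m, -, h1, -, -, h5, h6, -⟩ := residue_spec l
  intro x hx
  rcases List.mem_append.1 hx with hx | hx
  · obtain ⟨p, hp, q, hq, rfl⟩ := h6 x hx
    exact ⟨abs_nonneg _, hw p hp q hq⟩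
  · rw [h1] at hx
    exact discharge_mem_Icc m (fun p hp q hq => hw p (h5 p hp) q (h5 q hq)) x hx

/-- The excess of the first-direction strokes over the opposite ones, weighted by `c`. -/
def strokeExcess (c : ℝ → ℝ) (σ : Bool) (m : List ℝ) : ℝ :=
  if σ then ((chargeHalfCycles m).map c).sum - ((dischargeHalfCycles m).map c).sum
  else ((dischargeHalfCycles m).map c).sum - ((chargeHalfCycles m).map c).sum

theorem strokeExcess_cons {c : ℝ → ℝ} {σ : Bool} {a b : ℝ} {l : List ℝ}
    (hz : Zigzag σ (a :: b :: l)) :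
    Zigzag (!σ) (b :: l) ∧
    strokeExcess c σ (a :: b :: l) = c |a - b| - strokeExcess c (!σ) (b :: l) := by
  cases σ
  · obtain ⟨h1, h2⟩ := hz
    refine ⟨h2, ?_⟩
    simp only [strokeExcess, chargeHalfCycles, dischargeHalfCycles, if_pos h1,
      if_neg h1.not_gt, abs_of_pos (sub_pos.2 h1)]
    simp
    ring
  · obtain ⟨h1, h2⟩ := hz
    refine ⟨h2, ?_⟩
    simp only [strokeExcess, chargeHalfCycles, dischargeHalfCycles, if_pos h1,
      if_neg h1.not_gt, abs_of_neg (sub_neg.2 h1)]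
    simp
    ring

theorem strokeExcess_of_stepsDecrease {c : ℝ → ℝ} {w : ℝ} (hc : MonotoneOn c (Set.Icc 0 w))
    (hc0 : ∀ x ∈ Set.Icc 0 w, 0 ≤ c x) (l : List ℝ) : ∀ (σ : Bool) (a b : ℝ),
    (∀ p ∈ a :: b :: l, ∀ q ∈ a :: b :: l, |p - q| ≤ w) → Zigzag σ (a :: b :: l) →
    StepsDecrease (a :: b :: l) → strokeExcess c σ (a :: b :: l) ∈ Set.Icc 0 (c |a - b|) := by
  induction l with
  | nil =>
    intro σ a b hw hz _
    have : strokeExcess c (!σ) [b] = 0 := by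
      simp [strokeExcess, chargeHalfCycles, dischargeHalfCycles]
    rw [(strokeExcess_cons hz).2, this, sub_zero]
    exact ⟨hc0 _ ⟨abs_nonneg _, hw a (by simp) b (by simp)⟩, le_rfl⟩
  | cons d l ih =>
    intro σ a b hw hz hd
    obtain ⟨z1, z2⟩ := strokeExcess_cons (c := c) hz
    obtain ⟨i1, i2⟩ := ih (!σ) b d (fun p hp q hq => hw p (List.mem_cons_of_mem _ hp) q
      (List.mem_cons_of_mem _ hq)) z1 hd.2
    have hle : c |b - d| ≤ c |a - b| := hc ⟨abs_nonneg _, hw b (by simp) d (by simp)⟩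
      ⟨abs_nonneg _, hw a (by simp) b (by simp)⟩ hd.1.le
    rw [z2]
    constructor <;> linarith

theorem strokeExcess_mem {c : ℝ → ℝ} {w : ℝ} (hc : MonotoneOn c (Set.Icc 0 w))
    (hc0 : ∀ x ∈ Set.Icc 0 w, 0 ≤ c x) (l : List ℝ) : ∀ (σ : Bool) (a b : ℝ),
    (∀ p ∈ a :: b :: l, ∀ q ∈ a :: b :: l, |p - q| ≤ w) → Zigzag σ (a :: b :: l) →
    NoCycle (a :: b :: l) →
    strokeExcess c σ (a :: b :: l) ∈ Set.Icc (c |a - b| - c w) (c w) := by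
  induction l with
  | nil =>
    intro σ a b hw hz _
    obtain ⟨i1, i2⟩ := strokeExcess_of_stepsDecrease hc hc0 [] σ a b hw hz trivial
    have h1 := hw a (by simp) b (by simp)
    have : c |a - b| ≤ c w := hc ⟨abs_nonneg _, h1⟩ ⟨(abs_nonneg _).trans h1, le_rfl⟩ h1
    constructor <;> linarith
  | cons d l ih =>
    intro σ a b hw hz hn
    obtain ⟨z1, z2⟩ := strokeExcess_cons (c := c) hz
    have hw' : ∀ p ∈ b :: d :: l, ∀ q ∈ b :: d :: l, |p - q| ≤ w := fun p hp q hq =>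
      hw p (List.mem_cons_of_mem _ hp) q (List.mem_cons_of_mem _ hq)
    have h1 := hw a (by simp) b (by simp)
    have h2 := hw b (by simp) d (by simp)
    have m1 : c |a - b| ≤ c w := hc ⟨abs_nonneg _, h1⟩ ⟨(abs_nonneg _).trans h1, le_rfl⟩ h1
    rw [z2]
    rcases le_or_gt |b - d| |a - b| with hle | hlt
    · obtain ⟨i1, i2⟩ := strokeExcess_of_stepsDecrease hc hc0 l (!σ) b d hw' z1
        (hn.stepsDecrease hle)
      have : c |b - d| ≤ c |a - b| := hc ⟨abs_nonneg _, h2⟩ ⟨abs_nonneg _, h1⟩ hle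
      constructor <;> linarith
    · obtain ⟨i1, i2⟩ := ih (!σ) b d hw' z1 hn.tail
      have : c |a - b| ≤ c |b - d| := hc ⟨abs_nonneg _, h1⟩ ⟨abs_nonneg _, h2⟩ hlt.le
      constructor <;> linarith

/-- Upward and downward strokes balance up to the weight of the largest possible depth. -/
theorem abs_sum_ups_sub_sum_downs_le {c : ℝ → ℝ} {w : ℝ} (hw0 : 0 ≤ w)
    (hc : MonotoneOn c (Set.Icc 0 w)) (hc0 : ∀ x ∈ Set.Icc 0 w, 0 ≤ c x) {l : List ℝ}
    (hw : ∀ p ∈ l, ∀ q ∈ l, |p - q| ≤ w) :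
    |((rainflow l).ups.map c).sum - ((rainflow l).downs.map c).sum| ≤ c w := by
  obtain ⟨m, h1, h2, h3, ⟨σ, h4⟩, h5, -, -⟩ := residue_spec l
  have hw' : ∀ p ∈ m, ∀ q ∈ m, |p - q| ≤ w := fun p hp q hq => hw p (h5 p hp) q (h5 q hq)
  have h0 : 0 ≤ c w := hc0 w ⟨hw0, le_rfl⟩
  simp only [Cycles.ups, Cycles.downs, List.map_append, List.sum_append, h1, h2,
    add_sub_add_left_eq_sub]
  match m, h3, h4, hw' with
  | [], _, _, _ => simpa [chargeHalfCycles, dischargeHalfCycles] using h0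
  | [_], _, _, _ => simpa [chargeHalfCycles, dischargeHalfCycles] using h0
  | a :: b :: m, h3, h4, hw' =>
    obtain ⟨i1, i2⟩ := strokeExcess_mem hc hc0 m σ a b hw' h4 h3
    have := hc0 |a - b| ⟨abs_nonneg _, hw' a (by simp) b (by simp)⟩
    rw [abs_le]
    cases σ
    · simp only [strokeExcess, Bool.false_eq_true, if_false] at i1 i2
      constructor <;> linarith
    · simp only [strokeExcess, if_true] at i1 i2
      constructor <;> linarith

/-! ### Reflection -/

theorem localExtrema_neg (l : List ℝ) :
    localExtrema (l.map (- ·)) = (localExtrema l).map (- ·) := by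
  induction l using localExtrema.induct with
  | case1 => simp [localExtrema]
  | case2 a => simp [localExtrema]
  | case3 b => simp [localExtrema]
  | case4 a b h => simp [localExtrema, h]
  | case5 a b c l h ih =>
    rw [localExtrema, if_pos h, ← ih]
    simp only [List.map_cons]
    rw [localExtrema, if_pos]
    simp only [neg_le_neg_iff]
    tauto
  | case6 a b c l h ih =>
    rw [localExtrema, if_neg h]
    simp only [List.map_cons] at ih ⊢
    rw [localExtrema, if_neg, ih]
    simp only [neg_le_neg_iff]
    tauto

theorem rainflowSweep_neg (l : List ℝ) :
    rainflowSweep (l.map (- ·)) = ((rainflowSweep l).1, (rainflowSweep l).2.map (- ·)) := by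
  have e (a b : ℝ) : |-a - -b| = |a - b| := by rw [← abs_neg]; congr 1; ring
  induction l using rainflowSweep.induct with
  | case1 s₁ s₂ s₃ s₄ l h ih =>
    rw [rainflowSweep, if_pos h]
    simp only [List.map_cons] at ih ⊢
    rw [rainflowSweep, if_pos (by simpa only [e] using h), ih, e]
  | case2 s₁ s₂ s₃ s₄ l h ih =>
    rw [rainflowSweep, if_neg h]
    simp only [List.map_cons] at ih ⊢
    rw [rainflowSweep, if_neg (by simpa only [e] using h), ih]
  | case3 l h =>
    have e : rainflowSweep l = ([], l) := by
      rw [rainflowSweep]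
      exact h
    rw [e]
    match l, h with
    | [], _ => simp [rainflowSweep]
    | [_], _ => simp [rainflowSweep]
    | [_, _], _ => simp [rainflowSweep]
    | [_, _, _], _ => simp [rainflowSweep]
    | a :: b :: c :: d :: l, h => exact absurd rfl (h a b c d l)

theorem rainflowSweeps_neg (k : ℕ) (l : List ℝ) :
    rainflowSweeps k (l.map (- ·)) =
      ((rainflowSweeps k l).1, (rainflowSweeps k l).2.map (- ·)) := by
  induction k generalizing l with
  | zero => rfl
  | succ k ih => simp only [rainflowSweeps, rainflowSweep_neg, ih]

theorem chargeHalfCycles_neg (l : List ℝ) :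
    chargeHalfCycles (l.map (- ·)) = dischargeHalfCycles l := by
  induction l with
  | nil => rfl
  | cons a l ih =>
    cases l with
    | nil => rfl
    | cons b l =>
      simp only [List.map_cons] at ih ⊢
      rw [chargeHalfCycles, dischargeHalfCycles, ih]
      simp only [neg_lt_neg_iff, show -b - -a = a - b by ring]

theorem dischargeHalfCycles_neg (l : List ℝ) :
    dischargeHalfCycles (l.map (- ·)) = chargeHalfCycles l := by
  rw [← chargeHalfCycles_neg, List.map_map]
  simp

theorem rainflow_neg (l : List ℝ) :
    rainflow (l.map (- ·)) =
      ⟨(rainflow l).full, (rainflow l).discharge, (rainflow l).charge⟩ := by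
  simp only [rainflow, localExtrema_neg, List.length_map, rainflowSweeps_neg,
    chargeHalfCycles_neg, dischargeHalfCycles_neg]

theorem ups_neg (l : List ℝ) : (rainflow (l.map (- ·))).ups = (rainflow l).downs := by
  rw [rainflow_neg]; rfl

theorem downs_neg (l : List ℝ) : (rainflow (l.map (- ·))).downs = (rainflow l).ups := by
  rw [rainflow_neg]; rfl

theorem lifeLoss_eq (Φ : ℝ → ℝ) (y : Cycles) :
    lifeLoss Φ y = (y.ups.map fun x => Φ x / 2).sum + (y.downs.map fun x => Φ x / 2).sum := by
  have : ∀ l : List ℝ, (l.map Φ).sum = (l.map fun x => Φ x / 2).sum +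
      (l.map fun x => Φ x / 2).sum := by
    intro l
    induction l with
    | nil => simp
    | cons a l ih => simp only [List.map_cons, List.sum_cons, ih]; ring
  simp only [lifeLoss, Cycles.ups, Cycles.downs, List.map_append, List.sum_append, this]
  ring

/-! ### Weak majorization -/

theorem sum_map_eq_add_mul {l : List ℝ} {f g h : ℝ → ℝ} {c : ℝ}
    (H : ∀ x ∈ l, f x = g x + c * h x) :
    (l.map f).sum = (l.map g).sum + c * (l.map h).sum := by
  rw [List.map_congr_left H, List.sum_map_add, List.sum_map_mul_left]

theorem antitoneOn_of_convexOn_of_eq {f : ℝ → ℝ} {p q : ℝ} (hpq : p < q)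
    (hf : ConvexOn ℝ (Set.Icc 0 q) f) (h : f p = f q) : AntitoneOn f (Set.Icc 0 p) := by
  have key : ∀ x ∈ Set.Icc 0 p, f p ≤ f x := by
    rintro x ⟨hx0, hx1⟩
    rcases hx1.eq_or_lt with rfl | hx1
    · rfl
    · have := hf.slope_mono_adjacent ⟨hx0, by linarith⟩ ⟨by linarith, le_rfl⟩ hx1 hpq
      rw [h, sub_self, zero_div, div_le_iff₀ (by linarith), zero_mul] at this
      linarith
  rintro x ⟨hx0, hx1⟩ y ⟨hy0, hy1⟩ hxy
  rcases hxy.eq_or_lt with rfl | hxy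
  · rfl
  · rcases hy1.eq_or_lt with rfl | hy1
    · exact key x ⟨hx0, hx1⟩
    · have := hf.slope_mono_adjacent ⟨hx0, by linarith⟩ ⟨by linarith, hpq.le⟩ hxy hy1
      have h2 := key y ⟨hy0, hy1.le⟩
      have h3 : (f p - f y) / (p - y) ≤ 0 := div_nonpos_of_nonpos_of_nonneg (by linarith)
        (by linarith)
      have h4 := this.trans h3
      rw [div_le_iff₀ (by linarith), zero_mul] at h4
      linarith

/-- If all truncated sums of `hs` exceed those of `ks` by at most `O`, then decreasing convex
functions, which are mixtures of truncations, compare accordingly. -/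
theorem sum_convex_le_of_sum_min_le_aux {hs ks : List ℝ} {O : ℝ} (hO : 0 ≤ O) (S : Finset ℝ) :
    ∀ (τ K : ℝ) (f : ℝ → ℝ), 0 ≤ τ → 0 ≤ K → ConvexOn ℝ (Set.Icc 0 τ) f →
      AntitoneOn f (Set.Icc 0 τ) → f 0 = 0 → (∀ t ∈ Set.Icc 0 τ, -(K * t) ≤ f t) →
      (∀ s ∈ S, 0 ≤ s ∧ s < τ) → (∀ h ∈ hs, 0 ≤ h ∧ (h < τ → h ∈ S)) →
      (∀ k ∈ ks, 0 ≤ k ∧ (k < τ → k ∈ S)) →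
      (∀ t ∈ Set.Icc 0 τ, (hs.map (min · t)).sum ≤ (ks.map (min · t)).sum + O) →
      (ks.map fun k => f (min k τ)).sum ≤ (hs.map fun h => f (min h τ)).sum + K * O := by
  have base : ∀ (K : ℝ) (f : ℝ → ℝ), 0 ≤ K → f 0 = 0 → (∀ h ∈ hs, 0 ≤ h) → (∀ k ∈ ks, 0 ≤ k) →
      (ks.map fun k => f (min k 0)).sum ≤ (hs.map fun h => f (min h 0)).sum + K * O := by
    intro K f hK f0 hh hk
    have e : ∀ l : List ℝ, (∀ x ∈ l, 0 ≤ x) → (l.map fun k => f (min k 0)).sum = 0 := by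
      intro l hl
      apply List.sum_eq_zero
      intro y hy
      obtain ⟨x, hx, rfl⟩ := List.mem_map.1 hy
      rw [min_eq_right (hl x hx), f0]
    rw [e ks hk, e hs hh, zero_add]
    positivity
  have step : ∀ (p τ K : ℝ) (f : ℝ → ℝ), 0 ≤ p → p < τ → ConvexOn ℝ (Set.Icc 0 τ) f →
      AntitoneOn f (Set.Icc 0 τ) → f 0 = 0 → (∀ t ∈ Set.Icc 0 τ, -(K * t) ≤ f t) →
      (∀ h ∈ hs, h < τ → h ≤ p) → (∀ k ∈ ks, k < τ → k ≤ p) →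
      (∀ t ∈ Set.Icc 0 τ, (hs.map (min · t)).sum ≤ (ks.map (min · t)).sum + O) →
      (∀ (K' : ℝ) (f' : ℝ → ℝ), 0 ≤ K' → ConvexOn ℝ (Set.Icc 0 p) f' →
        AntitoneOn f' (Set.Icc 0 p) → f' 0 = 0 → (∀ t ∈ Set.Icc 0 p, -(K' * t) ≤ f' t) →
        (ks.map fun k => f' (min k p)).sum ≤ (hs.map fun h => f' (min h p)).sum + K' * O) →
      (ks.map fun k => f (min k τ)).sum ≤ (hs.map fun h => f (min h τ)).sum + K * O := by
    intro p τ K f hp hpτ hf ha f0 hK hh hk hsum IH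
    set c : ℝ := (f p - f τ) / (τ - p) with hc
    have hc0 : 0 ≤ c := div_nonneg
      (sub_nonneg.2 (ha ⟨hp, hpτ.le⟩ ⟨by linarith, le_rfl⟩ hpτ.le)) (by linarith)
    have hcm : c * (τ - p) = f p - f τ := div_mul_cancel₀ _ (by linarith)
    set g : ℝ → ℝ := fun x => f x + c * x with hg
    have hgc : ConvexOn ℝ (Set.Icc 0 τ) g :=
      hf.add ((convexOn_id (convex_Icc 0 τ)).smul hc0)
    have hgeq : g p = g τ := by simp only [hg]; linarith
    have hga := antitoneOn_of_convexOn_of_eq hpτ hgc hgeq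
    have g0 : g 0 = 0 := by simp [hg, f0]
    have hgp : g τ ≤ 0 := by
      rw [← hgeq, ← g0]
      exact hga ⟨le_rfl, hp⟩ ⟨hp, le_rfl⟩ hp
    have hKc : 0 ≤ K - c := by
      have := hK τ ⟨by linarith, le_rfl⟩
      simp only [hg] at hgp
      have h1 : 0 ≤ (K - c) * τ := by linarith
      exact nonneg_of_mul_nonneg_left h1 (by linarith)
    have hI := IH (K - c) g hKc (hgc.subset (Set.Icc_subset_Icc_right hpτ.le) (convex_Icc _ _))
      hga g0 fun t ht => by
        have := hK t ⟨ht.1, by linarith [ht.2]⟩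
        simp only [hg]; linarith
    have e : ∀ l : List ℝ, (∀ h ∈ l, h < τ → h ≤ p) → (l.map fun k => f (min k τ)).sum =
        (l.map fun k => g (min k p)).sum + -c * (l.map (min · τ)).sum := by
      intro l hl
      apply sum_map_eq_add_mul
      intro x hx
      rcases lt_or_ge x τ with h | h
      · rw [min_eq_left h.le, min_eq_left (hl x hx h)]
        simp only [hg]; ring
      · rw [min_eq_right h, min_eq_right (by linarith), hgeq]
        simp only [hg]; ring
    rw [e ks hk, e hs hh]
    have := mul_le_mul_of_nonneg_left (hsum τ ⟨by linarith, le_rfl⟩) hc0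
    linarith
  induction S using Finset.induction_on_max with
  | empty =>
    intro τ K f hτ hK hf ha f0 hKf hS hh hk hsum
    have hh0 := fun h hm => (hh h hm).1
    have hk0 := fun h hm => (hk h hm).1
    rcases hτ.eq_or_lt with rfl | hτ
    · exact base K f hK f0 hh0 hk0
    · refine step 0 τ K f le_rfl hτ hf ha f0 hKf (fun h hm hlt => ?_) (fun h hm hlt => ?_) hsum
        (fun K' f' hK' _ _ f0' _ => base K' f' hK' f0' hh0 hk0)
      · simpa using (hh h hm).2 hlt
      · simpa using (hk h hm).2 hlt
  | insert a S ha ih =>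
    intro τ K f hτ hK hf hanti f0 hKf hS hh hk hsum
    obtain ⟨a0, a1⟩ := hS a (Finset.mem_insert_self _ _)
    have hle : ∀ x ∈ insert a S, x ≤ a := by
      intro x hx
      rcases Finset.mem_insert.1 hx with rfl | hx
      · rfl
      · exact (ha x hx).le
    have hins : ∀ x ∈ insert a S, x < a → x ∈ S := by
      intro x hx hlt
      exact (Finset.mem_insert.1 hx).resolve_left hlt.ne
    refine step a τ K f a0 a1 hf hanti f0 hKf (fun h hm hlt => hle h ((hh h hm).2 hlt))
      (fun h hm hlt => hle h ((hk h hm).2 hlt)) hsum fun K' f' hK' hf' ha' f0' hKf' => ?_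
    exact ih a K' f' a0 hK' hf' ha' f0' hKf'
      (fun s hs => ⟨(hS s (Finset.mem_insert_of_mem hs)).1, ha s hs⟩)
      (fun h hm => ⟨(hh h hm).1, fun hlt => hins h ((hh h hm).2 (hlt.trans a1)) hlt⟩)
      (fun h hm => ⟨(hk h hm).1, fun hlt => hins h ((hk h hm).2 (hlt.trans a1)) hlt⟩)
      fun t ht => hsum t ⟨ht.1, by linarith [ht.2]⟩

theorem sum_convex_le_of_sum_min_le {hs ks : List ℝ} {O τ K : ℝ} {f : ℝ → ℝ} (hO : 0 ≤ O)
    (hτ : 0 ≤ τ) (hK : 0 ≤ K) (hf : ConvexOn ℝ (Set.Icc 0 τ) f) (ha : AntitoneOn f (Set.Icc 0 τ))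
    (f0 : f 0 = 0) (hKf : ∀ t ∈ Set.Icc 0 τ, -(K * t) ≤ f t) (hh : ∀ h ∈ hs, 0 ≤ h)
    (hk : ∀ k ∈ ks, 0 ≤ k)
    (hsum : ∀ t ∈ Set.Icc 0 τ, (hs.map (min · t)).sum ≤ (ks.map (min · t)).sum + O) :
    (ks.map fun k => f (min k τ)).sum ≤ (hs.map fun h => f (min h τ)).sum + K * O := by
  refine sum_convex_le_of_sum_min_le_aux hO ((hs ++ ks).toFinset.filter (· < τ)) τ K f hτ hK hf ha
    f0 hKf (fun s hs' => ?_) (fun h hm => ⟨hh h hm, fun hlt => ?_⟩)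
    (fun h hm => ⟨hk h hm, fun hlt => ?_⟩) hsum
  · simp only [Finset.mem_filter, List.mem_toFinset, List.mem_append] at hs'
    exact ⟨hs'.1.elim (hh s) (hk s), hs'.2⟩
  · simp [hm, hlt]
  · simp [hm, hlt]

/-! ### Convex functions and their minimizers -/

theorem monotoneOn_of_convexOn_of_isMinOn {f : ℝ → ℝ} {m : ℝ} (hf : ConvexOn ℝ (Set.Icc 0 1) f)
    (hm : m ∈ Set.Icc (0 : ℝ) 1) (hmin : IsMinOn f (Set.Icc 0 1) m) :
    MonotoneOn f (Set.Icc m 1) := by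
  rintro x ⟨hx0, hx1⟩ y ⟨hy0, hy1⟩ hxy
  rcases hxy.eq_or_lt with rfl | hxy
  · rfl
  rcases hx0.eq_or_lt with rfl | hx0
  · exact hmin ⟨by linarith [hm.1], hy1⟩
  have h := hf.slope_mono_adjacent hm ⟨by linarith [hm.1], hy1⟩ hx0 hxy
  have h1 : f m ≤ f x := hmin ⟨by linarith [hm.1], hx1⟩
  have h2 : 0 ≤ (f x - f m) / (x - m) := div_nonneg (by linarith) (by linarith)
  have h3 := h2.trans h
  rw [le_div_iff₀ (by linarith), zero_mul] at h3
  linarith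

theorem antitoneOn_of_convexOn_of_isMinOn {f : ℝ → ℝ} {m : ℝ} (hf : ConvexOn ℝ (Set.Icc 0 1) f)
    (hm : m ∈ Set.Icc (0 : ℝ) 1) (hmin : IsMinOn f (Set.Icc 0 1) m) :
    AntitoneOn f (Set.Icc 0 m) := by
  rintro x ⟨hx0, hx1⟩ y ⟨hy0, hy1⟩ hxy
  rcases hxy.eq_or_lt with rfl | hxy
  · rfl
  rcases hy1.eq_or_lt with rfl | hy1
  · exact hmin ⟨by linarith [hm.1], by linarith [hm.2]⟩
  have h := hf.slope_mono_adjacent ⟨hx0, by linarith [hm.2]⟩ hm hxy hy1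
  have h1 : f m ≤ f y := hmin ⟨by linarith, by linarith [hm.2]⟩
  have h2 : (f m - f y) / (m - y) ≤ 0 := div_nonpos_of_nonpos_of_nonneg (by linarith) (by linarith)
  have h3 := h.trans h2
  rw [div_le_iff₀ (by linarith), zero_mul] at h3
  linarith

theorem convexOn_comp_max_of_isMinOn {f : ℝ → ℝ} {m : ℝ} (hf : ConvexOn ℝ (Set.Icc 0 1) f)
    (hm : m ∈ Set.Icc (0 : ℝ) 1) (hmin : IsMinOn f (Set.Icc 0 1) m) :
    ConvexOn ℝ (Set.Icc 0 1) fun x => f (max x m) := by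
  have hmono := monotoneOn_of_convexOn_of_isMinOn hf hm hmin
  refine ⟨convex_Icc _ _, fun x hx y hy a b ha hb hab => ?_⟩
  have hX : max x m ∈ Set.Icc (0 : ℝ) 1 := ⟨le_max_of_le_left hx.1, max_le hx.2 hm.2⟩
  have hY : max y m ∈ Set.Icc (0 : ℝ) 1 := ⟨le_max_of_le_left hy.1, max_le hy.2 hm.2⟩
  have hle : max (a • x + b • y) m ≤ a • max x m + b • max y m := by
    simp only [smul_eq_mul]
    refine max_le ?_ ?_
    · gcongr <;> exact le_max_left _ _
    · calc m = a * m + b * m := by rw [← add_mul, hab, one_mul]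
        _ ≤ _ := by gcongr <;> exact le_max_right _ _
  have hC := convex_Icc (0 : ℝ) 1 hX hY ha hb hab
  exact (hmono ⟨le_max_right _ _, hle.trans hC.2⟩ ⟨(le_max_right _ _).trans hle, hC.2⟩ hle).trans
    (hf.2 hX hY ha hb hab)

/-! ### Comparison of two families of strokes -/

/-- `f` prices strokes in one direction, `g` strokes in the other, with minimizers `v ≤ u ≤ w` of
`f`, `f + g`, `g`. The strokes `ky`, `kz` of depth at most `u` are compared with the strokes `hy`,
`hz`, whose truncated sums exceed theirs by at most `O`. -/
theorem stroke_cost_le {f g : ℝ → ℝ} {u v w Kf Kg O : ℝ} {hy hz ky kz : List ℝ}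
    (hf : ConvexOn ℝ (Set.Icc 0 1) f) (hg : ConvexOn ℝ (Set.Icc 0 1) g)
    (f0 : f 0 = 0) (g0 : g 0 = 0)
    (hu : u ∈ Set.Icc (0 : ℝ) 1) (hv : v ∈ Set.Icc (0 : ℝ) 1) (hw : w ∈ Set.Icc (0 : ℝ) 1)
    (hu_min : IsMinOn (fun x => f x + g x) (Set.Icc 0 1) u)
    (hv_min : IsMinOn f (Set.Icc 0 1) v) (hw_min : IsMinOn g (Set.Icc 0 1) w)
    (hvu : v ≤ u) (huw : u ≤ w) (hKf : 0 ≤ Kf) (hKg : 0 ≤ Kg) (hO : 0 ≤ O)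
    (hfK : ∀ t ∈ Set.Icc (0 : ℝ) 1, -(Kf * t) ≤ f t)
    (hgK : ∀ t ∈ Set.Icc (0 : ℝ) 1, -(Kg * t) ≤ g t)
    (hy_mem : ∀ x ∈ hy, x ∈ Set.Icc (0 : ℝ) 1) (hz_mem : ∀ x ∈ hz, x ∈ Set.Icc (0 : ℝ) 1)
    (ky_mem : ∀ x ∈ ky, x ∈ Set.Icc 0 u) (kz_mem : ∀ x ∈ kz, x ∈ Set.Icc 0 u)
    (sum_y : ∀ t ∈ Set.Icc 0 u, (hy.map (min · t)).sum ≤ (ky.map (min · t)).sum + O)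
    (sum_z : ∀ t ∈ Set.Icc 0 u, (hz.map (min · t)).sum ≤ (kz.map (min · t)).sum + O)
    (bal_h : ∀ c : ℝ → ℝ, MonotoneOn c (Set.Icc 0 1) → (∀ x ∈ Set.Icc (0 : ℝ) 1, 0 ≤ c x) →
      |(hy.map c).sum - (hz.map c).sum| ≤ c 1)
    (bal_k : ∀ c : ℝ → ℝ, MonotoneOn c (Set.Icc 0 1) → (∀ x ∈ Set.Icc (0 : ℝ) 1, 0 ≤ c x) →
      |(ky.map c).sum - (kz.map c).sum| ≤ c u) :
    (ky.map f).sum + (kz.map g).sum ≤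
      (hy.map f).sum + (hz.map g).sum + (Kf + Kg) * O + (2 * (f u - f v) + (g u - g w)) := by
  obtain ⟨u0, u1⟩ := hu
  obtain ⟨v0, v1⟩ := hv
  obtain ⟨w0, w1⟩ := hw
  have fmono := monotoneOn_of_convexOn_of_isMinOn hf ⟨v0, v1⟩ hv_min
  have ganti := antitoneOn_of_convexOn_of_isMinOn hg ⟨w0, w1⟩ hw_min
  set c : ℝ → ℝ := fun h => f (max (min h u) v) - f v + (g u - g (min (max h u) w)) with hc
  have cmono : MonotoneOn c (Set.Icc 0 1) := by
    rintro x ⟨x0, x1⟩ y ⟨y0, y1⟩ hxy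
    have h1 : f (max (min x u) v) ≤ f (max (min y u) v) := by
      refine fmono ⟨le_max_right _ _, max_le ((min_le_right _ _).trans u1) v1⟩
        ⟨le_max_right _ _, max_le ((min_le_right _ _).trans u1) v1⟩ ?_
      gcongr
    have h2 : g (min (max y u) w) ≤ g (min (max x u) w) := by
      refine ganti ⟨le_min (le_max_of_le_left x0) w0, min_le_right _ _⟩
        ⟨le_min (le_max_of_le_left y0) w0, min_le_right _ _⟩ ?_
      gcongr
    simp only [hc]; linarith
  have c0 : ∀ x ∈ Set.Icc (0 : ℝ) 1, 0 ≤ c x := by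
    intro x hx
    refine le_trans ?_ (cmono ⟨le_rfl, zero_le_one⟩ hx hx.1)
    simp [hc, u0, v0, huw]
  have cu : c u = f u - f v := by simp [hc, hvu, huw]
  have c1 : c 1 = f u - f v + (g u - g w) := by simp [hc, hvu, u1, w1]
  set gz : ℝ → ℝ := fun h => g h + (f (max h v) - f v) with hgz
  have gz_conv : ConvexOn ℝ (Set.Icc 0 1) gz :=
    hg.add ((convexOn_comp_max_of_isMinOn hf ⟨v0, v1⟩ hv_min).add_const (-f v))
  have gz_min : IsMinOn gz (Set.Icc 0 1) u := by
    have key : ∀ x ∈ Set.Icc v 1, gz u ≤ gz x := by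
      rintro x ⟨x0, x1⟩
      have : f u + g u ≤ f x + g x := hu_min ⟨by linarith, x1⟩
      simp only [hgz, max_eq_left hvu, max_eq_left x0]
      linarith
    rintro x ⟨x0, x1⟩
    rcases le_total v x with h | h
    · exact key x ⟨h, x1⟩
    · have h1 : g v ≤ g x := ganti ⟨x0, by linarith⟩ ⟨v0, by linarith⟩ h
      refine (key v ⟨le_rfl, v1⟩).trans ?_
      simp only [hgz, max_self, max_eq_right h]
      linarith
  have gz_anti := antitoneOn_of_convexOn_of_isMinOn gz_conv ⟨u0, u1⟩ gz_min
  have f_anti := antitoneOn_of_convexOn_of_isMinOn hf ⟨v0, v1⟩ hv_min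
  have maj_y := sum_convex_le_of_sum_min_le hO v0 hKf
    (hf.subset (Set.Icc_subset_Icc_right v1) (convex_Icc _ _)) f_anti f0
    (fun t ht => hfK t ⟨ht.1, ht.2.trans v1⟩) (fun x hx => (hy_mem x hx).1)
    (fun x hx => (ky_mem x hx).1) fun t ht => sum_y t ⟨ht.1, ht.2.trans hvu⟩
  have maj_z := sum_convex_le_of_sum_min_le hO u0 hKg
    (gz_conv.subset (Set.Icc_subset_Icc_right u1) (convex_Icc _ _)) gz_anti
    (by simp [hgz, g0, v0])
    (fun t ht => by
      have h1 := hgK t ⟨ht.1, ht.2.trans u1⟩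
      have h2 : f v ≤ f (max t v) := hv_min ⟨le_max_of_le_left ht.1, max_le (ht.2.trans u1) v1⟩
      simp only [hgz]; linarith)
    (fun x hx => (hz_mem x hx).1) (fun x hx => (kz_mem x hx).1) sum_z
  have bh := abs_le.1 (bal_h c cmono c0)
  have bk := abs_le.1 (bal_k c cmono c0)
  have e_ky : (ky.map f).sum = (ky.map fun k => f (min k v)).sum + 1 * (ky.map c).sum := by
    apply sum_map_eq_add_mul
    intro x hx
    obtain ⟨x0, x1⟩ := ky_mem x hx
    simp only [hc, min_eq_left x1, max_eq_right x1, min_eq_left huw]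
    rcases le_total x v with h | h
    · simp [h]
    · simp [h]
  have e_kz : (kz.map g).sum = (kz.map fun k => gz (min k u)).sum + -1 * (kz.map c).sum := by
    apply sum_map_eq_add_mul
    intro x hx
    obtain ⟨x0, x1⟩ := kz_mem x hx
    simp only [hc, hgz, min_eq_left x1, max_eq_right x1, min_eq_left huw]
    ring
  have e_hy : (hy.map fun h => f (min h v)).sum + 1 * (hy.map c).sum ≤ (hy.map f).sum := by
    rw [← sum_map_eq_add_mul (f := fun h => f (min h v) + 1 * c h) (fun _ _ => rfl)]
    apply List.sum_le_sum
    intro x hx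
    obtain ⟨x0, x1⟩ := hy_mem x hx
    simp only [hc]
    rcases le_total x u with h | h
    · simp only [min_eq_left h, max_eq_right h, min_eq_left huw]
      rcases le_total x v with h | h
      · simp [h]
      · simp [h]
    · rw [min_eq_right (hvu.trans h), min_eq_right h, max_eq_left hvu, max_eq_left h]
      rcases le_total x w with h' | h'
      · rw [min_eq_left h']
        have : f u + g u ≤ f x + g x := hu_min ⟨x0, x1⟩
        linarith
      · rw [min_eq_right h']
        have h1 : f u + g u ≤ f w + g w := hu_min ⟨w0, w1⟩
        have h2 : f w ≤ f x := fmono ⟨hvu.trans huw, w1⟩ ⟨hvu.trans h, x1⟩ h'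
        linarith
  have e_hz : (hz.map fun h => gz (min h u)).sum + -1 * (hz.map c).sum ≤ (hz.map g).sum := by
    rw [← sum_map_eq_add_mul (f := fun h => gz (min h u) + -1 * c h) (fun _ _ => rfl)]
    apply List.sum_le_sum
    intro x hx
    obtain ⟨x0, x1⟩ := hz_mem x hx
    simp only [hc, hgz]
    rcases le_total x u with h | h
    · simp only [min_eq_left h, max_eq_right h, min_eq_left huw]
      linarith
    · simp only [min_eq_right h, max_eq_left h]
      have : g (min x w) ≤ g x := by
        rcases le_total x w with h' | h'
        · rw [min_eq_left h']
        · rw [min_eq_right h']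
          exact hw_min ⟨x0, x1⟩
      linarith
  linarith

/-! ### The stop operator along a sequence -/

/-- The points of a sequence up to index `N`, as a profile. -/
def profileOf (N : ℕ) (z : ℕ → ℝ) : List ℝ := (List.range (N + 1)).map z

/-- The state of the stop operator of width `t`, started at `β`, along a sequence. -/
def stopState (t β : ℝ) (z : ℕ → ℝ) : ℕ → ℝ
  | 0 => β
  | n + 1 => clampTo t (stopState t β z n + (z (n + 1) - z n))

theorem stopState_shift (t β : ℝ) (z : ℕ → ℝ) (n : ℕ) :
    stopState t β z (n + 1) =
      stopState t (clampTo t (β + (z 1 - z 0))) (fun k => z (k + 1)) n := by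
  induction n with
  | zero => rfl
  | succ n ih => rw [stopState, ih]; rfl

theorem profileOf_succ (N : ℕ) (z : ℕ → ℝ) :
    profileOf (N + 1) z = z 0 :: profileOf N fun k => z (k + 1) := by
  rw [profileOf, List.range_succ_eq_map, List.map_cons, List.map_map]
  rfl

theorem profileOf_cons (N : ℕ) (z : ℕ → ℝ) : ∃ l, profileOf N z = z 0 :: l := by
  cases N with
  | zero => exact ⟨[], rfl⟩
  | succ N => exact ⟨_, profileOf_succ N z⟩

theorem profileOf_neg (N : ℕ) (z : ℕ → ℝ) :
    profileOf N (fun n => -z n) = (profileOf N z).map (- ·) := by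
  rw [profileOf, profileOf, List.map_map]
  rfl

theorem mem_profileOf {N : ℕ} {z : ℕ → ℝ} {x : ℝ} :
    x ∈ profileOf N z ↔ ∃ n ≤ N, z n = x := by
  simp [profileOf]

theorem stopDown_profileOf (t β : ℝ) (N : ℕ) (z : ℕ → ℝ) :
    stopDown t β (profileOf N z) =
      ∑ n ∈ Finset.range N, max (stopState t β z n - stopState t β z (n + 1)) 0 := by
  induction N generalizing β z with
  | zero => simp [profileOf, stopDown]
  | succ N ih =>
    obtain ⟨l, hl⟩ := profileOf_cons N fun k => z (k + 1)
    have := ih (clampTo t (β + (z 1 - z 0))) fun k => z (k + 1)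
    rw [profileOf_succ, Finset.sum_range_succ']
    rw [hl] at this ⊢
    simp only [zero_add] at this ⊢
    rw [stopDown, this, add_comm]
    simp only [stopState_shift t β z]
    rfl

theorem stopState_mem {t β : ℝ} (hβ : β ∈ Set.Icc 0 t) (z : ℕ → ℝ) (n : ℕ) :
    stopState t β z n ∈ Set.Icc 0 t := by
  cases n with
  | zero => exact hβ
  | succ n => exact clampTo_mem (hβ.1.trans hβ.2)

/-- A stop operator started with less room below, but at least down to a lower bound of the
sequence, has the same downward variation. -/
theorem stopState_lower {t lo : ℝ} (ht : 0 ≤ t) {N : ℕ} {z : ℕ → ℝ} (hz : ∀ n ≤ N, lo ≤ z n) :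
    ∀ n ≤ N, min (stopState t t z n) (z n - lo) =
      stopState t (min t (z 0 - lo)) z n := by
  intro n hn
  induction n with
  | zero => rfl
  | succ n ih =>
    have h1 := stopState_mem ⟨ht, le_rfl⟩ z n (t := t)
    rw [stopState, stopState, ← ih (by omega)]
    have h2 := hz n (by omega)
    have h3 := hz (n + 1) hn
    have e : min (stopState t t z n) (z n - lo) + (z (n + 1) - z n) =
        min (stopState t t z n + (z (n + 1) - z n)) (z (n + 1) - lo) := by
      rw [← min_add_add_right]; congr 1; ring
    rw [e]
    generalize stopState t t z n + (z (n + 1) - z n) = q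
    rcases clampTo_cases ht q with ⟨p, q, e1⟩ | ⟨p, e1⟩ | ⟨p, e1⟩ <;> rw [e1]
    · rw [clampTo_of_mem]
      · exact le_min p (by linarith)
      · exact (min_le_left _ _).trans q
    · rw [clampTo, max_eq_right, min_comm q, min_assoc, min_eq_right p, min_comm]
      exact le_min (le_min (by linarith) (by linarith)) ht
    · rw [min_eq_left (by linarith), clampTo_of_nonpos ((min_le_left _ _).trans p)]

theorem stopDown_lower {t lo : ℝ} (ht : 0 ≤ t) {N : ℕ} {z : ℕ → ℝ} (hz : ∀ n ≤ N, lo ≤ z n) :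
    stopDown t t (profileOf N z) = stopDown t (min t (z 0 - lo)) (profileOf N z) := by
  rw [stopDown_profileOf, stopDown_profileOf]
  refine Finset.sum_congr rfl fun n hn => ?_
  have hn := Finset.mem_range.1 hn
  rw [← stopState_lower ht hz n hn.le, ← stopState_lower ht hz (n + 1) hn]
  have h1 := stopState_mem ⟨ht, le_rfl⟩ z n (t := t)
  have h2 := hz n (by omega)
  have h3 := hz (n + 1) hn
  rw [stopState]
  generalize stopState t t z n = B at *
  rcases clampTo_cases ht (B + (z (n + 1) - z n)) with ⟨p, q, e1⟩ | ⟨p, e1⟩ | ⟨p, e1⟩ <;> rw [e1]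
  · have : min (B + (z (n + 1) - z n)) (z (n + 1) - lo) =
        min B (z n - lo) + (z (n + 1) - z n) := by
      rw [← min_add_add_right]; congr 1; ring
    rw [this]
    congr 1
    ring
  · rw [max_eq_right (by linarith [h1.2]), max_eq_right]
    have : min B (z n - lo) ≤ min t (z (n + 1) - lo) := by
      refine min_le_min h1.2 ?_
      linarith [h1.2]
    linarith
  · rw [min_eq_left (by linarith), min_eq_left (by linarith)]

theorem stopState_ge_of_le {t M : ℝ} (ht : 0 ≤ t) {z : ℕ → ℝ} {n : ℕ} (hM : ∀ k ≤ n, z k ≤ M) :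
    t - (M - z n) ≤ stopState t t z n := by
  induction n with
  | zero => have := hM 0 le_rfl; rw [stopState]; linarith
  | succ n ih =>
    have i := ih fun k hk => hM k (by omega)
    have h := hM (n + 1) le_rfl
    rw [stopState]
    rcases clampTo_cases ht (stopState t t z n + (z (n + 1) - z n)) with
      ⟨p, q, e1⟩ | ⟨p, e1⟩ | ⟨p, e1⟩ <;> linarith

theorem stopState_le_of_ge {t m : ℝ} (ht : 0 ≤ t) {z : ℕ → ℝ} {n : ℕ} (hm : ∀ k ≤ n, m ≤ z k)
    {i : ℕ} (hi : i ≤ n) : stopState t t z n ≤ max (z n - m) (t - (z i - z n)) := by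
  induction n with
  | zero =>
    obtain rfl : i = 0 := by omega
    simp [stopState]
  | succ n ih =>
    have h := hm (n + 1) le_rfl
    rcases hi.eq_or_lt with rfl | hi
    · rw [sub_self, sub_zero]
      exact (stopState_mem ⟨ht, le_rfl⟩ z _).2.trans (le_max_right _ _)
    have i' := ih (fun k hk => hm k (by omega)) (by omega)
    rw [stopState]
    rcases clampTo_cases ht (stopState t t z n + (z (n + 1) - z n)) with
      ⟨p, q, e1⟩ | ⟨p, e1⟩ | ⟨p, e1⟩ <;> rw [e1]
    · rcases le_max_iff.1 i' with h' | h'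
      · exact le_max_of_le_left (by linarith)
      · exact le_max_of_le_right (by linarith)
    · rcases le_max_iff.1 i' with h' | h'
      · exact le_max_of_le_left (by linarith)
      · exact le_max_of_le_right (by linarith)
    · exact le_max_of_le_left (by linarith)

theorem stopDown_eq_of_wide {t lo hi : ℝ} (ht : 0 ≤ t) (hw : hi - lo ≤ t) {N : ℕ} {z : ℕ → ℝ}
    (hz : ∀ n ≤ N, z n ∈ Set.Icc lo hi) :
    stopDown t t (profileOf N z) = ∑ n ∈ Finset.range N, max (z n - z (n + 1)) 0 := by
  rw [stopDown_profileOf]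
  refine Finset.sum_congr rfl fun n hn => ?_
  have hn := Finset.mem_range.1 hn
  have h1 := stopState_ge_of_le ht (z := z) (n := n) fun k hk => (hz k (by omega)).2
  have h2 := (hz (n + 1) hn).1
  have h3 := stopState_mem ⟨ht, le_rfl⟩ z n (t := t)
  rw [stopState]
  rcases clampTo_cases ht (stopState t t z n + (z (n + 1) - z n)) with
    ⟨p, q, e1⟩ | ⟨p, e1⟩ | ⟨p, e1⟩ <;> rw [e1]
  · congr 1; ring
  · rw [max_eq_right (by linarith [h3.2]), max_eq_right (by linarith [h3.2])]
  · congr 1; linarith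

/-! ### Paths that follow an instruction -/

/-- A path in `[lo, hi]` whose range is at most `u` and which follows the instructed steps `ρ`
unless stopped by one of these limits. -/
structure ThresholdPath (u lo hi : ℝ) (N : ℕ) (ρ y : ℕ → ℝ) : Prop where
  mem : ∀ n ≤ N, y n ∈ Set.Icc lo hi
  range : ∀ i ≤ N, ∀ j ≤ N, y i - y j ≤ u
  up : ∀ n < N, 0 ≤ ρ n → y n ≤ y (n + 1) ∧ y (n + 1) ≤ y n + ρ n ∧
    (y (n + 1) = y n + ρ n ∨ y (n + 1) = hi ∨ ∃ j ≤ n, y (n + 1) = y j + u)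
  down : ∀ n < N, ρ n ≤ 0 → y (n + 1) ≤ y n ∧ y n + ρ n ≤ y (n + 1) ∧
    (y (n + 1) = y n + ρ n ∨ y (n + 1) = lo ∨ ∃ j ≤ n, y (n + 1) = y j - u)

/-- A path in `[lo, hi]` that exceeds the instructed steps `ρ` by at most `o`. -/
structure ResponsePath (lo hi : ℝ) (N : ℕ) (ρ o z : ℕ → ℝ) : Prop where
  mem : ∀ n ≤ N, z n ∈ Set.Icc lo hi
  nonneg : ∀ n < N, 0 ≤ o n
  up : ∀ n < N, 0 ≤ ρ n → -o n ≤ z (n + 1) - z n ∧ z (n + 1) - z n ≤ ρ n + o n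
  down : ∀ n < N, ρ n ≤ 0 → ρ n - o n ≤ z (n + 1) - z n ∧ z (n + 1) - z n ≤ o n

theorem ThresholdPath.neg {u lo hi : ℝ} {N : ℕ} {ρ y : ℕ → ℝ} (h : ThresholdPath u lo hi N ρ y) :
    ThresholdPath u (-hi) (-lo) N (fun n => -ρ n) fun n => -y n where
  mem n hn := ⟨neg_le_neg (h.mem n hn).2, neg_le_neg (h.mem n hn).1⟩
  range i hi j hj := by linarith [h.range j hj i hi]
  up n hn hρ := by
    obtain ⟨h1, h2, h3⟩ := h.down n hn (by linarith)
    refine ⟨by linarith, by linarith, ?_⟩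
    rcases h3 with h3 | h3 | ⟨j, hj, h3⟩
    · exact Or.inl (by linarith)
    · exact Or.inr (Or.inl (by linarith))
    · exact Or.inr (Or.inr ⟨j, hj, by linarith⟩)
  down n hn hρ := by
    obtain ⟨h1, h2, h3⟩ := h.up n hn (by linarith)
    refine ⟨by linarith, by linarith, ?_⟩
    rcases h3 with h3 | h3 | ⟨j, hj, h3⟩
    · exact Or.inl (by linarith)
    · exact Or.inr (Or.inl (by linarith))
    · exact Or.inr (Or.inr ⟨j, hj, by linarith⟩)

theorem ResponsePath.neg {lo hi : ℝ} {N : ℕ} {ρ o z : ℕ → ℝ} (h : ResponsePath lo hi N ρ o z) :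
    ResponsePath (-hi) (-lo) N (fun n => -ρ n) o fun n => -z n where
  mem n hn := ⟨neg_le_neg (h.mem n hn).2, neg_le_neg (h.mem n hn).1⟩
  nonneg := h.nonneg
  up n hn hρ := by
    obtain ⟨h1, h2⟩ := h.down n hn (by linarith)
    constructor <;> linarith
  down n hn hρ := by
    obtain ⟨h1, h2⟩ := h.up n hn (by linarith)
    constructor <;> linarith

theorem stop_step_up {t b b' ρ o ξ ξ' E : ℝ} (hb : b ∈ Set.Icc 0 t) (hb' : b' ∈ Set.Icc 0 t)
    (h1 : -o ≤ ξ) (h2 : ξ ≤ ρ + o) (h0 : 0 ≤ o) (h3 : 0 ≤ ξ')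
    (h5 : ξ' = ρ ∨ clampTo t (b + ξ) ≤ clampTo t (b' + ξ')) (hE0 : 0 ≤ E) (hE : b - b' ≤ E) :
    0 ≤ E + (max (b' - clampTo t (b' + ξ')) 0 - max (b - clampTo t (b + ξ)) 0 + o) ∧
    clampTo t (b + ξ) - clampTo t (b' + ξ') ≤
      E + (max (b' - clampTo t (b' + ξ')) 0 - max (b - clampTo t (b + ξ)) 0 + o) := by
  have ht := hb.1.trans hb.2
  obtain ⟨b0, b1⟩ := hb
  obtain ⟨c0, c1⟩ := hb'
  have hmono : b' ≤ clampTo t (b' + ξ') := by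
    rcases clampTo_cases ht (b' + ξ') with ⟨p, q, e1⟩ | ⟨p, e1⟩ | ⟨p, e1⟩ <;> linarith
  rw [max_eq_right (a := b' - _) (by linarith)]
  have hle : max (b - clampTo t (b + ξ)) 0 ≤ o := by
    refine max_le ?_ h0
    rcases clampTo_cases ht (b + ξ) with ⟨p, q, e1⟩ | ⟨p, e1⟩ | ⟨p, e1⟩ <;> linarith
  refine ⟨by linarith, ?_⟩
  rcases le_total (b - clampTo t (b + ξ)) 0 with h | h
  · rw [max_eq_right h]
    rcases h5 with rfl | h5
    · rcases clampTo_cases ht (b + ξ) with ⟨p, q, e1⟩ | ⟨p, e1⟩ | ⟨p, e1⟩ <;>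
      rcases clampTo_cases ht (b' + ξ') with ⟨p', q', e2⟩ | ⟨p', e2⟩ | ⟨p', e2⟩ <;>
      linarith
    · linarith
  · rw [max_eq_left h]
    linarith

theorem stop_step_down {t b b' ρ o ξ ξ' E : ℝ} (hb : b ∈ Set.Icc 0 t) (hb' : b' ∈ Set.Icc 0 t)
    (h1 : ρ - o ≤ ξ) (h2 : ξ ≤ o) (h0 : 0 ≤ o) (h3 : ξ' ≤ 0)
    (h5 : ξ' = ρ ∨ clampTo t (b' + ξ') = 0) (hE0 : 0 ≤ E) (hE : b - b' ≤ E) :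
    0 ≤ E + (max (b' - clampTo t (b' + ξ')) 0 - max (b - clampTo t (b + ξ)) 0 + o) ∧
    clampTo t (b + ξ) - clampTo t (b' + ξ') ≤
      E + (max (b' - clampTo t (b' + ξ')) 0 - max (b - clampTo t (b + ξ)) 0 + o) := by
  have ht := hb.1.trans hb.2
  obtain ⟨b0, b1⟩ := hb
  obtain ⟨c0, c1⟩ := hb'
  have hmono : clampTo t (b' + ξ') ≤ b' := by
    rcases clampTo_cases ht (b' + ξ') with ⟨p, q, e1⟩ | ⟨p, e1⟩ | ⟨p, e1⟩ <;> linarith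
  rw [max_eq_left (a := b' - _) (by linarith)]
  rcases le_total (b - clampTo t (b + ξ)) 0 with h | h
  · rw [max_eq_right h]
    refine ⟨by linarith, ?_⟩
    rcases clampTo_cases ht (b + ξ) with ⟨p, q, e1⟩ | ⟨p, e1⟩ | ⟨p, e1⟩ <;> linarith
  · rw [max_eq_left h]
    refine ⟨?_, by linarith⟩
    rcases h5 with rfl | h5
    · rcases clampTo_cases ht (b + ξ) with ⟨p, q, e1⟩ | ⟨p, e1⟩ | ⟨p, e1⟩ <;>
      rcases clampTo_cases ht (b' + ξ') with ⟨p', q', e2⟩ | ⟨p', e2⟩ | ⟨p', e2⟩ <;>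
      linarith
    · have := (clampTo_mem (x := b + ξ) ht).1
      linarith

/-- Among all responses, the threshold path has the largest downward stop variation, at every
width up to its threshold. -/
theorem stopDown_le_of_thresholdPath {u lo hi t : ℝ} {N : ℕ} {ρ o y z : ℕ → ℝ}
    (hy : ThresholdPath u lo hi N ρ y) (hz : ResponsePath lo hi N ρ o z) (h0 : y 0 = z 0)
    (ht : t ∈ Set.Icc 0 u) :
    stopDown t t (profileOf N z) ≤
      stopDown t t (profileOf N y) + ∑ n ∈ Finset.range N, o n := by
  obtain ⟨t0, t1⟩ := ht
  have ylo : ∀ n ≤ N, lo ≤ y n := fun n hn => (hy.mem n hn).1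
  have zlo : ∀ n ≤ N, lo ≤ z n := fun n hn => (hz.mem n hn).1
  have blocked_up : ∀ n < N, (y (n + 1) = hi ∨ ∃ j ≤ n, y (n + 1) = y j + u) →
      min t (hi - lo) ≤ stopState t (min t (y 0 - lo)) y (n + 1) := by
    intro n hn h
    rw [← stopState_lower t0 ylo (n + 1) hn]
    have hmax : ∀ k ≤ n + 1, y k ≤ y (n + 1) := by
      intro k hk
      rcases h with h | ⟨j, hj, h⟩
      · rw [h]; exact (hy.mem k (by omega)).2
      · linarith [hy.range k (by omega) j (by omega)]
    have hB := stopState_ge_of_le t0 hmax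
    rw [sub_self, sub_zero] at hB
    refine le_min ((min_le_left _ _).trans hB) ?_
    rcases h with h | ⟨j, hj, h⟩
    · rw [h]; exact min_le_right _ _
    · exact (min_le_left _ _).trans (by linarith [ylo j (by omega)])
  have blocked_down : ∀ n < N, (y (n + 1) = lo ∨ ∃ j ≤ n, y (n + 1) = y j - u) →
      stopState t (min t (y 0 - lo)) y (n + 1) = 0 := by
    intro n hn h
    rw [← stopState_lower t0 ylo (n + 1) hn]
    have hB := (stopState_mem ⟨t0, le_rfl⟩ y (n + 1) (t := t)).1
    rcases h with h | ⟨j, hj, h⟩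
    · rw [h, sub_self, min_eq_right hB]
    · have := stopState_le_of_ge t0 (z := y) (n := n + 1) (m := y (n + 1))
        (fun k hk => by linarith [hy.range j (by omega) k (by omega)]) (i := j) (by omega)
      rw [sub_self, max_eq_left (by linarith)] at this
      rw [min_eq_left (by linarith [ylo (n + 1) hn])]
      exact le_antisymm this hB
  rw [stopDown_lower t0 ylo, stopDown_lower t0 zlo, ← h0, stopDown_profileOf, stopDown_profileOf]
  set β := min t (y 0 - lo) with hβ
  have hβm : β ∈ Set.Icc 0 t := ⟨le_min t0 (by linarith [ylo 0 (Nat.zero_le _)]), min_le_left _ _⟩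
  have ztop : ∀ n ≤ N, stopState t β z n ≤ min t (hi - lo) := by
    intro n hn
    rw [hβ, h0, ← stopState_lower t0 zlo n hn]
    exact min_le_min (stopState_mem ⟨t0, le_rfl⟩ z n).2 (by linarith [(hz.mem n hn).2])
  have key : ∀ n ≤ N, 0 ≤ ∑ k ∈ Finset.range n,
        (max (stopState t β y k - stopState t β y (k + 1)) 0 -
          max (stopState t β z k - stopState t β z (k + 1)) 0 + o k) ∧
      stopState t β z n - stopState t β y n ≤ ∑ k ∈ Finset.range n,
        (max (stopState t β y k - stopState t β y (k + 1)) 0 -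
          max (stopState t β z k - stopState t β z (k + 1)) 0 + o k) := by
    intro n hn
    induction n with
    | zero => simp [stopState]
    | succ n ih =>
      obtain ⟨i1, i2⟩ := ih (by omega)
      rw [Finset.sum_range_succ]
      rcases le_total 0 (ρ n) with hρ | hρ
      · obtain ⟨a1, a2, a3⟩ := hy.up n hn hρ
        obtain ⟨b1, b2⟩ := hz.up n hn hρ
        refine stop_step_up (stopState_mem hβm z n) (stopState_mem hβm y n) b1 b2
          (hz.nonneg n hn) (by linarith) ?_ i1 i2
        rcases a3 with a3 | a3
        · left; linarith
        · right
          exact (ztop (n + 1) hn).trans (blocked_up n hn a3)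
      · obtain ⟨a1, a2, a3⟩ := hy.down n hn hρ
        obtain ⟨b1, b2⟩ := hz.down n hn hρ
        refine stop_step_down (stopState_mem hβm z n) (stopState_mem hβm y n) b1 b2
          (hz.nonneg n hn) (by linarith) ?_ i1 i2
        rcases a3 with a3 | a3
        · left; linarith
        · right
          exact blocked_down n hn a3
  have := (key N le_rfl).1
  rw [Finset.sum_add_distrib, Finset.sum_sub_distrib] at this
  linarith

theorem sum_min_downs_le {u lo hi t : ℝ} {N : ℕ} {ρ o y z : ℕ → ℝ}
    (hy : ThresholdPath u lo hi N ρ y) (hz : ResponsePath lo hi N ρ o z) (h0 : y 0 = z 0)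
    (ht : t ∈ Set.Icc 0 u) :
    ((rainflow (profileOf N z)).downs.map (min · t)).sum ≤
      ((rainflow (profileOf N y)).downs.map (min · t)).sum + ∑ n ∈ Finset.range N, o n := by
  rw [sum_min_downs ht.1, sum_min_downs ht.1]
  exact stopDown_le_of_thresholdPath hy hz h0 ht

theorem sum_min_ups_le {u lo hi t : ℝ} {N : ℕ} {ρ o y z : ℕ → ℝ}
    (hy : ThresholdPath u lo hi N ρ y) (hz : ResponsePath lo hi N ρ o z) (h0 : y 0 = z 0)
    (ht : t ∈ Set.Icc 0 u) :
    ((rainflow (profileOf N z)).ups.map (min · t)).sum ≤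
      ((rainflow (profileOf N y)).ups.map (min · t)).sum + ∑ n ∈ Finset.range N, o n := by
  have := sum_min_downs_le hy.neg hz.neg (by simp [h0]) ht
  simpa only [profileOf_neg, downs_neg] using this

theorem abs_sub_le_of_mem_profileOf {lo hi w : ℝ} {N : ℕ} {z : ℕ → ℝ}
    (hz : ∀ n ≤ N, z n ∈ Set.Icc lo hi) (hw : hi - lo ≤ w) :
    ∀ p ∈ profileOf N z, ∀ q ∈ profileOf N z, |p - q| ≤ w := by
  intro p hp q hq
  obtain ⟨i, hi', rfl⟩ := mem_profileOf.1 hp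
  obtain ⟨j, hj, rfl⟩ := mem_profileOf.1 hq
  obtain ⟨a1, a2⟩ := hz i hi'
  obtain ⟨b1, b2⟩ := hz j hj
  rw [abs_le]
  constructor <;> linarith

theorem sum_downs {lo hi : ℝ} (hlh : lo ≤ hi) {N : ℕ} {z : ℕ → ℝ}
    (hz : ∀ n ≤ N, z n ∈ Set.Icc lo hi) :
    (rainflow (profileOf N z)).downs.sum = ∑ n ∈ Finset.range N, max (z n - z (n + 1)) 0 := by
  rw [← stopDown_eq_of_wide (sub_nonneg.2 hlh) le_rfl hz, ← sum_min_downs (sub_nonneg.2 hlh)]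
  conv_lhs => rw [← List.map_id (rainflow (profileOf N z)).downs]
  congr 1
  refine List.map_congr_left fun x hx => ?_
  exact (min_eq_left (downs_mem_Icc (abs_sub_le_of_mem_profileOf hz le_rfl) x hx).2).symm

theorem sum_ups {lo hi : ℝ} (hlh : lo ≤ hi) {N : ℕ} {z : ℕ → ℝ}
    (hz : ∀ n ≤ N, z n ∈ Set.Icc lo hi) :
    (rainflow (profileOf N z)).ups.sum = ∑ n ∈ Finset.range N, max (z (n + 1) - z n) 0 := by
  have := sum_downs (neg_le_neg hlh) (N := N) (z := fun n => -z n) fun n hn =>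
    ⟨neg_le_neg (hz n hn).2, neg_le_neg (hz n hn).1⟩
  rw [profileOf_neg, downs_neg] at this
  rw [this]
  refine Finset.sum_congr rfl fun n _ => ?_
  congr 1
  ring

/-- The strokes of a threshold path cost at most `2 (f u - f v) + (g u - g w)` more than those of
any other response; `f` prices upward and `g` downward strokes. -/
theorem ThresholdPath.cost_le {u v w lo hi Kf Kg : ℝ} {N : ℕ} {ρ o y z : ℕ → ℝ} {f g : ℝ → ℝ}
    (hy : ThresholdPath u lo hi N ρ y) (hz : ResponsePath lo hi N ρ o z) (h0 : y 0 = z 0)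
    (hlh : hi - lo ≤ 1)
    (hf : ConvexOn ℝ (Set.Icc 0 1) f) (hg : ConvexOn ℝ (Set.Icc 0 1) g)
    (f0 : f 0 = 0) (g0 : g 0 = 0)
    (hu : u ∈ Set.Icc (0 : ℝ) 1) (hv : v ∈ Set.Icc (0 : ℝ) 1) (hw : w ∈ Set.Icc (0 : ℝ) 1)
    (hu_min : IsMinOn (fun x => f x + g x) (Set.Icc 0 1) u)
    (hv_min : IsMinOn f (Set.Icc 0 1) v) (hw_min : IsMinOn g (Set.Icc 0 1) w)
    (hvu : v ≤ u) (huw : u ≤ w) (hKf : 0 ≤ Kf) (hKg : 0 ≤ Kg)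
    (hfK : ∀ t ∈ Set.Icc (0 : ℝ) 1, -(Kf * t) ≤ f t)
    (hgK : ∀ t ∈ Set.Icc (0 : ℝ) 1, -(Kg * t) ≤ g t) :
    ((rainflow (profileOf N y)).ups.map f).sum + ((rainflow (profileOf N y)).downs.map g).sum ≤
      ((rainflow (profileOf N z)).ups.map f).sum + ((rainflow (profileOf N z)).downs.map g).sum +
        (Kf + Kg) * ∑ n ∈ Finset.range N, o n + (2 * (f u - f v) + (g u - g w)) := by
  have hyw : ∀ p ∈ profileOf N y, ∀ q ∈ profileOf N y, |p - q| ≤ u := by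
    intro p hp q hq
    obtain ⟨i, hi', rfl⟩ := mem_profileOf.1 hp
    obtain ⟨j, hj, rfl⟩ := mem_profileOf.1 hq
    rw [abs_le]
    constructor <;> linarith [hy.range i hi' j hj, hy.range j hj i hi']
  have hzw := abs_sub_le_of_mem_profileOf hz.mem hlh
  have hsub : Set.Icc 0 u ⊆ Set.Icc 0 1 := Set.Icc_subset_Icc_right hu.2
  exact stroke_cost_le hf hg f0 g0 hu hv hw hu_min hv_min hw_min hvu huw hKf hKg
    (Finset.sum_nonneg fun n hn => hz.nonneg n (Finset.mem_range.1 hn)) hfK hgK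
    (ups_mem_Icc hzw) (downs_mem_Icc hzw) (ups_mem_Icc hyw) (downs_mem_Icc hyw)
    (fun t ht => sum_min_ups_le hy hz h0 ht) (fun t ht => sum_min_downs_le hy hz h0 ht)
    (fun c hc hc0 => abs_sum_ups_sub_sum_downs_le zero_le_one hc hc0 hzw)
    (fun c hc hc0 => abs_sum_ups_sub_sum_downs_le hu.1 (hc.mono hsub)
      (fun x hx => hc0 x (hsub hx)) hyw)

/-! ### Profiles with three monotone phases -/

theorem localExtrema_remove {a b c : ℝ} (h : (a ≤ b ∧ b ≤ c) ∨ (c ≤ b ∧ b ≤ a)) (l₂ : List ℝ)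
    (l₁ : List ℝ) :
    localExtrema (l₁ ++ a :: b :: c :: l₂) = localExtrema (l₁ ++ a :: c :: l₂) := by
  have one : ∀ p, localExtrema (p :: a :: b :: c :: l₂) = localExtrema (p :: a :: c :: l₂) := by
    intro p
    have tail : localExtrema (a :: b :: c :: l₂) = localExtrema (a :: c :: l₂) := by
      rw [localExtrema, if_pos h]
    by_cases hab : a = b
    · subst hab
      rw [localExtrema, if_pos (by rcases le_total p a with h | h <;> simp [h])]
    rw [localExtrema, localExtrema.eq_4 p a c, tail]
    by_cases h1 : (p ≤ a ∧ a ≤ b) ∨ (b ≤ a ∧ a ≤ p)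
    · have h2 : (p ≤ a ∧ a ≤ c) ∨ (c ≤ a ∧ a ≤ p) := by
        rcases h with h | h <;> rcases h1 with h1 | h1
        · exact Or.inl ⟨h1.1, h.1.trans h.2⟩
        · exact absurd (le_antisymm h.1 h1.1) hab
        · exact absurd (le_antisymm h1.2 h.2) hab
        · exact Or.inr ⟨h.1.trans h.2, h1.2⟩
      have h3 : (p ≤ b ∧ b ≤ c) ∨ (c ≤ b ∧ b ≤ p) := by
        rcases h with h | h <;> rcases h1 with h1 | h1
        · exact Or.inl ⟨h1.1.trans h1.2, h.2⟩
        · exact absurd (le_antisymm h.1 h1.1) hab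
        · exact absurd (le_antisymm h1.2 h.2) hab
        · exact Or.inr ⟨h.1, h1.1.trans h1.2⟩
      rw [if_pos h1, if_pos h2, localExtrema, if_pos h3]
    · have h2 : ¬ ((p ≤ a ∧ a ≤ c) ∨ (c ≤ a ∧ a ≤ p)) := by
        rintro (h2 | h2) <;> rcases h with h | h
        · exact h1 (Or.inl ⟨h2.1, h.1⟩)
        · exact hab (by linarith)
        · exact hab (by linarith)
        · exact h1 (Or.inr ⟨h.2, h2.2⟩)
      rw [if_neg h1, if_neg h2]
  induction hn : l₁.length generalizing l₁ with
  | zero =>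
    rw [List.length_eq_zero_iff.1 hn, List.nil_append, List.nil_append, localExtrema, if_pos h]
  | succ n ih =>
    match l₁, hn with
    | [p], _ => exact one p
    | [p, q], hn =>
      have i1 := ih [p] (by simp at hn ⊢; omega)
      have i2 := ih [q] (by simp at hn ⊢; omega)
      simp only [List.cons_append, List.nil_append] at i1 i2 ⊢
      rw [localExtrema, localExtrema.eq_4 p q a, i1, i2]
    | p :: q :: s :: l, hn =>
      have i1 := ih (p :: s :: l) (by simpa using hn)
      have i2 := ih (q :: s :: l) (by simpa using hn)
      simp only [List.cons_append] at i1 i2 ⊢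
      rw [localExtrema, localExtrema.eq_4 p q s, i1, i2]

theorem localExtrema_run {z : ℕ → ℝ} (k : ℕ) (i : ℕ)
    (h : (∀ n, i ≤ n → n < i + (k + 1) → z n ≤ z (n + 1)) ∨
      (∀ n, i ≤ n → n < i + (k + 1) → z (n + 1) ≤ z n)) (l₁ l₂ : List ℝ) :
    localExtrema (l₁ ++ ((List.range' i (k + 2)).map z ++ l₂)) =
      localExtrema (l₁ ++ z i :: z (i + (k + 1)) :: l₂) := by
  induction k generalizing i l₁ with
  | zero => rfl
  | succ k ih =>
    have hI := ih (i + 1) (h.imp (fun h n h1 h2 => h n (by omega) (by omega))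
      fun h n h1 h2 => h n (by omega) (by omega)) (l₁ ++ [z i])
    rw [List.range'_succ, List.map_cons]
    simp only [List.append_assoc, List.cons_append, List.nil_append] at hI ⊢
    rw [hI, localExtrema_remove, show i + 1 + (k + 1) = i + (k + 1 + 1) by ring]
    rcases h with h | h
    · left
      refine ⟨h i le_rfl (by omega), ?_⟩
      have : ∀ m, m ≤ k + 1 → z (i + 1) ≤ z (i + 1 + m) := by
        intro m hm
        induction m with
        | zero => rfl
        | succ m ihm => exact (ihm (by omega)).trans (h (i + 1 + m) (by omega) (by omega))
      exact this _ le_rfl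
    · right
      refine ⟨?_, h i le_rfl (by omega)⟩
      have : ∀ m, m ≤ k + 1 → z (i + 1 + m) ≤ z (i + 1) := by
        intro m hm
        induction m with
        | zero => rfl
        | succ m ihm => exact (h (i + 1 + m) (by omega) (by omega)).trans (ihm (by omega))
      exact this _ le_rfl

theorem localExtrema_three_phases {z : ℕ → ℝ} {K : ℕ} (hK : 0 < K)
    (h1 : ∀ n, n < K → z n ≤ z (n + 1))
    (h2 : ∀ n, K ≤ n → n < 2 * K → z (n + 1) ≤ z n)
    (h3 : ∀ n, 2 * K ≤ n → n < 3 * K → z n ≤ z (n + 1)) :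
    localExtrema (profileOf (3 * K) z) = localExtrema [z 0, z K, z (2 * K), z (3 * K)] := by
  obtain ⟨k, rfl⟩ : ∃ k, K = k + 1 := ⟨K - 1, by omega⟩
  have e1 : profileOf (3 * (k + 1)) z =
      [] ++ ((List.range' 0 (k + 2)).map z ++ (List.range' (k + 2) (2 * (k + 1))).map z) := by
    rw [profileOf, List.range_eq_range', List.nil_append, ← List.map_append]
    congr 1
    have := List.range'_append (s := 0) (m := k + 2) (n := 2 * (k + 1)) (step := 1)
    rw [show 0 + 1 * (k + 2) = k + 2 by ring] at this
    rw [this]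
    congr 1
    ring
  have e2 : [] ++ z 0 :: z (0 + (k + 1)) :: (List.range' (k + 2) (2 * (k + 1))).map z =
      [z 0] ++ ((List.range' (k + 1) (k + 2)).map z ++
        (List.range' (2 * (k + 1) + 1) (k + 1)).map z) := by
    rw [List.range'_succ (s := k + 1), ← List.map_append]
    have := List.range'_append (s := k + 2) (m := k + 1) (n := k + 1) (step := 1)
    rw [show k + 2 + 1 * (k + 1) = 2 * (k + 1) + 1 by ring,
      show k + 1 + (k + 1) = 2 * (k + 1) by ring] at this
    rw [← this]
    simp
  have e3 : [z 0] ++ z (k + 1) :: z (k + 1 + (k + 1)) ::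
      (List.range' (2 * (k + 1) + 1) (k + 1)).map z =
      [z 0, z (k + 1)] ++ ((List.range' (2 * (k + 1)) (k + 2)).map z ++ []) := by
    rw [List.range'_succ (s := 2 * (k + 1)), show k + 1 + (k + 1) = 2 * (k + 1) by ring]
    simp
  rw [e1, localExtrema_run k 0 (Or.inl fun n _ hn => h1 n (by omega)), e2,
    localExtrema_run k (k + 1) (Or.inr fun n hn hn' => h2 n (by omega) (by omega)), e3,
    localExtrema_run k (2 * (k + 1)) (Or.inl fun n hn hn' => h3 n (by omega) (by omega))]
  rw [show 2 * (k + 1) + (k + 1) = 3 * (k + 1) by ring]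
  simp

theorem rainflow_congr {l l' : List ℝ} (h : localExtrema l = localExtrema l') :
    rainflow l = rainflow l' := by
  simp only [rainflow, h]

theorem rainflow_up_down_up {p q : ℝ} (hp : 0 ≤ p) (hpq : p ≤ q) {f g : ℝ → ℝ} (f0 : f 0 = 0)
    (g0 : g 0 = 0) :
    ((rainflow [0, p, p - q, 2 * p - q]).ups.map f).sum +
      ((rainflow [0, p, p - q, 2 * p - q]).downs.map g).sum = 2 * f p + g q := by
  rcases hp.eq_or_lt with rfl | hp
  · rcases hpq.eq_or_lt with rfl | hq
    · have e : localExtrema [0, 0, 0 - 0, 2 * 0 - 0] = [0] := by simp [localExtrema]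
      have s : rainflowSweep [0] = ([], [0]) := by simp [rainflowSweep]
      rw [rainflow, e]
      simp [rainflowSweeps, s, chargeHalfCycles, dischargeHalfCycles, Cycles.ups, Cycles.downs,
        f0, g0]
    · have e : localExtrema [0, 0, 0 - q, 2 * 0 - q] = [0, -q] := by
        simp [localExtrema, hq.le, hq.ne']
      have s : rainflowSweep [0, -q] = ([], [0, -q]) := by simp [rainflowSweep]
      rw [rainflow, e]
      simp [rainflowSweeps, s, chargeHalfCycles, dischargeHalfCycles, Cycles.ups, Cycles.downs,
        f0, hq, hq.not_gt]
  · have e : localExtrema [0, p, p - q, 2 * p - q] = [0, p, p - q, 2 * p - q] := by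
      have hq : 0 < q := hp.trans_le hpq
      rw [localExtrema, if_neg, localExtrema, if_neg, localExtrema, if_neg]
      · linarith
      · rintro (h | h) <;> linarith [h.1, h.2]
      · rintro (h | h) <;> linarith [h.1, h.2]
    have a1 : |p - (p - q)| = q := by rw [sub_sub_cancel, abs_of_pos (hp.trans_le hpq)]
    have a2 : |0 - p| = p := by rw [zero_sub, abs_neg, abs_of_pos hp]
    have a3 : |p - q - (2 * p - q)| = p := by
      rw [show p - q - (2 * p - q) = -p by ring, abs_neg, abs_of_pos hp]
    rcases hpq.eq_or_lt with rfl | hq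
    · have s : rainflowSweep [0, p, p - p, 2 * p - p] = ([p], [0, 2 * p - p]) := by
        rw [rainflowSweep, a1, a2, a3]
        simp [rainflowSweep]
      have s2 : rainflowSweep [0, 2 * p - p] = ([], [0, 2 * p - p]) := by simp [rainflowSweep]
      rw [rainflow, e]
      simp only [List.length_cons, List.length_nil, rainflowSweeps, s, s2, Cycles.ups,
        Cycles.downs, chargeHalfCycles, dischargeHalfCycles]
      rw [if_pos (by linarith), if_neg (by linarith)]
      simp only [List.cons_append, List.nil_append, List.map_cons, List.map_nil, List.sum_cons,
        List.sum_nil, List.append_nil]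
      rw [show 2 * p - p - 0 = p by ring]
      ring
    · have s : rainflowSweep [0, p, p - q, 2 * p - q] = ([], [0, p, p - q, 2 * p - q]) := by
        rw [rainflowSweep, a1, a2, a3, if_neg (by simp [hq])]
        simp [rainflowSweep]
      rw [rainflow, e]
      simp only [List.length_cons, List.length_nil, rainflowSweeps, s, Cycles.ups,
        Cycles.downs, chargeHalfCycles, dischargeHalfCycles]
      rw [if_pos hp, if_neg (by linarith), if_pos (by linarith), if_neg (by linarith),
        if_pos (by linarith), if_neg (by linarith)]
      simp only [List.append_nil, List.nil_append, List.map_cons, List.map_nil, List.sum_cons,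
        List.sum_nil]
      rw [show p - 0 = p by ring, show 2 * p - q - (p - q) = p by ring, sub_sub_cancel]
      ring

/-- Steps that go up by `p`, down by `q` and up by `p`, in `K` equal steps each. -/
def upDownUp (K : ℕ) (p q : ℝ) (n : ℕ) : ℝ :=
  if n < K then p / K else if n < 2 * K then -(q / K) else p / K

theorem upDownUp_path {K : ℕ} (hK : 0 < K) {p q : ℝ} (hp : 0 ≤ p) (hpq : p ≤ q) {z : ℕ → ℝ}
    (z0 : z 0 = 0) (hz : ∀ n < 3 * K, z (n + 1) - z n = upDownUp K p q n) :
    (∀ n ≤ 3 * K, z n ∈ Set.Icc (p - q) p) ∧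
      localExtrema (profileOf (3 * K) z) = localExtrema [0, p, p - q, 2 * p - q] := by
  have hK' : (0 : ℝ) < K := by exact_mod_cast hK
  have hpK : 0 ≤ p / K := by positivity
  have hqK : 0 ≤ q / K := div_nonneg (hp.trans hpq) hK'.le
  have eK : ∀ x : ℝ, (K : ℝ) * (x / K) = x := fun x => by field_simp
  have d1 : ∀ n < K, z (n + 1) - z n = p / K := fun n hn => by
    rw [hz n (by omega), upDownUp, if_pos hn]
  have d2 : ∀ n, K ≤ n → n < 2 * K → z (n + 1) - z n = -(q / K) := fun n h1 h2 => by
    rw [hz n (by omega), upDownUp, if_neg (by omega), if_pos h2]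
  have d3 : ∀ n, 2 * K ≤ n → n < 3 * K → z (n + 1) - z n = p / K := fun n h1 h2 => by
    rw [hz n (by omega), upDownUp, if_neg (by omega), if_neg (by omega)]
  have c1 : ∀ j ≤ K, z j = j * (p / K) := by
    intro j hj
    induction j with
    | zero => simp [z0]
    | succ j ih =>
      have := d1 j (by omega)
      rw [ih (by omega)] at this
      push_cast
      linarith
  have v1 : z K = p := by rw [c1 K le_rfl, eK]
  have c2 : ∀ j ≤ K, z (K + j) = p - j * (q / K) := by
    intro j hj
    induction j with
    | zero => simp [v1]
    | succ j ih =>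
      have := d2 (K + j) (by omega) (by omega)
      rw [ih (by omega)] at this
      push_cast
      rw [← add_assoc]
      linarith
  have v2 : z (2 * K) = p - q := by rw [two_mul, c2 K le_rfl, eK]
  have c3 : ∀ j ≤ K, z (2 * K + j) = p - q + j * (p / K) := by
    intro j hj
    induction j with
    | zero => simp [v2]
    | succ j ih =>
      have := d3 (2 * K + j) (by omega) (by omega)
      rw [ih (by omega)] at this
      push_cast
      rw [← add_assoc]
      linarith
  have v3 : z (3 * K) = 2 * p - q := by
    rw [show 3 * K = 2 * K + K by ring, c3 K le_rfl, eK]; ring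
  have bound : ∀ x : ℝ, 0 ≤ x / K → ∀ j : ℕ, j ≤ K → 0 ≤ (j : ℝ) * (x / K) ∧
      (j : ℝ) * (x / K) ≤ x := by
    intro x hx j hj
    refine ⟨by positivity, ?_⟩
    calc (j : ℝ) * (x / K) ≤ K * (x / K) := by gcongr
      _ = x := eK x
  refine ⟨fun n hn => ?_, ?_⟩
  · rcases le_total n K with h | h
    · have := bound p hpK n h
      rw [c1 n h]
      constructor <;> linarith
    · rcases le_total n (2 * K) with h' | h'
      · obtain ⟨j, rfl⟩ : ∃ j, n = K + j := ⟨n - K, by omega⟩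
        have := bound q hqK j (by omega)
        rw [c2 j (by omega)]
        constructor <;> linarith
      · obtain ⟨j, rfl⟩ : ∃ j, n = 2 * K + j := ⟨n - 2 * K, by omega⟩
        have := bound p hpK j (by omega)
        rw [c3 j (by omega)]
        constructor <;> linarith
  · rw [localExtrema_three_phases hK (fun n hn => by linarith [d1 n hn])
      (fun n h1 h2 => by linarith [d2 n h1 h2]) (fun n h1 h2 => by linarith [d3 n h1 h2]), z0, v1,
      v2, v3]

theorem ThresholdPath.upDownUp {K : ℕ} (hK : 0 < K) {u w lo hi : ℝ} (hu : 0 ≤ u) (huw : u ≤ w)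
    (hlo : lo ≤ 0) (hhi : u ≤ hi) {y : ℕ → ℝ} (y0 : y 0 = 0)
    (hy : ThresholdPath u lo hi (3 * K) (upDownUp K u w) y) :
    localExtrema (profileOf (3 * K) y) = localExtrema [0, u, u - u, 2 * u - u] := by
  have hK' : (0 : ℝ) < K := by exact_mod_cast hK
  have huK : 0 ≤ u / K := by positivity
  have hwK : 0 ≤ w / K := div_nonneg (hu.trans huw) hK'.le
  have eK : ∀ x : ℝ, (K : ℝ) * (x / K) = x := fun x => by field_simp
  have r1 : ∀ n < K, BatteryRegulation.upDownUp K u w n = u / K := fun n hn => by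
    rw [BatteryRegulation.upDownUp, if_pos hn]
  have r2 : ∀ n, K ≤ n → n < 2 * K → BatteryRegulation.upDownUp K u w n = -(w / K) :=
    fun n h1 h2 => by rw [BatteryRegulation.upDownUp, if_neg (by omega), if_pos h2]
  have r3 : ∀ n, 2 * K ≤ n → n < 3 * K → BatteryRegulation.upDownUp K u w n = u / K :=
    fun n h1 h2 => by rw [BatteryRegulation.upDownUp, if_neg (by omega), if_neg (by omega)]
  have rise : ∀ s, s + K ≤ 3 * K → y s = 0 → (∀ i ≤ s, 0 ≤ y i) →
      (∀ j < K, BatteryRegulation.upDownUp K u w (s + j) = u / K) →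
      ∀ j ≤ K, y (s + j) = j * (u / K) ∧ ∀ i ≤ s + j, 0 ≤ y i := by
    intro s hs ys hpos hρ j hj
    induction j with
    | zero => simpa [ys] using hpos
    | succ j ih =>
      obtain ⟨i1, i2⟩ := ih (by omega)
      have hr := hρ j (by omega)
      obtain ⟨a1, a2, a3⟩ := hy.up (s + j) (by omega) (by rw [hr]; exact huK)
      rw [hr, i1] at a2 a3
      have hb : ((j : ℝ) + 1) * (u / K) ≤ u := by
        calc ((j : ℝ) + 1) * (u / K) ≤ K * (u / K) := by
              gcongr
              exact_mod_cast hj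
          _ = u := eK u
      have e : y (s + j + 1) = (j + 1) * (u / K) := by
        rcases a3 with a3 | a3 | ⟨i, hi', a3⟩
        · linarith
        · linarith
        · linarith [i2 i hi']
      refine ⟨by rw [← add_assoc, e]; push_cast; ring, fun i hi' => ?_⟩
      rcases Nat.lt_or_ge i (s + j + 1) with h | h
      · exact i2 i (by omega)
      · obtain rfl : i = s + j + 1 := by omega
        rw [e]
        positivity
  have ph1 := rise 0 (by omega) y0 (fun i hi' => by rw [Nat.le_zero.1 hi', y0])
    (fun j hj => by rw [zero_add]; exact r1 j hj)
  have v1 : y K = u := by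
    have := (ph1 K le_rfl).1
    rwa [zero_add, eK] at this
  have ypos : ∀ n ≤ 3 * K, 0 ≤ y n := fun n hn => by
    linarith [hy.range K (by omega) n hn]
  have fall : ∀ j ≤ K, y (K + j) ≤ max 0 (u - j * (w / K)) := by
    intro j hj
    induction j with
    | zero => simp [v1]
    | succ j ih =>
      have hr := r2 (K + j) (by omega) (by omega)
      obtain ⟨a1, a2, a3⟩ := hy.down (K + j) (by omega) (by rw [hr]; linarith)
      rw [hr] at a2 a3
      rw [← add_assoc]
      push_cast
      rcases a3 with a3 | a3 | ⟨i, hi', a3⟩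
      · rcases le_max_iff.1 (ih (by omega)) with h | h
        · exact le_max_of_le_left (by linarith)
        · exact le_max_of_le_right (by linarith)
      · exact le_max_of_le_left (by linarith)
      · exact le_max_of_le_left (by linarith [hy.range i (by omega) 0 (by omega)])
  have v2 : y (2 * K) = 0 := by
    refine le_antisymm ?_ (ypos _ (by omega))
    have := fall K le_rfl
    rwa [eK, ← two_mul, max_eq_left (by linarith)] at this
  have v3 : y (3 * K) = u := by
    have := (rise (2 * K) (by omega) v2 (fun i hi' => ypos i (by omega))
      (fun j hj => r3 _ (by omega) (by omega)) K le_rfl).1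
    rwa [eK, show 2 * K + K = 3 * K by ring] at this
  rw [localExtrema_three_phases hK
    (fun n hn => (hy.up n (by omega) (by rw [r1 n hn]; exact huK)).1)
    (fun n h1 h2 => (hy.down n (by omega) (by rw [r2 n h1 h2]; linarith)).1)
    (fun n h1 h2 => (hy.up n (by omega) (by rw [r3 n h1 h2]; exact huK)).1), y0, v1, v2, v3,
    show u - u = 0 by ring, show 2 * u - u = u by ring]

/-! ### Minimizers of perturbed strictly convex functions -/

theorem StrictConvexOn.mul_sub_linear {φ : ℝ → ℝ} {s : Set ℝ} (h : StrictConvexOn ℝ s φ) {k : ℝ}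
    (hk : 0 < k) (m : ℝ) : StrictConvexOn ℝ s fun x => k * φ x - m * x := by
  refine ⟨h.1, fun x hx y hy hxy a b ha hb hab => ?_⟩
  have := mul_lt_mul_of_pos_left (h.2 hx hy hxy ha hb hab) hk
  simp only [smul_eq_mul] at this ⊢
  linarith

/-- Adding an increasing linear function moves the minimizer to the left. -/
theorem minimizer_le_of_add_linear {F G : ℝ → ℝ} {s : Set ℝ} {p q k : ℝ}
    (hF : StrictConvexOn ℝ s F) (hk : 0 ≤ k) (hG : ∀ x, G x = F x + k * x) (hp : p ∈ s)
    (hq : q ∈ s) (hp_min : IsMinOn F s p) (hq_min : IsMinOn G s q) : q ≤ p := by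
  by_contra! hlt
  have h1 : G q ≤ G p := hq_min hp
  rw [hG, hG] at h1
  have h2 : 0 ≤ k * (q - p) := mul_nonneg hk (by linarith)
  have h3 : F q ≤ F p := by linarith
  have hq' : IsMinOn F s q := fun x hx => h3.trans (hp_min hx)
  exact hlt.ne (hF.eq_of_isMinOn hp_min hq' hp hq)

/-- The total price of the strokes of a profile, `f` for upward and `g` for downward ones. -/
def strokeCost (f g : ℝ → ℝ) (l : List ℝ) : ℝ :=
  ((rainflow l).ups.map f).sum + ((rainflow l).downs.map g).sum

theorem strokeCost_neg (f g : ℝ → ℝ) (N : ℕ) (z : ℕ → ℝ) :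
    strokeCost f g (profileOf N fun n => -z n) = strokeCost g f (profileOf N z) := by
  rw [strokeCost, profileOf_neg, ups_neg, downs_neg, add_comm, strokeCost]

namespace Model

variable {M : Model}

/-- The standing assumptions on the data. -/
structure Valid (M : Model) : Prop where
  T_pos : 0 < M.T
  E_pos : 0 < M.E
  R_pos : 0 < M.R
  P_pos : 0 < M.P
  ηc_pos : 0 < M.ηc
  ηd_pos : 0 < M.ηd
  θ_nonneg : 0 ≤ M.θ
  π_nonneg : 0 ≤ M.π
  limits : M.eLo ≤ M.eHi
  capacity : M.eHi - M.eLo ≤ M.E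
  Φ_zero : M.Φ 0 = 0
  Φ_nonneg : ∀ x ∈ Set.Icc (0 : ℝ) 1, 0 ≤ M.Φ x
  Φ_convex : StrictConvexOn ℝ (Set.Icc (0 : ℝ) 1) M.Φ

/-! ### Costs in terms of strokes -/

theorem soc_eq (M : Model) (e₀ : ℝ) (c d : ℕ → ℝ) (n : ℕ) :
    M.soc e₀ c d n = e₀ + M.soc 0 c d n := by
  induction n with
  | zero => simp [soc]
  | succ n ih => rw [soc, soc, ih]; ring

/-- The normalized energy level, relative to the initial one. -/
def level (M : Model) (x : (ℕ → ℝ) × (ℕ → ℝ)) (n : ℕ) : ℝ := M.soc 0 x.1 x.2 n / M.E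

theorem level_zero (M : Model) (x : (ℕ → ℝ) × (ℕ → ℝ)) : M.level x 0 = 0 := by
  simp [level, soc]

theorem level_succ (M : Model) (x : (ℕ → ℝ) × (ℕ → ℝ)) (n : ℕ) :
    M.level x (n + 1) - M.level x n = (M.T * M.ηc * x.1 n - M.T / M.ηd * x.2 n) / M.E := by
  rw [level, level, soc]; ring

theorem level_mem (hM : M.Valid) {N : ℕ} {e₀ : ℝ} {x : (ℕ → ℝ) × (ℕ → ℝ)}
    (hx : x ∈ M.feasible N e₀) :
    ∀ n ≤ N, M.level x n ∈ Set.Icc ((M.eLo - e₀) / M.E) ((M.eHi - e₀) / M.E) := by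
  intro n hn
  obtain ⟨h1, h2⟩ := hx.1 n hn
  rw [soc_eq] at h1 h2
  have := hM.E_pos
  constructor <;> (rw [level]; gcongr; linarith)

/-- The step asked for by an instruction, in normalized energy. -/
def instructedStep (M : Model) (r : ℕ → ℝ) (n : ℕ) : ℝ :=
  (if 0 ≤ r n then M.T * M.ηc * r n else M.T / M.ηd * r n) / M.E

/-- The penalty of not responding at all. -/
def baseline (M : Model) (N : ℕ) (r : ℕ → ℝ) : ℝ :=
  ∑ n ∈ Finset.range N, (M.T * M.θ * max (r n) 0 + M.T * M.π * max (-r n) 0)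

/-- The amount by which a step exceeds the instructed one. -/
def excess (M : Model) (r : ℕ → ℝ) (x : (ℕ → ℝ) × (ℕ → ℝ)) (n : ℕ) : ℝ :=
  max (M.level x (n + 1) - M.level x n - max (M.instructedStep r n) 0) 0 +
    max (min (M.instructedStep r n) 0 - (M.level x (n + 1) - M.level x n)) 0

theorem sum_map_sub_mul (l : List ℝ) (f : ℝ → ℝ) (k m : ℝ) :
    (l.map fun x => k * f x - m * x).sum = k * (l.map f).sum - m * l.sum := by
  induction l with
  | nil => simp
  | cons a l ih => simp only [List.map_cons, List.sum_cons, ih]; ring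

theorem cost_eq (hM : M.Valid) {N : ℕ} {e₀ : ℝ} {x : (ℕ → ℝ) × (ℕ → ℝ)}
    (hx : x ∈ M.feasible N e₀) (r : ℕ → ℝ) :
    M.cost N r x = strokeCost M.Jv M.Jw (profileOf N (M.level x)) +
      ∑ n ∈ Finset.range N, (M.E / M.ηc * M.θ * max (M.level x (n + 1) - M.level x n) 0 +
        M.E * M.ηd * M.π * max (M.level x n - M.level x (n + 1)) 0 +
        M.T * M.θ * max (r n - x.1 n + x.2 n) 0 + M.T * M.π * max (x.1 n - x.2 n - r n) 0) := by
  have hz := level_mem hM hx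
  have hlh : (M.eLo - e₀) / M.E ≤ (M.eHi - e₀) / M.E := by
    have := hM.E_pos
    have := hM.limits
    gcongr
  have hv : M.Jv = fun x => M.E * M.R * (M.Φ x / 2) - M.E / M.ηc * M.θ * x := by
    funext x; rw [Jv]; ring
  have hw : M.Jw = fun x => M.E * M.R * (M.Φ x / 2) - M.E * M.ηd * M.π * x := by
    funext x; rw [Jw]; ring
  have hp : M.profile N x.1 x.2 = profileOf N (M.level x) := rfl
  rw [cost, agingCost, penalty, hp, strokeCost, hv, hw,
    sum_map_sub_mul _ (fun x => M.Φ x / 2), sum_map_sub_mul _ (fun x => M.Φ x / 2),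
    sum_ups hlh hz, sum_downs hlh hz, lifeLoss_eq]
  simp only [Finset.sum_add_distrib, ← Finset.mul_sum]
  ring

theorem cost_eq_of_responsive (hM : M.Valid) {N : ℕ} {e₀ : ℝ} {r : ℕ → ℝ}
    {x : (ℕ → ℝ) × (ℕ → ℝ)} (hx : x ∈ M.responsive N e₀ r) :
    M.cost N r x = strokeCost M.Jv M.Jw (profileOf N (M.level x)) + M.baseline N r := by
  rw [cost_eq hM hx.1, baseline]
  congr 1
  refine Finset.sum_congr rfl fun n hn => ?_
  obtain ⟨h1, h2, -⟩ := hx.1.2 n (Finset.mem_range.1 hn)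
  obtain ⟨h3, h4⟩ := hx.2 n (Finset.mem_range.1 hn)
  have hE := hM.E_pos
  have hT := hM.T_pos
  have hc := hM.ηc_pos
  have hd := hM.ηd_pos
  rw [← neg_sub (M.level x (n + 1)), level_succ]
  rcases le_total 0 (r n) with hr | hr
  · rw [max_eq_left hr] at h3
    rw [max_eq_right (by linarith)] at h4
    have d0 : x.2 n = 0 := le_antisymm h4 h2.1
    have c0 := h1.1
    rw [d0, max_eq_left hr, max_eq_right (a := -r n) (by linarith),
      max_eq_left (a := r n - x.1 n + 0) (by linarith),
      max_eq_right (a := x.1 n - 0 - r n) (by linarith), mul_zero, sub_zero,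
      max_eq_left (by positivity), max_eq_right (by rw [neg_nonpos]; positivity)]
    field_simp
    ring
  · rw [max_eq_right hr] at h3
    rw [max_eq_left (by linarith)] at h4
    have c0 : x.1 n = 0 := le_antisymm h3 h1.1
    have d0 := h2.1
    have hnn : 0 ≤ M.T / M.ηd * x.2 n / M.E := by positivity
    rw [c0, max_eq_right hr, max_eq_left (a := -r n) (by linarith),
      max_eq_right (a := r n - 0 + x.2 n) (by linarith),
      max_eq_left (a := 0 - x.2 n - r n) (by linarith), mul_zero, zero_sub, neg_div, neg_neg,
      max_eq_left hnn, max_eq_right (by linarith)]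
    field_simp
    ring

theorem cost_eq_of_lossless (hM : M.Valid) (hη : M.ηc * M.ηd = 1) {N : ℕ} {e₀ : ℝ} (r : ℕ → ℝ)
    {x : (ℕ → ℝ) × (ℕ → ℝ)} (hx : x ∈ M.feasible N e₀) :
    M.cost N r x = strokeCost M.Jv M.Jw (profileOf N (M.level x)) + M.baseline N r +
      (M.E / M.ηc * M.θ + M.E * M.ηd * M.π) * ∑ n ∈ Finset.range N, M.excess r x n := by
  have hE := hM.E_pos
  have hT := hM.T_pos
  have hc := hM.ηc_pos
  have hd : M.ηd = 1 / M.ηc := by field_simp; linarith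
  rw [cost_eq hM hx, baseline, add_assoc, Finset.mul_sum, ← Finset.sum_add_distrib]
  congr 1
  refine Finset.sum_congr rfl fun n _ => ?_
  set k : ℝ := M.T * M.ηc / M.E with hk
  have hk0 : 0 < k := by positivity
  have hstep : M.level x (n + 1) - M.level x n = k * (x.1 n - x.2 n) := by
    rw [level_succ, hd, hk]
    field_simp
  have hinstr : M.instructedStep r n = k * r n := by
    have : M.T / M.ηd = M.T * M.ηc := by rw [hd]; field_simp
    rw [instructedStep, this, ite_self, hk]
    ring
  have hKa : M.E / M.ηc * M.θ = M.T * M.θ / k := by rw [hk]; field_simp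
  have hKb : M.E * M.ηd * M.π = M.T * M.π / k := by rw [hk, hd]; field_simp
  have sc : ∀ a : ℝ, max (k * a) 0 = k * max a 0 := fun a => by
    rw [mul_max_of_nonneg _ _ hk0.le, mul_zero]
  have sc' : ∀ a : ℝ, min (k * a) 0 = k * min a 0 := fun a => by
    rw [mul_min_of_nonneg _ _ hk0.le, mul_zero]
  rw [excess, ← neg_sub (M.level x (n + 1)), hstep, hinstr, sc (r n), sc' (r n), ← mul_neg,
    ← mul_sub, ← mul_sub, sc, sc, sc, sc, hKa, hKb]
  rw [show r n - x.1 n + x.2 n = r n - (x.1 n - x.2 n) by ring]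
  generalize x.1 n - x.2 n = p
  generalize r n = q
  have id1 : max p 0 + max (q - p) 0 = max q 0 + (max (p - max q 0) 0 + max (min q 0 - p) 0) := by
    rcases le_total 0 q with h1 | h1 <;> rcases le_total 0 p with h2 | h2 <;>
    rcases le_total q p with h3 | h3 <;> simp [h1, h2, h3] <;> linarith
  have id2 : max (-p) 0 + max (p - q) 0 =
      max (-q) 0 + (max (p - max q 0) 0 + max (min q 0 - p) 0) := by
    rcases le_total 0 q with h1 | h1 <;> rcases le_total 0 p with h2 | h2 <;>
    rcases le_total q p with h3 | h3 <;> simp [h1, h2, h3] <;> linarith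
  have ca : ∀ a b : ℝ, a / k * (k * b) = a * b := fun a b => by field_simp
  rw [← mul_add, ca, ca, add_mul, ca, ca]
  linear_combination M.T * M.θ * id1 + M.T * M.π * id2

/-! ### Responses and the threshold policy as paths -/

theorem instructedStep_nonneg_iff (hM : M.Valid) (r : ℕ → ℝ) (n : ℕ) :
    0 ≤ M.instructedStep r n ↔ 0 ≤ r n := by
  have := hM.E_pos
  have := hM.T_pos
  have := hM.ηc_pos
  have := hM.ηd_pos
  rw [instructedStep]
  constructor
  · intro h
    by_contra h'
    rw [if_neg h'] at h
    have : M.T / M.ηd * r n / M.E < 0 :=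
      div_neg_of_neg_of_pos (mul_neg_of_pos_of_neg (by positivity) (not_le.1 h')) ‹_›
    linarith
  · intro h
    rw [if_pos h]
    positivity

theorem responsePath_excess (hM : M.Valid) {N : ℕ} {e₀ : ℝ} (r : ℕ → ℝ)
    {x : (ℕ → ℝ) × (ℕ → ℝ)} (hx : x ∈ M.feasible N e₀) :
    ResponsePath ((M.eLo - e₀) / M.E) ((M.eHi - e₀) / M.E) N (M.instructedStep r) (M.excess r x)
      (M.level x) where
  mem := level_mem hM hx
  nonneg n _ := add_nonneg (le_max_right _ _) (le_max_right _ _)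
  up n _ hρ := by
    rw [excess, max_eq_left hρ, min_eq_right hρ]
    generalize M.level x (n + 1) - M.level x n = ξ
    have h1 := le_max_left (ξ - M.instructedStep r n) 0
    have h2 := le_max_right (ξ - M.instructedStep r n) 0
    have h3 := le_max_left (0 - ξ) 0
    have h4 := le_max_right (0 - ξ) 0
    constructor <;> linarith
  down n _ hρ := by
    rw [excess, max_eq_right hρ, min_eq_left hρ]
    generalize M.level x (n + 1) - M.level x n = ξ
    have h1 := le_max_left (ξ - 0) 0
    have h2 := le_max_right (ξ - 0) 0
    have h3 := le_max_left (M.instructedStep r n - ξ) 0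
    have h4 := le_max_right (M.instructedStep r n - ξ) 0
    constructor <;> linarith

theorem excess_eq_zero_of_responsive (hM : M.Valid) {N : ℕ} {e₀ : ℝ} {r : ℕ → ℝ}
    {x : (ℕ → ℝ) × (ℕ → ℝ)} (hx : x ∈ M.responsive N e₀ r) : ∀ n < N, M.excess r x n = 0 := by
  intro n hn
  obtain ⟨h1, h2, -⟩ := hx.1.2 n hn
  obtain ⟨h3, h4⟩ := hx.2 n hn
  have hE := hM.E_pos
  have hT := hM.T_pos
  have hc := hM.ηc_pos
  have hd := hM.ηd_pos
  rw [excess, level_succ]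
  rcases le_or_gt 0 (r n) with hr | hr
  · rw [max_eq_left hr] at h3
    rw [max_eq_right (by linarith)] at h4
    have d0 : x.2 n = 0 := le_antisymm h4 h2.1
    have c0 := h1.1
    have hρ := (instructedStep_nonneg_iff hM r n).2 hr
    have hle : M.T * M.ηc * x.1 n / M.E ≤ M.instructedStep r n := by
      rw [instructedStep, if_pos hr]
      gcongr
    have hnn : 0 ≤ M.T * M.ηc * x.1 n / M.E := by positivity
    rw [d0, mul_zero, sub_zero, max_eq_left hρ, min_eq_right hρ, max_eq_right (by linarith),
      max_eq_right (by linarith), add_zero]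
  · rw [max_eq_right hr.le] at h3
    rw [max_eq_left (by linarith)] at h4
    have c0 : x.1 n = 0 := le_antisymm h3 h1.1
    have d0 := h2.1
    have hρ : M.instructedStep r n ≤ 0 := by
      by_contra h
      linarith [(instructedStep_nonneg_iff hM r n).1 (not_le.1 h).le]
    have hle : M.instructedStep r n ≤ -(M.T / M.ηd * x.2 n) / M.E := by
      rw [instructedStep, if_neg (not_le.2 hr), ← mul_neg]
      gcongr
      linarith
    have hnn : 0 ≤ M.T / M.ηd * x.2 n / M.E := by positivity
    rw [neg_div] at hle
    rw [c0, mul_zero, zero_sub, neg_div, max_eq_right hρ, min_eq_left hρ,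
      max_eq_right (by linarith), max_eq_right (by linarith), add_zero]

theorem policyState_e (M : Model) (u e₀ : ℝ) (r : ℕ → ℝ) (n : ℕ) :
    (M.policyState u e₀ r n).e = M.soc e₀ (M.policy u e₀ r).1 (M.policy u e₀ r).2 n := by
  induction n with
  | zero => rfl
  | succ n ih => rw [soc, ← ih]; rfl

theorem policyState_e_succ (hM : M.Valid) (u e₀ : ℝ) (r : ℕ → ℝ) (n : ℕ) :
    (M.policyState u e₀ r (n + 1)).e =
      if 0 ≤ r n then
        min (min M.eHi ((M.policyState u e₀ r n).eMin + u * M.E))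
          ((M.policyState u e₀ r n).e + M.T * M.ηc * r n)
      else
        max (max M.eLo ((M.policyState u e₀ r n).eMax - u * M.E))
          ((M.policyState u e₀ r n).e + M.T / M.ηd * r n) := by
  have hT := hM.T_pos
  have hc := hM.ηc_pos
  have hd := hM.ηd_pos
  simp only [policyState, policyAction]
  split_ifs with h
  · rw [mul_zero, sub_zero, mul_min_of_nonneg _ _ (by positivity), ← min_add_add_left]
    congr 1
    field_simp
    ring
  · rw [mul_zero, zero_sub, mul_min_of_nonneg _ _ (by positivity), ← max_neg_neg,
      ← max_add_add_left]
    congr 1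
    · field_simp
      ring
    · ring

theorem policyState_spec (hM : M.Valid) {u e₀ : ℝ} (hu : 0 ≤ u)
    (he : e₀ ∈ Set.Icc M.eLo M.eHi) (r : ℕ → ℝ) (n : ℕ) :
    M.eLo ≤ (M.policyState u e₀ r n).eMin ∧ (M.policyState u e₀ r n).eMax ≤ M.eHi ∧
    (M.policyState u e₀ r n).eMax - (M.policyState u e₀ r n).eMin ≤ u * M.E ∧
    (∀ j ≤ n, (M.policyState u e₀ r n).eMin ≤ (M.policyState u e₀ r j).e ∧
      (M.policyState u e₀ r j).e ≤ (M.policyState u e₀ r n).eMax) ∧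
    (∃ j ≤ n, (M.policyState u e₀ r j).e = (M.policyState u e₀ r n).eMin) ∧
    ∃ j ≤ n, (M.policyState u e₀ r j).e = (M.policyState u e₀ r n).eMax := by
  have hE := hM.E_pos
  have hT := hM.T_pos
  have hc := hM.ηc_pos
  have hd := hM.ηd_pos
  have huE : 0 ≤ u * M.E := by positivity
  induction n with
  | zero =>
    refine ⟨he.1, he.2, ?_, fun j hj => ?_, ⟨0, le_rfl, rfl⟩, ⟨0, le_rfl, rfl⟩⟩
    · simpa [policyState] using huE
    · rw [Nat.le_zero.1 hj]
      exact ⟨le_rfl, le_rfl⟩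
  | succ n ih =>
    obtain ⟨i1, i2, i3, i4, ⟨a, ha, ha'⟩, ⟨b, hb, hb'⟩⟩ := ih
    obtain ⟨i5, i6⟩ := i4 n le_rfl
    have hs := policyState_e_succ hM u e₀ r n
    have hmin : (M.policyState u e₀ r (n + 1)).eMin =
      min (M.policyState u e₀ r n).eMin (M.policyState u e₀ r (n + 1)).e := rfl
    have hmax : (M.policyState u e₀ r (n + 1)).eMax =
      max (M.policyState u e₀ r n).eMax (M.policyState u e₀ r (n + 1)).e := rfl
    generalize (M.policyState u e₀ r (n + 1)).eMin = m' at *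
    generalize (M.policyState u e₀ r (n + 1)).eMax = X' at *
    have hrec : ∀ y, (M.policyState u e₀ r (n + 1)).e = y → m' ≤ y ∧ y ≤ X' := by
      rintro y rfl
      rw [hmin, hmax]
      exact ⟨min_le_right _ _, le_max_right _ _⟩
    have hbd : M.eLo ≤ (M.policyState u e₀ r (n + 1)).e ∧
        (M.policyState u e₀ r (n + 1)).e ≤ M.eHi ∧
        (M.policyState u e₀ r (n + 1)).e ≤ (M.policyState u e₀ r n).eMin + u * M.E ∧
        (M.policyState u e₀ r n).eMax - u * M.E ≤ (M.policyState u e₀ r (n + 1)).e := by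
      rw [hs]
      split_ifs with h
      · have h1 : 0 ≤ M.T * M.ηc * r n := by positivity
        refine ⟨le_min (le_min ?_ ?_) ?_, ?_, ?_, le_min (le_min ?_ ?_) ?_⟩
        · linarith
        · linarith
        · linarith
        · exact (min_le_left _ _).trans (min_le_left _ _)
        · exact (min_le_left _ _).trans (min_le_right _ _)
        · linarith
        · linarith
        · linarith
      · have h1 : M.T / M.ηd * r n ≤ 0 :=
          mul_nonpos_of_nonneg_of_nonpos (by positivity) (not_le.1 h).le
        refine ⟨?_, max_le (max_le ?_ ?_) ?_, max_le (max_le ?_ ?_) ?_, ?_⟩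
        · exact (le_max_left _ _).trans (le_max_left _ _)
        · linarith
        · linarith
        · linarith
        · linarith
        · linarith
        · linarith
        · exact (le_max_right _ _).trans (le_max_left _ _)
    obtain ⟨b1, b2, b3, b4⟩ := hbd
    refine ⟨?_, ?_, ?_, fun j hj => ?_, ?_, ?_⟩
    · rw [hmin]; exact le_min i1 b1
    · rw [hmax]; exact max_le i2 b2
    · rw [hmin, hmax, sub_le_iff_le_add]
      refine max_le ?_ ?_ <;> rw [← sub_le_iff_le_add'] <;> refine le_min ?_ ?_ <;> linarith
    · rcases hj.eq_or_lt with rfl | hj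
      · exact hrec _ rfl
      · obtain ⟨c1, c2⟩ := i4 j (by omega)
        rw [hmin, hmax]
        exact ⟨(min_le_left _ _).trans c1, c2.trans (le_max_left _ _)⟩
    · rcases min_choice (M.policyState u e₀ r n).eMin (M.policyState u e₀ r (n + 1)).e with h | h
      · exact ⟨a, by omega, by rw [hmin, h, ha']⟩
      · exact ⟨n + 1, le_rfl, by rw [hmin, h]⟩
    · rcases max_choice (M.policyState u e₀ r n).eMax (M.policyState u e₀ r (n + 1)).e with h | h
      · exact ⟨b, by omega, by rw [hmax, h, hb']⟩
      · exact ⟨n + 1, le_rfl, by rw [hmax, h]⟩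

theorem policy_mem_responsive (hM : M.Valid) {u e₀ : ℝ} (hu : 0 ≤ u)
    (he : e₀ ∈ Set.Icc M.eLo M.eHi) {N : ℕ} {r : ℕ → ℝ}
    (hr : ∀ n < N, r n ∈ Set.Icc (-M.P) M.P) : M.policy u e₀ r ∈ M.responsive N e₀ r := by
  have hT := hM.T_pos
  have hc := hM.ηc_pos
  have hd := hM.ηd_pos
  have hP := hM.P_pos
  have huE : 0 ≤ u * M.E := mul_nonneg hu hM.E_pos.le
  have key : ∀ n, 0 ≤ (M.policy u e₀ r).1 n ∧ (M.policy u e₀ r).1 n ≤ max (r n) 0 ∧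
      0 ≤ (M.policy u e₀ r).2 n ∧ (M.policy u e₀ r).2 n ≤ max (-r n) 0 ∧
      ((M.policy u e₀ r).1 n = 0 ∨ (M.policy u e₀ r).2 n = 0) := by
    intro n
    obtain ⟨i1, i2, i3, i4, -, -⟩ := policyState_spec hM hu he r n
    obtain ⟨i5, i6⟩ := i4 n le_rfl
    simp only [policy, policyAction]
    split_ifs with h
    · refine ⟨le_min (mul_nonneg (by positivity) ?_) h, (min_le_right _ _).trans (le_max_left _ _),
        le_rfl, le_max_right _ _, Or.inr rfl⟩
      rw [sub_nonneg]
      exact le_min (by linarith) (by linarith)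
    · refine ⟨le_rfl, le_max_right _ _, le_min (mul_nonneg (by positivity) ?_) ?_,
        (min_le_right _ _).trans (le_max_left _ _), Or.inl rfl⟩
      · rw [sub_nonneg]
        exact max_le (by linarith) (by linarith)
      · linarith [not_le.1 h]
  refine ⟨⟨fun n _ => ?_, fun n hn => ?_⟩, fun n _ => ⟨(key n).2.1, (key n).2.2.2.1⟩⟩
  · obtain ⟨i1, i2, i3, i4, -, -⟩ := policyState_spec hM hu he r n
    obtain ⟨i5, i6⟩ := i4 n le_rfl
    rw [← policyState_e]
    exact ⟨i1.trans i5, i6.trans i2⟩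
  · obtain ⟨k1, k2, k3, k4, k5⟩ := key n
    obtain ⟨r1, r2⟩ := hr n hn
    exact ⟨⟨k1, k2.trans (max_le r2 hP.le)⟩, ⟨k3, k4.trans (max_le (by linarith) hP.le)⟩, k5⟩

theorem thresholdPath_policy (hM : M.Valid) {u e₀ : ℝ} (hu : 0 ≤ u)
    (he : e₀ ∈ Set.Icc M.eLo M.eHi) (N : ℕ) (r : ℕ → ℝ) :
    ThresholdPath u ((M.eLo - e₀) / M.E) ((M.eHi - e₀) / M.E) N (M.instructedStep r)
      (M.level (M.policy u e₀ r)) := by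
  have hE := hM.E_pos
  have hT := hM.T_pos
  have hc := hM.ηc_pos
  have hd := hM.ηd_pos
  have huE : 0 ≤ u * M.E := by positivity
  have hl : ∀ n, M.level (M.policy u e₀ r) n = ((M.policyState u e₀ r n).e - e₀) / M.E := by
    intro n
    rw [policyState_e, soc_eq, add_sub_cancel_left, level]
  have up : ∀ n, 0 ≤ r n →
      M.level (M.policy u e₀ r) n ≤ M.level (M.policy u e₀ r) (n + 1) ∧
      M.level (M.policy u e₀ r) (n + 1) ≤ M.level (M.policy u e₀ r) n + M.instructedStep r n ∧
      (M.level (M.policy u e₀ r) (n + 1) = M.level (M.policy u e₀ r) n + M.instructedStep r n ∨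
        M.level (M.policy u e₀ r) (n + 1) = (M.eHi - e₀) / M.E ∨
        ∃ j ≤ n, M.level (M.policy u e₀ r) (n + 1) = M.level (M.policy u e₀ r) j + u) := by
    intro n hr
    obtain ⟨i1, i2, i3, i4, ⟨a, ha, ha'⟩, -⟩ := policyState_spec hM hu he r n
    obtain ⟨i5, i6⟩ := i4 n le_rfl
    have hs := policyState_e_succ hM u e₀ r n
    rw [if_pos hr] at hs
    have e1 : M.level (M.policy u e₀ r) n + M.instructedStep r n =
        ((M.policyState u e₀ r n).e + M.T * M.ηc * r n - e₀) / M.E := by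
      rw [hl, instructedStep, if_pos hr]; ring
    have e2 : ∀ j, M.level (M.policy u e₀ r) j + u =
        ((M.policyState u e₀ r j).e + u * M.E - e₀) / M.E := by
      intro j; rw [hl]; field_simp; ring
    refine ⟨?_, ?_, ?_⟩
    · rw [hl, hl]
      have : 0 ≤ M.T * M.ηc * r n := by positivity
      gcongr
      rw [hs]
      exact le_min (le_min (by linarith) (by linarith)) (by linarith)
    · rw [e1, hl, hs]
      gcongr
      exact min_le_right _ _
    · simp only [e1, e2, hl (n + 1), hs]
      rcases min_choice (min M.eHi ((M.policyState u e₀ r n).eMin + u * M.E))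
        ((M.policyState u e₀ r n).e + M.T * M.ηc * r n) with h | h
      · rcases min_choice M.eHi ((M.policyState u e₀ r n).eMin + u * M.E) with h' | h'
        · exact Or.inr (Or.inl (by rw [h, h']))
        · exact Or.inr (Or.inr ⟨a, ha, by rw [h, h', ha']⟩)
      · exact Or.inl (by rw [h])
  have down : ∀ n, r n < 0 →
      M.level (M.policy u e₀ r) (n + 1) ≤ M.level (M.policy u e₀ r) n ∧
      M.level (M.policy u e₀ r) n + M.instructedStep r n ≤ M.level (M.policy u e₀ r) (n + 1) ∧
      (M.level (M.policy u e₀ r) (n + 1) = M.level (M.policy u e₀ r) n + M.instructedStep r n ∨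
        M.level (M.policy u e₀ r) (n + 1) = (M.eLo - e₀) / M.E ∨
        ∃ j ≤ n, M.level (M.policy u e₀ r) (n + 1) = M.level (M.policy u e₀ r) j - u) := by
    intro n hr
    obtain ⟨i1, i2, i3, i4, -, ⟨a, ha, ha'⟩⟩ := policyState_spec hM hu he r n
    obtain ⟨i5, i6⟩ := i4 n le_rfl
    have hs := policyState_e_succ hM u e₀ r n
    rw [if_neg (not_le.2 hr)] at hs
    have e1 : M.level (M.policy u e₀ r) n + M.instructedStep r n =
        ((M.policyState u e₀ r n).e + M.T / M.ηd * r n - e₀) / M.E := by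
      rw [hl, instructedStep, if_neg (not_le.2 hr)]; ring
    have e2 : ∀ j, M.level (M.policy u e₀ r) j - u =
        ((M.policyState u e₀ r j).e - u * M.E - e₀) / M.E := by
      intro j; rw [hl]; field_simp; ring
    refine ⟨?_, ?_, ?_⟩
    · rw [hl, hl]
      have : M.T / M.ηd * r n ≤ 0 := mul_nonpos_of_nonneg_of_nonpos (by positivity) hr.le
      gcongr
      rw [hs]
      exact max_le (max_le (by linarith) (by linarith)) (by linarith)
    · rw [e1, hl, hs]
      gcongr
      exact le_max_right _ _
    · simp only [e1, e2, hl (n + 1), hs]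
      rcases max_choice (max M.eLo ((M.policyState u e₀ r n).eMax - u * M.E))
        ((M.policyState u e₀ r n).e + M.T / M.ηd * r n) with h | h
      · rcases max_choice M.eLo ((M.policyState u e₀ r n).eMax - u * M.E) with h' | h'
        · exact Or.inr (Or.inl (by rw [h, h']))
        · exact Or.inr (Or.inr ⟨a, ha, by rw [h, h', ha']⟩)
      · exact Or.inl (by rw [h])
  refine ⟨fun n _ => ?_, fun i hi j hj => ?_, fun n _ hρ => ?_, fun n _ hρ => ?_⟩
  · obtain ⟨i1, i2, i3, i4, -, -⟩ := policyState_spec hM hu he r n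
    obtain ⟨i5, i6⟩ := i4 n le_rfl
    rw [hl]
    constructor <;> (gcongr; linarith)
  · obtain ⟨i1, i2, i3, i4, -, -⟩ := policyState_spec hM hu he r N
    have a1 := i4 i hi
    have a2 := i4 j hj
    rw [hl, hl, ← sub_div, div_le_iff₀ hE]
    linarith
  · exact up n ((instructedStep_nonneg_iff hM r n).1 hρ)
  · rcases lt_or_ge (r n) 0 with h | h
    · exact down n h
    · obtain ⟨u1, u2, u3⟩ := up n h
      have h0 : M.instructedStep r n = 0 :=
        le_antisymm hρ ((instructedStep_nonneg_iff hM r n).2 h)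
      rw [h0, add_zero] at u2 ⊢
      exact ⟨u2, u1, Or.inl (le_antisymm u2 u1)⟩

end Model

namespace Model

variable {M : Model}

/-! ### Half-cycle costs -/

theorem Jv_strictConvexOn (hM : M.Valid) : StrictConvexOn ℝ (Set.Icc (0 : ℝ) 1) M.Jv := by
  have hk : 0 < 1 / 2 * (M.E * M.R) := by
    have := hM.E_pos
    have := hM.R_pos
    positivity
  convert StrictConvexOn.mul_sub_linear hM.Φ_convex hk (M.E / M.ηc * M.θ) using 1
  funext x; rw [Jv]; ring

theorem Jw_strictConvexOn (hM : M.Valid) : StrictConvexOn ℝ (Set.Icc (0 : ℝ) 1) M.Jw := by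
  have hk : 0 < 1 / 2 * (M.E * M.R) := by
    have := hM.E_pos
    have := hM.R_pos
    positivity
  convert StrictConvexOn.mul_sub_linear hM.Φ_convex hk (M.E * M.ηd * M.π) using 1
  funext x; rw [Jw]; ring

theorem Ju_strictConvexOn (hM : M.Valid) : StrictConvexOn ℝ (Set.Icc (0 : ℝ) 1) M.Ju :=
  StrictConvexOn.mul_sub_linear hM.Φ_convex (mul_pos hM.E_pos hM.R_pos) _

theorem Jv_add_Jw (M : Model) (x : ℝ) : M.Jv x + M.Jw x = M.Ju x := by
  rw [Jv, Jw, Ju]; ring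

theorem Jv_eq_Jw_add (M : Model) (x : ℝ) :
    M.Jv x = M.Jw x + M.E * (M.π * M.ηd - M.θ / M.ηc) * x := by
  rw [Jv, Jw]; ring

theorem Jv_zero (hM : M.Valid) : M.Jv 0 = 0 := by simp [Jv, hM.Φ_zero]

theorem Jw_zero (hM : M.Valid) : M.Jw 0 = 0 := by simp [Jw, hM.Φ_zero]

theorem neg_le_Jv (hM : M.Valid) : ∀ t ∈ Set.Icc (0 : ℝ) 1, -(M.E / M.ηc * M.θ * t) ≤ M.Jv t := by
  intro t ht
  have : 0 ≤ 1 / 2 * (M.E * M.R * M.Φ t) := mul_nonneg (by norm_num)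
    (mul_nonneg (mul_nonneg hM.E_pos.le hM.R_pos.le) (hM.Φ_nonneg t ht))
  rw [Jv]; linarith

theorem neg_le_Jw (hM : M.Valid) : ∀ t ∈ Set.Icc (0 : ℝ) 1, -(M.E * M.ηd * M.π * t) ≤ M.Jw t := by
  intro t ht
  have : 0 ≤ 1 / 2 * (M.E * M.R * M.Φ t) := mul_nonneg (by norm_num)
    (mul_nonneg (mul_nonneg hM.E_pos.le hM.R_pos.le) (hM.Φ_nonneg t ht))
  rw [Jw]; linarith

/-- The thresholds `u`, `v`, `w` minimize the costs of a full cycle and of the half cycles. -/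
structure Thresholds (M : Model) (u v w : ℝ) : Prop where
  u_mem : u ∈ Set.Icc (0 : ℝ) 1
  u_min : IsMinOn M.Ju (Set.Icc (0 : ℝ) 1) u
  v_mem : v ∈ Set.Icc (0 : ℝ) 1
  v_min : IsMinOn M.Jv (Set.Icc (0 : ℝ) 1) v
  w_mem : w ∈ Set.Icc (0 : ℝ) 1
  w_min : IsMinOn M.Jw (Set.Icc (0 : ℝ) 1) w

theorem Thresholds.le_of_le (hM : M.Valid) {u v w : ℝ} (h : M.Thresholds u v w)
    (hab : M.θ / M.ηc ≤ M.π * M.ηd) : v ≤ u ∧ u ≤ w := by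
  have hk : 0 ≤ M.E * (M.π * M.ηd - M.θ / M.ηc) := mul_nonneg hM.E_pos.le (by linarith)
  constructor
  · refine minimizer_le_of_add_linear (Ju_strictConvexOn hM) hk (G := fun x => 2 * M.Jv x)
      (fun x => ?_) h.u_mem h.v_mem h.u_min fun x hx => ?_
    · rw [← Jv_add_Jw]; linarith [Jv_eq_Jw_add M x]
    · have : M.Jv v ≤ M.Jv x := h.v_min hx
      simpa using this
  · refine minimizer_le_of_add_linear (F := fun x => M.Jw x + M.Jw x)
      ((Jw_strictConvexOn hM).add (Jw_strictConvexOn hM)) hk (G := M.Ju)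
      (fun x => ?_) h.w_mem h.u_mem (fun x hx => ?_) h.u_min
    · rw [← Jv_add_Jw]; linarith [Jv_eq_Jw_add M x]
    · have : M.Jw w ≤ M.Jw x := h.w_min hx
      exact add_le_add this this

theorem Thresholds.le_of_ge (hM : M.Valid) {u v w : ℝ} (h : M.Thresholds u v w)
    (hab : M.π * M.ηd ≤ M.θ / M.ηc) : w ≤ u ∧ u ≤ v := by
  have hk : 0 ≤ M.E * (M.θ / M.ηc - M.π * M.ηd) := mul_nonneg hM.E_pos.le (by linarith)
  constructor
  · refine minimizer_le_of_add_linear (Ju_strictConvexOn hM) hk (G := fun x => 2 * M.Jw x)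
      (fun x => ?_) h.u_mem h.w_mem h.u_min fun x hx => ?_
    · rw [← Jv_add_Jw]; linarith [Jv_eq_Jw_add M x]
    · have : M.Jw w ≤ M.Jw x := h.w_min hx
      simpa using this
  · refine minimizer_le_of_add_linear (F := fun x => M.Jv x + M.Jv x)
      ((Jv_strictConvexOn hM).add (Jv_strictConvexOn hM)) hk (G := M.Ju)
      (fun x => ?_) h.v_mem h.u_mem (fun x hx => ?_) h.u_min
    · rw [← Jv_add_Jw]; linarith [Jv_eq_Jw_add M x]
    · have : M.Jv v ≤ M.Jv x := h.v_min hx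
      exact add_le_add this this

/-! ### The upper bound -/

theorem cost_policy_le (hM : M.Valid) {u v w : ℝ} (h : M.Thresholds u v w) {N : ℕ} {e₀ : ℝ}
    {r : ℕ → ℝ} (he : e₀ ∈ Set.Icc M.eLo M.eHi) (hr : ∀ n < N, r n ∈ Set.Icc (-M.P) M.P)
    {x : (ℕ → ℝ) × (ℕ → ℝ)} (hx : x ∈ M.feasible N e₀)
    (hcost : M.cost N r x = strokeCost M.Jv M.Jw (profileOf N (M.level x)) + M.baseline N r +
      (M.E / M.ηc * M.θ + M.E * M.ηd * M.π) * ∑ n ∈ Finset.range N, M.excess r x n) :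
    M.cost N r (M.policy u e₀ r) - M.cost N r x ≤ M.worstGap u v w := by
  have hE := hM.E_pos
  have hKa : 0 ≤ M.E / M.ηc * M.θ :=
    mul_nonneg (div_nonneg hE.le hM.ηc_pos.le) hM.θ_nonneg
  have hKb : 0 ≤ M.E * M.ηd * M.π :=
    mul_nonneg (mul_nonneg hE.le hM.ηd_pos.le) hM.π_nonneg
  have hy := thresholdPath_policy hM h.u_mem.1 he N r
  have hz := responsePath_excess hM r hx
  have h0 : M.level (M.policy u e₀ r) 0 = M.level x 0 := by rw [level_zero, level_zero]
  have hlh : (M.eHi - e₀) / M.E - (M.eLo - e₀) / M.E ≤ 1 := by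
    rw [← sub_div, div_le_one hE]
    linarith [hM.capacity]
  rw [hcost, cost_eq_of_responsive hM (policy_mem_responsive hM h.u_mem.1 he hr)]
  have umin1 : IsMinOn (fun x => M.Jv x + M.Jw x) (Set.Icc 0 1) u := by
    simpa only [Jv_add_Jw] using h.u_min
  have umin2 : IsMinOn (fun x => M.Jw x + M.Jv x) (Set.Icc 0 1) u := by
    simpa only [add_comm (M.Jw _), Jv_add_Jw] using h.u_min
  have caseLe : M.θ / M.ηc ≤ M.π * M.ηd →
      strokeCost M.Jv M.Jw (profileOf N (M.level (M.policy u e₀ r))) ≤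
        strokeCost M.Jv M.Jw (profileOf N (M.level x)) +
        (M.E / M.ηc * M.θ + M.E * M.ηd * M.π) * ∑ n ∈ Finset.range N, M.excess r x n +
        (2 * (M.Jv u - M.Jv v) + (M.Jw u - M.Jw w)) := fun hab => by
    obtain ⟨o1, o2⟩ := h.le_of_le hM hab
    exact hy.cost_le hz h0 hlh (Jv_strictConvexOn hM).convexOn (Jw_strictConvexOn hM).convexOn
      (Jv_zero hM) (Jw_zero hM) h.u_mem h.v_mem h.w_mem umin1 h.v_min h.w_min o1 o2 hKa hKb
      (neg_le_Jv hM) (neg_le_Jw hM)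
  rw [worstGap]
  split_ifs with h1 h2
  · linarith [caseLe h1.le]
  · obtain ⟨o1, o2⟩ := h.le_of_ge hM h2.le
    have := hy.neg.cost_le hz.neg (by rw [h0]) (by linarith) (Jw_strictConvexOn hM).convexOn
      (Jv_strictConvexOn hM).convexOn (Jw_zero hM) (Jv_zero hM) h.u_mem h.w_mem h.v_mem umin2
      h.w_min h.v_min o1 o2 hKb hKa (neg_le_Jw hM) (neg_le_Jv hM)
    have e : strokeCost M.Jw M.Jv (profileOf N fun n => -M.level (M.policy u e₀ r) n) ≤
        strokeCost M.Jw M.Jv (profileOf N fun n => -M.level x n) +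
        (M.E * M.ηd * M.π + M.E / M.ηc * M.θ) * ∑ n ∈ Finset.range N, M.excess r x n +
        (2 * (M.Jw u - M.Jw w) + (M.Jv u - M.Jv v)) := this
    rw [strokeCost_neg, strokeCost_neg] at e
    linarith
  · have hab : M.θ / M.ηc = M.π * M.ηd := le_antisymm (not_lt.1 h2) (not_lt.1 h1)
    obtain ⟨o1, o2⟩ := h.le_of_le hM hab.le
    obtain ⟨o3, o4⟩ := h.le_of_ge hM hab.ge
    have := caseLe hab.le
    rw [le_antisymm o1 o4, le_antisymm o3 o2] at this
    linarith

theorem boundsGap_responsive (hM : M.Valid) {u v w : ℝ} (h : M.Thresholds u v w) :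
    M.BoundsGap u M.responsive (M.worstGap u v w) := by
  intro N e₀ r he hr x hx
  refine cost_policy_le hM h he hr hx.1 ?_
  rw [cost_eq_of_responsive hM hx, Finset.sum_eq_zero fun n hn =>
    excess_eq_zero_of_responsive hM hx n (Finset.mem_range.1 hn), mul_zero, add_zero]

theorem boundsGap_feasible (hM : M.Valid) {u v w : ℝ} (h : M.Thresholds u v w)
    (hη : M.ηc * M.ηd = 1) :
    M.BoundsGap u (fun N e₀ _ => M.feasible N e₀) (M.worstGap u v w) :=
  fun _ _ r he hr _ hx => cost_policy_le hM h he hr hx (cost_eq_of_lossless hM hη r hx)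

/-! ### The bound is attained -/

/-- The signed power that moves the normalized energy level by `s` in one interval. -/
def powerOf (M : Model) (s : ℝ) : ℝ :=
  if 0 ≤ s then s * (M.E / (M.T * M.ηc)) else s * (M.E * M.ηd / M.T)

theorem powerOf_nonneg (hM : M.Valid) {s : ℝ} (hs : 0 ≤ s) : 0 ≤ M.powerOf s := by
  rw [powerOf, if_pos hs]
  have := hM.E_pos
  have := hM.T_pos
  have := hM.ηc_pos
  positivity

theorem powerOf_neg (hM : M.Valid) {s : ℝ} (hs : s < 0) : M.powerOf s < 0 := by
  rw [powerOf, if_neg (not_le.2 hs)]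
  have := hM.E_pos
  have := hM.T_pos
  have := hM.ηd_pos
  exact mul_neg_of_neg_of_pos hs (by positivity)

theorem powerOf_mono (hM : M.Valid) : Monotone M.powerOf := by
  intro s t hst
  have := hM.E_pos
  have := hM.T_pos
  have := hM.ηd_pos
  have := hM.ηc_pos
  rcases le_or_gt 0 s with hs | hs
  · rw [powerOf, powerOf, if_pos hs, if_pos (hs.trans hst)]
    gcongr
  · rcases le_or_gt 0 t with ht | ht
    · exact (powerOf_neg hM hs).le.trans (powerOf_nonneg hM ht)
    · rw [powerOf, powerOf, if_neg (not_le.2 hs), if_neg (not_le.2 ht)]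
      gcongr

theorem abs_powerOf_le (hM : M.Valid) (s : ℝ) :
    |M.powerOf s| ≤ |s| * (M.E / (M.T * M.ηc) + M.E * M.ηd / M.T) := by
  have := hM.E_pos
  have := hM.T_pos
  have := hM.ηd_pos
  have := hM.ηc_pos
  have a : 0 ≤ M.E / (M.T * M.ηc) := by positivity
  have b : 0 ≤ M.E * M.ηd / M.T := by positivity
  rw [powerOf]
  split_ifs
  · rw [abs_mul, abs_of_nonneg a]
    gcongr
    linarith
  · rw [abs_mul, abs_of_nonneg b]
    gcongr
    linarith

theorem instructedStep_powerOf (hM : M.Valid) (ρ : ℕ → ℝ) :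
    M.instructedStep (fun n => M.powerOf (ρ n)) = ρ := by
  have := hM.E_pos
  have := hM.T_pos
  have := hM.ηd_pos
  have := hM.ηc_pos
  funext n
  rw [instructedStep]
  rcases le_or_gt 0 (ρ n) with h | h
  · rw [if_pos (powerOf_nonneg hM h), powerOf, if_pos h]
    field_simp
  · rw [if_neg (not_le.2 (powerOf_neg hM h)), powerOf, if_neg (not_le.2 h)]
    field_simp

/-- The controls that move the normalized energy level by the given steps. -/
def controlsOf (M : Model) (ξ : ℕ → ℝ) : (ℕ → ℝ) × (ℕ → ℝ) :=
  (fun n => max (M.powerOf (ξ n)) 0, fun n => max (-M.powerOf (ξ n)) 0)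

theorem level_controlsOf_succ (hM : M.Valid) (ξ : ℕ → ℝ) (n : ℕ) :
    M.level (M.controlsOf ξ) (n + 1) - M.level (M.controlsOf ξ) n = ξ n := by
  have := hM.E_pos
  have := hM.T_pos
  have := hM.ηd_pos
  have := hM.ηc_pos
  rw [level_succ]
  simp only [controlsOf]
  rcases le_or_gt 0 (ξ n) with h | h
  · have hp := powerOf_nonneg hM h
    rw [max_eq_left hp, max_eq_right (by linarith), powerOf, if_pos h]
    field_simp
    ring
  · have hp := powerOf_neg hM h
    rw [max_eq_right hp.le, max_eq_left (by linarith), powerOf, if_neg (not_le.2 h)]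
    field_simp
    ring

theorem controlsOf_mem_responsive (hM : M.Valid) {N : ℕ} {e₀ : ℝ} {ρ ξ : ℕ → ℝ}
    (hρ : ∀ n < N, |M.powerOf (ρ n)| ≤ M.P)
    (hξ : ∀ n < N, (0 ≤ ξ n ∧ ξ n ≤ ρ n) ∨ (ρ n ≤ ξ n ∧ ξ n ≤ 0))
    (hmem : ∀ n ≤ N, M.level (M.controlsOf ξ) n ∈
      Set.Icc ((M.eLo - e₀) / M.E) ((M.eHi - e₀) / M.E)) :
    M.controlsOf ξ ∈ M.responsive N e₀ fun n => M.powerOf (ρ n) := by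
  have hE := hM.E_pos
  have hP := hM.P_pos
  have p0 : M.powerOf 0 = 0 := by simp [powerOf]
  have key : ∀ n < N, max (M.powerOf (ξ n)) 0 ≤ max (M.powerOf (ρ n)) 0 ∧
      max (-M.powerOf (ξ n)) 0 ≤ max (-M.powerOf (ρ n)) 0 := by
    intro n hn
    rcases hξ n hn with ⟨h1, h2⟩ | ⟨h1, h2⟩
    · have a1 := powerOf_nonneg hM h1
      have a2 := powerOf_mono hM h2
      refine ⟨max_le_max_right _ a2, ?_⟩
      rw [max_eq_right (a := -M.powerOf (ξ n)) (by linarith)]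
      exact le_max_right _ _
    · have a1 := powerOf_mono hM h2
      have a2 := powerOf_mono hM h1
      rw [p0] at a1
      refine ⟨?_, max_le_max_right _ (by linarith)⟩
      rw [max_eq_right (a := M.powerOf (ξ n)) (by linarith)]
      exact le_max_right _ _
  refine ⟨⟨fun n hn => ?_, fun n hn => ?_⟩, key⟩
  · obtain ⟨h1, h2⟩ := hmem n hn
    rw [level, div_le_div_iff_of_pos_right hE] at h1 h2
    rw [soc_eq]
    constructor <;> linarith
  · obtain ⟨k1, k2⟩ := key n hn
    obtain ⟨a1, a2⟩ := abs_le.1 (hρ n hn)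
    refine ⟨⟨le_max_right _ _, k1.trans (max_le a2 hP.le)⟩,
      ⟨le_max_right _ _, k2.trans (max_le (by linarith) hP.le)⟩, ?_⟩
    simp only [controlsOf]
    rcases le_total 0 (M.powerOf (ξ n)) with h | h
    · exact Or.inr (max_eq_right (by linarith))
    · exact Or.inl (max_eq_right h)

theorem exists_abs_powerOf_le (hM : M.Valid) :
    ∃ K : ℕ, 0 < K ∧ ∀ s : ℝ, |s| ≤ 1 / K → |M.powerOf s| ≤ M.P := by
  have := hM.E_pos
  have := hM.T_pos
  have := hM.ηd_pos
  have := hM.ηc_pos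
  have hP := hM.P_pos
  set C := M.E / (M.T * M.ηc) + M.E * M.ηd / M.T with hC
  have hC0 : 0 < C := by positivity
  obtain ⟨K, hK⟩ := exists_nat_gt (C / M.P)
  have hK0 : (0 : ℝ) < K := lt_trans (by positivity) hK
  refine ⟨K, by exact_mod_cast hK0, fun s hs => (abs_powerOf_le hM s).trans ?_⟩
  rw [div_lt_iff₀ hP] at hK
  calc |s| * C ≤ 1 / K * C := by gcongr
    _ ≤ 1 / K * (K * M.P) := by gcongr
    _ = M.P := by field_simp

theorem abs_upDownUp_le {K : ℕ} {p q : ℝ} (hp : p ∈ Set.Icc (0 : ℝ) 1)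
    (hq : q ∈ Set.Icc (0 : ℝ) 1) (n : ℕ) : |upDownUp K p q n| ≤ 1 / K := by
  have h : ∀ x ∈ Set.Icc (0 : ℝ) 1, |x / (K : ℝ)| ≤ 1 / K := by
    intro x hx
    rw [abs_of_nonneg (div_nonneg hx.1 (Nat.cast_nonneg K))]
    gcongr
    exact hx.2
  rw [upDownUp]
  split_ifs
  · exact h p hp
  · rw [abs_neg]; exact h q hq
  · exact h p hp

theorem upDownUp_between {K : ℕ} {p p' q : ℝ} (hp : 0 ≤ p) (hpp : p ≤ p') (hq : 0 ≤ q) (n : ℕ) :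
    (0 ≤ upDownUp K p q n ∧ upDownUp K p q n ≤ upDownUp K p' q n) ∨
      (upDownUp K p' q n ≤ upDownUp K p q n ∧ upDownUp K p q n ≤ 0) := by
  simp only [upDownUp]
  split_ifs
  · exact Or.inl ⟨by positivity, by gcongr⟩
  · exact Or.inr ⟨le_rfl, by rw [neg_nonpos]; positivity⟩
  · exact Or.inl ⟨by positivity, by gcongr⟩

theorem exists_gap_eq_of_lt (hM : M.Valid) {u v w : ℝ} (h : M.Thresholds u v w)
    (hab : M.θ / M.ηc < M.π * M.ηd) (hwide : (u + |w - v|) * M.E ≤ M.eHi - M.eLo) :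
    ∃ (N : ℕ) (e₀ : ℝ) (r : ℕ → ℝ) (x : (ℕ → ℝ) × (ℕ → ℝ)),
      e₀ ∈ Set.Icc M.eLo M.eHi ∧ (∀ n < N, r n ∈ Set.Icc (-M.P) M.P) ∧
      x ∈ M.responsive N e₀ r ∧
      M.cost N r (M.policy u e₀ r) - M.cost N r x = M.worstGap u v w := by
  have hE := hM.E_pos
  obtain ⟨o1, o2⟩ := h.le_of_le hM hab.le
  obtain ⟨u0, u1⟩ := h.u_mem
  obtain ⟨v0, v1⟩ := h.v_mem
  obtain ⟨w0, w1⟩ := h.w_mem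
  rw [abs_of_nonneg (by linarith)] at hwide
  obtain ⟨K, hK, hKP⟩ := exists_abs_powerOf_le hM
  set e₀ := M.eLo + (w - v) * M.E with he₀
  have hlo : (M.eLo - e₀) / M.E = v - w := by rw [he₀]; field_simp; ring
  have hhi : u ≤ (M.eHi - e₀) / M.E := by rw [le_div_iff₀ hE, he₀]; linarith
  have he : e₀ ∈ Set.Icc M.eLo M.eHi := by
    have : 0 ≤ (w - v) * M.E := mul_nonneg (by linarith) hE.le
    have : 0 ≤ u * M.E := by positivity
    constructor <;> linarith
  have hP : ∀ n, |M.powerOf (upDownUp K u w n)| ≤ M.P := fun n =>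
    hKP _ (abs_upDownUp_le h.u_mem h.w_mem n)
  have hr : ∀ n < 3 * K, M.powerOf (upDownUp K u w n) ∈ Set.Icc (-M.P) M.P := fun n _ =>
    abs_le.1 (hP n)
  obtain ⟨x1, x2⟩ := upDownUp_path hK v0 (o1.trans o2) (level_zero M _)
    fun n _ => level_controlsOf_succ hM (upDownUp K v w) n
  have hx : M.controlsOf (upDownUp K v w) ∈
      M.responsive (3 * K) e₀ fun n => M.powerOf (upDownUp K u w n) :=
    controlsOf_mem_responsive hM (fun n _ => hP n) (fun n _ => upDownUp_between v0 o1 w0 n)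
      fun n hn => ⟨by rw [hlo]; exact (x1 n hn).1, (x1 n hn).2.trans (o1.trans hhi)⟩
  refine ⟨3 * K, e₀, _, _, he, hr, hx, ?_⟩
  have hy := thresholdPath_policy hM u0 he (3 * K) fun n => M.powerOf (upDownUp K u w n)
  rw [instructedStep_powerOf hM] at hy
  have y2 := hy.upDownUp hK u0 o2 (by rw [hlo]; linarith) hhi (level_zero M _)
  rw [cost_eq_of_responsive hM hx, cost_eq_of_responsive hM (policy_mem_responsive hM u0 he hr),
    strokeCost, strokeCost, rainflow_congr x2, rainflow_congr y2,
    rainflow_up_down_up v0 (o1.trans o2) (Jv_zero hM) (Jw_zero hM),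
    rainflow_up_down_up u0 le_rfl (Jv_zero hM) (Jw_zero hM), worstGap, if_pos hab]
  ring

theorem exists_gap_eq_of_gt (hM : M.Valid) {u v w : ℝ} (h : M.Thresholds u v w)
    (hab : M.π * M.ηd < M.θ / M.ηc) (hwide : (u + |w - v|) * M.E ≤ M.eHi - M.eLo) :
    ∃ (N : ℕ) (e₀ : ℝ) (r : ℕ → ℝ) (x : (ℕ → ℝ) × (ℕ → ℝ)),
      e₀ ∈ Set.Icc M.eLo M.eHi ∧ (∀ n < N, r n ∈ Set.Icc (-M.P) M.P) ∧
      x ∈ M.responsive N e₀ r ∧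
      M.cost N r (M.policy u e₀ r) - M.cost N r x = M.worstGap u v w := by
  have hE := hM.E_pos
  obtain ⟨o1, o2⟩ := h.le_of_ge hM hab.le
  obtain ⟨u0, u1⟩ := h.u_mem
  obtain ⟨v0, v1⟩ := h.v_mem
  obtain ⟨w0, w1⟩ := h.w_mem
  rw [abs_of_nonpos (by linarith)] at hwide
  obtain ⟨K, hK, hKP⟩ := exists_abs_powerOf_le hM
  set e₀ := M.eHi - (v - w) * M.E with he₀
  have hhi : (M.eHi - e₀) / M.E = v - w := by rw [he₀]; field_simp; ring
  have hlo : u ≤ -((M.eLo - e₀) / M.E) := by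
    rw [← neg_div, le_div_iff₀ hE, he₀]; linarith
  have he : e₀ ∈ Set.Icc M.eLo M.eHi := by
    have : 0 ≤ (v - w) * M.E := mul_nonneg (by linarith) hE.le
    have : 0 ≤ u * M.E := by positivity
    constructor <;> linarith
  have hP : ∀ n, |M.powerOf (-upDownUp K u v n)| ≤ M.P := fun n =>
    hKP _ (by rw [abs_neg]; exact abs_upDownUp_le h.u_mem h.v_mem n)
  have hr : ∀ n < 3 * K, M.powerOf (-upDownUp K u v n) ∈ Set.Icc (-M.P) M.P := fun n _ =>
    abs_le.1 (hP n)
  set ξ : ℕ → ℝ := fun n => -upDownUp K w v n with hξ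
  obtain ⟨x1, x2⟩ := upDownUp_path hK w0 (o1.trans o2)
    (z := fun n => -M.level (M.controlsOf ξ) n) (by simp [level_zero])
    fun n _ => by linarith [level_controlsOf_succ hM ξ n, congrFun hξ n]
  have hx : M.controlsOf ξ ∈
      M.responsive (3 * K) e₀ fun n => M.powerOf (-upDownUp K u v n) := by
    refine controlsOf_mem_responsive hM (fun n _ => hP n) (fun n _ => ?_) fun n hn => ?_
    · rcases upDownUp_between (K := K) w0 o1 v0 n with ⟨h1, h2⟩ | ⟨h1, h2⟩
      · exact Or.inr ⟨neg_le_neg h2, neg_nonpos.2 h1⟩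
      · exact Or.inl ⟨neg_nonneg.2 h2, neg_le_neg h1⟩
    · obtain ⟨a1, a2⟩ := x1 n hn
      rw [hhi]
      constructor <;> linarith
  refine ⟨3 * K, e₀, _, _, he, hr, hx, ?_⟩
  have hy := thresholdPath_policy hM u0 he (3 * K) fun n => M.powerOf (-upDownUp K u v n)
  rw [instructedStep_powerOf hM fun n => -upDownUp K u v n] at hy
  have hy' := hy.neg
  simp only [neg_neg] at hy'
  have y2 := hy'.upDownUp hK u0 o2 (by rw [hhi]; linarith) hlo (by simp [level_zero])
  rw [cost_eq_of_responsive hM hx, cost_eq_of_responsive hM (policy_mem_responsive hM u0 he hr),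
    ← strokeCost_neg M.Jw M.Jv _ (M.level (M.controlsOf ξ)),
    ← strokeCost_neg M.Jw M.Jv _ (M.level (M.policy u e₀ _)), strokeCost, strokeCost, rainflow_congr x2,
    rainflow_congr y2, rainflow_up_down_up w0 (o1.trans o2) (Jw_zero hM) (Jv_zero hM),
    rainflow_up_down_up u0 le_rfl (Jw_zero hM) (Jv_zero hM), worstGap, if_neg hab.not_gt,
    if_pos hab]
  ring

theorem isGreatest_gaps (hM : M.Valid) {u v w : ℝ} (h : M.Thresholds u v w)
    (hwide : M.π * M.ηd ≠ M.θ / M.ηc → (u + |w - v|) * M.E ≤ M.eHi - M.eLo)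
    {A : ℕ → ℝ → (ℕ → ℝ) → Set ((ℕ → ℝ) × (ℕ → ℝ))}
    (hA : ∀ N e₀ r, M.responsive N e₀ r ⊆ A N e₀ r)
    (hbound : M.BoundsGap u A (M.worstGap u v w)) :
    IsGreatest (M.gaps u A) (M.worstGap u v w) := by
  have ex : ∃ (N : ℕ) (e₀ : ℝ) (r : ℕ → ℝ) (x : (ℕ → ℝ) × (ℕ → ℝ)),
      e₀ ∈ Set.Icc M.eLo M.eHi ∧ (∀ n < N, r n ∈ Set.Icc (-M.P) M.P) ∧
      x ∈ M.responsive N e₀ r ∧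
      M.cost N r (M.policy u e₀ r) - M.cost N r x = M.worstGap u v w := by
    rcases lt_trichotomy (M.θ / M.ηc) (M.π * M.ηd) with hab | hab | hab
    · exact exists_gap_eq_of_lt hM h hab (hwide hab.ne')
    · have he : M.eLo ∈ Set.Icc M.eLo M.eHi := ⟨le_rfl, hM.limits⟩
      have hr : ∀ n < 0, (0 : ℝ) ∈ Set.Icc (-M.P) M.P := fun n hn => absurd hn (Nat.not_lt_zero n)
      refine ⟨0, M.eLo, fun _ => 0, _, he, hr, policy_mem_responsive hM h.u_mem.1 he hr, ?_⟩
      rw [sub_self, worstGap, if_neg hab.not_lt, if_neg hab.not_gt]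
    · exact exists_gap_eq_of_gt hM h hab (hwide hab.ne)
  constructor
  · obtain ⟨N, e₀, r, x, he, hr, hx, hgap⟩ := ex
    refine ⟨N, e₀, r, x, he, hr, hA _ _ _ hx, fun x' hx' => ?_, hgap.symm⟩
    have := hbound N e₀ r he hr x' hx'
    show M.cost N r x ≤ M.cost N r x'
    linarith
  · rintro δ ⟨N, e₀, r, x, he, hr, hx, -, rfl⟩
    exact hbound N e₀ r he hr x hx

end Model

end BatteryRegulation

end

open BatteryRegulation in
theorem theorem2 (M : Model)
    (hT : 0 < M.T) (hE : 0 < M.E) (hR : 0 < M.R) (hP : 0 < M.P)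
    (hηc : 0 < M.ηc) (hηd : 0 < M.ηd) (hθ : 0 ≤ M.θ) (hπ : 0 ≤ M.π)
    (he : M.eLo ≤ M.eHi) (hcap : M.eHi - M.eLo ≤ M.E)
    (hΦ_zero : M.Φ 0 = 0) (hΦ_nonneg : ∀ x ∈ Set.Icc (0 : ℝ) 1, 0 ≤ M.Φ x)
    (hΦ : StrictConvexOn ℝ (Set.Icc (0 : ℝ) 1) M.Φ)
    (u v w : ℝ)
    (hu : u ∈ Set.Icc (0 : ℝ) 1) (hu_min : IsMinOn M.Ju (Set.Icc (0 : ℝ) 1) u)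
    (hv : v ∈ Set.Icc (0 : ℝ) 1) (hv_min : IsMinOn M.Jv (Set.Icc (0 : ℝ) 1) v)
    (hw : w ∈ Set.Icc (0 : ℝ) 1) (hw_min : IsMinOn M.Jw (Set.Icc (0 : ℝ) 1) w) :
    -- against every control that responds within the instruction, for any efficiencies
    M.BoundsGap u M.responsive (M.worstGap u v w) ∧
    -- the bound is attained if the energy range leaves room for the depths involved
    ((M.π * M.ηd ≠ M.θ / M.ηc → (u + |w - v|) * M.E ≤ M.eHi - M.eLo) →
      IsGreatest (M.gaps u M.responsive) (M.worstGap u v w)) ∧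
    -- for a lossless battery, the same against every feasible control
    (M.ηc * M.ηd = 1 →
      M.BoundsGap u (fun N e₀ _ => M.feasible N e₀) (M.worstGap u v w) ∧
      ((M.π * M.ηd ≠ M.θ / M.ηc → (u + |w - v|) * M.E ≤ M.eHi - M.eLo) →
        IsGreatest (M.gaps u fun N e₀ _ => M.feasible N e₀) (M.worstGap u v w))) := by
  have hM : M.Valid := ⟨hT, hE, hR, hP, hηc, hηd, hθ, hπ, he, hcap, hΦ_zero, hΦ_nonneg, hΦ⟩
  have h : M.Thresholds u v w := ⟨hu, hu_min, hv, hv_min, hw, hw_min⟩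
  have h₁ := Model.boundsGap_responsive hM h
  refine ⟨h₁, fun hwide => Model.isGreatest_gaps hM h hwide (fun _ _ _ => subset_rfl) h₁,
    fun hη => ?_⟩
  have h₂ := Model.boundsGap_feasible hM h hη
  exact ⟨h₂, fun hwide => Model.isGreatest_gaps hM h hwide (fun _ _ _ _ hx => hx.1) h₂⟩
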